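/- Let $M$ be a smooth $n$-dimensional Riemannian manifold (Hausdorff, second countable, not necessarily complete) with exponential map $\exp$. Call an open set $U\subseteq M$ a normal convex neighbourhood if for every $p\in U$ there is $r\in(0,\infty]$ such that $\exp_p$ is defined on the ball $\{v\in T_pM : |v|<r\}$ and maps it diffeomorphically onto an open set containing $U$, and, for every $q\in U$, the vector $v$ of this ball with $\exp_p v=q$ satisfies $\exp_p(tv)\in U$ for all $t\in[0,1]$. For $p,q\in U$ write $\log_p q$ for the initial velocity of the unique geodesic $[0,1]\to U$ from $p$ to $q$, and $\gamma(t;p,q)=\exp_p(t\log_p q)$. The Bézier curve of degree $k$ with control points $p_0,\dots,p_k\in U$ is $\beta=\beta_0^k:[0,1]\to U$, where $\beta_i^0(t)=p_i$ and $\beta_i^r(t)=\gamma(t;\beta_i^{r-1}(t),\beta_{i+1}^{r-1}(t))$. Let $L\ge1$. A cubic Bézier spline with $L$ segments in $U$ is a map $B:[0,L]\to U$ for which there are points $p^{(i)}_j\in U$ ($0\le i\le L-1$, $0\le j\le 3$) with $p^{(i)}_3=p^{(i+1)}_0$ and $\gamma(2;p^{(i)}_2,p^{(i)}_3)=p^{(i+1)}_1$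 (in particular the left side is defined) for $0\le i\le L-2$, such that $B(t)=\beta^{(i)}(t-i)$ for $t\in(i,i+1]$ (and for $t\in[0,1]$ if $i=0$), $\beta^{(i)}$ being the cubic Bézier curve with control points $p^{(i)}_0,\dots,p^{(i)}_3$. Let $\mathcal B=\mathcal B^L_3(U)$ (the Bézierfold) be the set of all such maps. **Theorem.** Let $U$ be a normal convex neighbourhood in $M$ and $L\ge 1$. Every $B\in\mathcal B$ is $C^1$ on $[0,L]$, and the map $$F:\mathcal B\to (TU)^{L+1},\qquad F(B)=\Big(\big(B(i),\tfrac13\dot B(i)\big)\Big)_{i=0,\dots,L},$$ is injective. Its image is the set $\mathcal V$ of all $((p_i,u_i))_{i=0,\dots,L}\in(TU)^{L+1}$ such that, for all $t\in[0,1]$, $\exp_{p_i}(tu_i)$ is defined and lies in $U$ for each $i<L$, and $\exp_{p_i}(-tu_i)$ is defined and lies in $U$ for each $i>0$. In particular, if $U=M$ and $M$ is geodesically complete (for instance if $M$ is a Hadamard manifold), then $F$ is a bijection onto $(TM)^{L+1}$. The set $\mathcal V$ is open in $(TM)^{L+1}$, and $\mathcal B$ can be given the structure of a smooth (Hausdorff,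 second countable) manifold of dimension $(2L+2)n$ for which $F$ is a diffeomorphism from $\mathcal B$ onto $\mathcal V$, where $\mathcal V$ has the smooth structure of an open subset of the product $(TM)^{L+1}$. -/

import Mathlib

open Set Bundle TopologicalSpace
open scoped Manifold ContDiff Topology ENNReal

noncomputable section

namespace Bezierfold

/-! ### Geodesics, exponential map, normal convex sets -/

section Riemannian

variable {n : ℕ} {M : Type*} [TopologicalSpace M]
  [ChartedSpace (EuclideanSpace ℝ (Fin n)) M] [IsManifold (𝓡 n) ∞ M]
  [RiemannianBundle (fun x : M => TangentSpace (𝓡 n) x)]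

/-- The Riemannian metric in the preferred chart `φ` at `c`: the number
`g_{φ⁻¹ y} (d(φ⁻¹)_y v, d(φ⁻¹)_y w) = ∑ i j, g_ij(y) vⁱ wʲ`. -/
def chartMetric (c : M) (y v w : EuclideanSpace ℝ (Fin n)) : ℝ :=
  inner ℝ
    (mfderiv 𝓘(ℝ, EuclideanSpace ℝ (Fin n)) (𝓡 n) (extChartAt (𝓡 n) c).symm y v)
    (mfderiv 𝓘(ℝ, EuclideanSpace ℝ (Fin n)) (𝓡 n) (extChartAt (𝓡 n) c).symm y w)

/-- `σ` is a geodesic on the open set `s` of times: it is `C²`, and its expression `x` in the chart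
at `σ t` satisfies, at time `t`, the geodesic equation
`g_kl x''ˡ + ∂_m g_kl x'ᵐ x'ˡ = (1/2) ∂_k g_ij x'ⁱ x'ʲ` for all `k` (contracted with an arbitrary
vector `w`). Raising the index `k` turns it into `x''ᵏ + Γᵏ_ij x'ⁱ x'ʲ = 0`, with `Γ` the
Christoffel symbols of the Levi-Civita connection. -/
def IsGeodesicOn (σ : ℝ → M) (s : Set ℝ) : Prop :=
  ∀ t ∈ s, ContMDiffAt 𝓘(ℝ, ℝ) (𝓡 n) 2 σ t ∧
    let x : ℝ → EuclideanSpace ℝ (Fin n) := fun u => extChartAt (𝓡 n) (σ t) (σ u)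
    ∀ w : EuclideanSpace ℝ (Fin n),
      chartMetric (σ t) (x t) (deriv (deriv x) t) w
        + fderiv ℝ (fun y => chartMetric (σ t) y (deriv x t) w) (x t) (deriv x t)
      = 1 / 2 * fderiv ℝ (fun y => chartMetric (σ t) y (deriv x t) (deriv x t)) (x t) w

/-- The velocity of a curve, as a point of the tangent bundle. -/
def velocity (σ : ℝ → M) (t : ℝ) : TangentBundle (𝓡 n) M :=
  ⟨σ t, mfderiv 𝓘(ℝ, ℝ) (𝓡 n) σ t (1 : ℝ)⟩

/-- Multiplication by `a` in the fibres of the tangent bundle. -/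
def fiberSmul (a : ℝ) (ξ : TangentBundle (𝓡 n) M) : TangentBundle (𝓡 n) M :=
  ⟨ξ.proj, a • ξ.snd⟩

/-- `σ` is a geodesic, defined on an open interval around `[0, 1]`, with initial velocity `ξ`. -/
def IsGeodesicWithVelocity (ξ : TangentBundle (𝓡 n) M) (σ : ℝ → M) : Prop :=
  (∃ ε : ℝ, 0 < ε ∧ IsGeodesicOn (n := n) σ (Ioo (-ε) (1 + ε))) ∧ velocity σ 0 = ξ

/-- `ξ` lies in the domain of the exponential map. -/
def ExpDefined (ξ : TangentBundle (𝓡 n) M) : Prop :=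
  ∃ σ : ℝ → M, IsGeodesicWithVelocity ξ σ

open Classical in
/-- The exponential map `exp_p v`, for `ξ = (p, v)`: the position at time `1` of the geodesic
with initial velocity `ξ`. It is only meaningful if `ExpDefined ξ` holds. -/
def riemExp (ξ : TangentBundle (𝓡 n) M) : M :=
  if h : ExpDefined ξ then h.choose 1 else ξ.proj

/-- For `ξ = (p, v)`, the geodesic segment `t ↦ exp_p (t v)`, `t ∈ [0, 1]`, exists and never
leaves `U`. -/
def SegmentIn (U : Set M) (ξ : TangentBundle (𝓡 n) M) : Prop :=
  ∀ t ∈ Icc (0 : ℝ) 1, ExpDefined (fiberSmul t ξ) ∧ riemExp (fiberSmul t ξ) ∈ U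

/-- `U` is a normal convex neighbourhood: it is open and, for each `p ∈ U`, there is a ball around
`0` in `T_p M` (of possibly infinite radius `r`) which `exp_p` maps diffeomorphically onto an open
set containing `U`, such that for each `q ∈ U` the geodesic `t ↦ exp_p (t v)`, `t ∈ [0, 1]`, where
`v` is the vector of that ball with `exp_p v = q`, stays in `U`. -/
def IsNormalConvex (U : Set M) : Prop :=
  IsOpen U ∧ ∀ p ∈ U, ∃ r : ℝ≥0∞, 0 < r ∧
    (∀ v : TangentSpace (𝓡 n) p, ‖v‖ₑ < r → ExpDefined (n := n) ⟨p, v⟩) ∧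
    InjOn (fun v : TangentSpace (𝓡 n) p => riemExp (n := n) ⟨p, v⟩) {v | ‖v‖ₑ < r} ∧
    IsLocalDiffeomorphOn 𝓘(ℝ, TangentSpace (𝓡 n) p) (𝓡 n) ∞
      (fun v : TangentSpace (𝓡 n) p => riemExp (n := n) ⟨p, v⟩) {v | ‖v‖ₑ < r} ∧
    ∀ q ∈ U, ∃ v : TangentSpace (𝓡 n) p,
      ‖v‖ₑ < r ∧ riemExp (n := n) ⟨p, v⟩ = q ∧ SegmentIn (n := n) U ⟨p, v⟩

open Classical in
/-- The Riemannian logarithm on `U`: the initial velocity `(p, log_p q)` of the geodesic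
`[0, 1] → U` from `p` to `q` (unique if `U` is normal convex and `p, q ∈ U`). -/
def riemLog (U : Set M) (p q : M) : TangentBundle (𝓡 n) M :=
  if h : ∃ v : TangentSpace (𝓡 n) p, SegmentIn (n := n) U ⟨p, v⟩ ∧ riemExp (n := n) ⟨p, v⟩ = q
  then ⟨p, h.choose⟩ else ⟨p, 0⟩

/-- `γ(t; p, q) = exp_p (t log_p q)`. -/
def geod (U : Set M) (t : ℝ) (p q : M) : M :=
  riemExp (fiberSmul t (riemLog (n := n) U p q))

/-! ### Bézier curves and splines -/

/-- De Casteljau's algorithm: the value at `t` of the Bézier curve of degree `k` with control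
points `p 0, …, p k`. The curve `β_i^r` of the algorithm is the Bézier curve of degree `r` with
control points `p i, …, p (i + r)`. -/
def bezier (U : Set M) : (k : ℕ) → (Fin (k + 1) → M) → ℝ → M
  | 0, p, _ => p 0
  | k + 1, p, t =>
      geod (n := n) U t (bezier U k (fun i => p i.castSucc) t) (bezier U k (fun i => p i.succ) t)

/-- Admissible control points `P i j = p_j^{(i)}` of a cubic Bézier spline with `L` segments: they
lie in `U`, and `p_3^{(i)} = p_0^{(i+1)}` and `γ(2; p_2^{(i)}, p_3^{(i)}) = p_1^{(i+1)}`
(in particular the left side is defined) for consecutive segments. -/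
structure IsSplineControl (U : Set M) (L : ℕ) (P : Fin L → Fin 4 → M) : Prop where
  mem : ∀ i j, P i j ∈ U
  join : ∀ (i : ℕ) (h : i + 1 < L), P ⟨i, by omega⟩ 3 = P ⟨i + 1, h⟩ 0
  join_deriv : ∀ (i : ℕ) (h : i + 1 < L),
    ExpDefined (fiberSmul 2 (riemLog (n := n) U (P ⟨i, by omega⟩ 2) (P ⟨i, by omega⟩ 3))) ∧
    geod (n := n) U 2 (P ⟨i, by omega⟩ 2) (P ⟨i, by omega⟩ 3) = P ⟨i + 1, h⟩ 1

/-- `B : [0, L] → U` is the cubic Bézier spline with control points `P`: it equals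
`t ↦ β^{(i)} (t - i)` on `(i, i + 1]`, and on `[0, 1]` for `i = 0`. -/
def IsSplineWithControl (U : Set M) (L : ℕ) (P : Fin L → Fin 4 → M)
    (B : Icc (0 : ℝ) L → U) : Prop :=
  ∀ (i : Fin L) (t : Icc (0 : ℝ) L),
    (((i : ℕ) : ℝ) < t ∨ ((i : ℕ) = 0 ∧ (t : ℝ) = 0)) → (t : ℝ) ≤ ((i : ℕ) : ℝ) + 1 →
      (B t : M) = bezier (n := n) U 3 (P i) ((t : ℝ) - ((i : ℕ) : ℝ))

end Riemannian

/-- The Bézierfold of `U`: the set of all maps `B : [0, L] → U` that are cubic Bézier splines with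
`L` segments. No topology is put on it here. -/
def Spline (n : ℕ) {M : Type*} [TopologicalSpace M]
    [ChartedSpace (EuclideanSpace ℝ (Fin n)) M] [IsManifold (𝓡 n) ∞ M]
    [RiemannianBundle (fun x : M => TangentSpace (𝓡 n) x)] (U : Set M) (L : ℕ) : Type _ :=
  {B : Icc (0 : ℝ) L → U // ∃ P : Fin L → Fin 4 → M,
    IsSplineControl (n := n) U L P ∧ IsSplineWithControl (n := n) U L P B}

section Map

variable {n : ℕ} {M : Type*} [TopologicalSpace M]
  [ChartedSpace (EuclideanSpace ℝ (Fin n)) M] [IsManifold (𝓡 n) ∞ M]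
  [RiemannianBundle (fun x : M => TangentSpace (𝓡 n) x)] {U : Set M} {L : ℕ}

/-- The curve in `M` underlying a spline, extended constantly outside `[0, L]`. -/
def Spline.curve (B : Spline n U L) : ℝ → M :=
  IccExtend (Nat.cast_nonneg (α := ℝ) L) (fun t => (B.1 t : M))

/-- The derivative of a spline at `t ∈ [0, L]` (one-sided at `0` and `L`), as a point of the
tangent bundle. -/
def Spline.velocity (B : Spline n U L) (t : ℝ) : TangentBundle (𝓡 n) M :=
  ⟨B.curve t, mfderivWithin 𝓘(ℝ, ℝ) (𝓡 n) B.curve (Icc (0 : ℝ) L) t (1 : ℝ)⟩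

/-- The map `F`, sending `B` to the family of all `(B(i), Ḃ(i) / 3)`, `i = 0, …, L`. -/
def toTangent (B : Spline n U L) : Fin (L + 1) → TangentBundle (𝓡 n) M :=
  fun i => fiberSmul (1 / 3) (B.velocity ((i : ℕ) : ℝ))

variable (n U L) in
/-- The set of all families `((p_i, u_i))_{i = 0, …, L}` in `(TU)^{L+1}` such that the geodesic
segments `t ↦ exp_{p_i} (t u_i)` for `i < L` and `t ↦ exp_{p_i} (-t u_i)` for `i > 0`, with
`t ∈ [0, 1]`, exist and never leave `U`. -/
def admissible : Set (Fin (L + 1) → TangentBundle (𝓡 n) M) :=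
  {ξ | ∀ i : Fin (L + 1), (ξ i).proj ∈ U ∧
    ((i : ℕ) < L → SegmentIn U (ξ i)) ∧ (0 < (i : ℕ) → SegmentIn U (fiberSmul (-1) (ξ i)))}

end Map

end Bezierfold

end

/-!
# The manifold of cubic Bézier splines in a normal convex neighbourhood

A cubic Bézier spline is determined by its positions and derivatives at the knots. The derivative of
a cubic Bézier curve with control points `p₀, …, p₃` is `3 log_{p₀} p₁` at time `0`, and at time `1`
it is three times the velocity with which the geodesic from `p₂` to `p₃` arrives. This follows by
induction along de Casteljau's algorithm, where the curve is `t ↦ γ(t; f(t), g(t))` for two Bézier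
curves `f`, `g` of lower degree and its derivative is the sum of two partial derivatives
(`velocity_diagonal`, `IsNormalConvex.velocity_bezier_zero`, `IsNormalConvex.velocity_bezier_one`).
The join conditions of a spline therefore say that consecutive segments have the same derivative at
their common knot (`IsSplineControl.expVel_riemLog`), which makes the spline `C¹`. Writing
`(pᵢ, uᵢ)` for the position and a third of the derivative at the knot `i`, the control points of the
`i`-th segment are `pᵢ`, `exp(uᵢ)`, `exp(-uᵢ₊₁)`, `pᵢ₊₁`. Hence `F` is injective. Conversely, these
formulas define a spline whenever the geodesic segments involved stay in `U`: at an inner knot, the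
segments of `-uᵢ` and `uᵢ` form one geodesic, which is the join condition (`range_toTangent`). The
set of admissible families is open because the condition on each segment is open
(`isOpen_segmentIn`), and the smooth structure of the Bézierfold is transported from it along `F`
(`exists_transport`).

Normal convexity enters through the fact that a geodesic segment in `U` that starts at `p ∈ U` has
its initial vector in the ball on which `exp_p` is a diffeomorphism (`SegmentIn.enorm_lt`). So
geodesic segments in `U` are determined by their endpoints. It also follows that a segment from a
point of `U` to a point of `U` whose backward extension of the same length stays in `U` stays in `U`
itself (`IsNormalConvex.segmentIn_of_neg`); this is used at the joins.

The analysis needs only `C¹` dependence of geodesics on their initial velocity. In a chart,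
the geodesics are the integral curves of a smooth vector field, and this description does not depend
on the chart (`EulerLagrange.of_pullback`, `isGeodesicOn_singleton_iff`). Local flows are
differentiated in the initial value by comparison with the linearised equation (`exists_local_flow`)
and then extended along a geodesic by compactness (`ExpDefined.hasFlowAt`). Thus `exp` is `C¹` on
its open domain, and the inverse function theorem gives that `log` is `C¹` on `U × U`
(`IsNormalConvex.contMDiffAt_riemLog`).
-/

noncomputable section

set_option maxSynthPendingDepth 3

namespace Bezierfold

/-! ### Differentiable dependence of solutions of differential equations on initial values -/

section Flow

open Metric

variable {E : Type*} [NormedAddCommGroup E] [NormedSpace ℝ E]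

/-- First-order Taylor estimate with quadratic remainder, for a function whose derivative is
Lipschitz on a convex set. -/
theorem norm_taylor_one_le {f : E → E} {s : Set E} (hs : Convex ℝ s)
    (hf : ∀ x ∈ s, DifferentiableAt ℝ f x) {M : NNReal} (hM : LipschitzOnWith M (fderiv ℝ f) s)
    {x y : E} (hx : x ∈ s) (hy : y ∈ s) :
    ‖f y - f x - fderiv ℝ f x (y - x)‖ ≤ M * ‖y - x‖ ^ 2 := by
  have hseg : segment ℝ x y ⊆ s := hs.segment_subset hx hy
  have := (convex_segment x y).norm_image_sub_le_of_norm_hasFDerivWithin_le'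
    (f := f) (f' := fderiv ℝ f) (φ := fderiv ℝ f x) (C := M * ‖y - x‖)
    (fun z hz => (hf z (hseg hz)).hasFDerivAt.hasFDerivWithinAt) (fun z hz => by
      refine (hM.norm_sub_le (hseg hz) hx).trans ?_
      gcongr
      exact norm_sub_le_of_mem_segment hz) (left_mem_segment ℝ x y) (right_mem_segment ℝ x y)
  calc _ ≤ M * ‖y - x‖ * ‖y - x‖ := this
    _ = _ := by ring

/-- A solution `x` of `x' = f x` depends differentiably on its initial value, with derivative the
solution `Y` of the linearised equation: the deviation of a second solution `y` from its linear
prediction `x + Y (y 0 - x 0)` is quadratic in `y 0 - x 0`, by Grönwall's inequality. -/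
theorem norm_flow_sub_le {f : E → E} {s : Set E} (hs : Convex ℝ s)
    (hf : ∀ x ∈ s, DifferentiableAt ℝ f x) {M K : NNReal} (hM : LipschitzOnWith M (fderiv ℝ f) s)
    (hK : ∀ x ∈ s, ‖fderiv ℝ f x‖ ≤ K) {T : ℝ} (hT : 0 ≤ T) {x y : ℝ → E} {Y : ℝ → E →L[ℝ] E}
    (hx : ∀ t ∈ Icc 0 T, x t ∈ s ∧ HasDerivAt x (f (x t)) t)
    (hy : ∀ t ∈ Icc 0 T, y t ∈ s ∧ HasDerivAt y (f (y t)) t)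
    (hY : ∀ t ∈ Icc 0 T, HasDerivAt Y ((fderiv ℝ f (x t)).comp (Y t)) t)
    (hY0 : Y 0 = ContinuousLinearMap.id ℝ E) :
    ‖y T - x T - Y T (y 0 - x 0)‖
      ≤ gronwallBound 0 K (M * Real.exp (K * T) ^ 2) T * ‖y 0 - x 0‖ ^ 2 := by
  have hlip : LipschitzOnWith K f s := hs.lipschitzOnWith_of_nnnorm_hasFDerivWithin_le
    (fun z hz => (hf z hz).hasFDerivAt.hasFDerivWithinAt) (fun z hz => hK z hz)
  have hd : ∀ t ∈ Icc 0 T, ‖y t - x t‖ ≤ ‖y 0 - x 0‖ * Real.exp (K * T) := by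
    intro t ht
    have := dist_le_of_trajectories_ODE_of_mem (v := fun _ => f) (s := fun _ => s) (a := 0) (b := T)
      (K := K) (f := y) (g := x) (δ := ‖y 0 - x 0‖) (fun _ _ => hlip)
      (fun t ht => (hy t ht).2.continuousAt.continuousWithinAt)
      (fun t ht => (hy t ⟨ht.1, ht.2.le⟩).2.hasDerivWithinAt) (fun t ht => (hy t ⟨ht.1, ht.2.le⟩).1)
      (fun t ht => (hx t ht).2.continuousAt.continuousWithinAt)
      (fun t ht => (hx t ⟨ht.1, ht.2.le⟩).2.hasDerivWithinAt) (fun t ht => (hx t ⟨ht.1, ht.2.le⟩).1)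
      (by rw [dist_eq_norm]) t ht
    rw [dist_eq_norm] at this
    refine this.trans ?_
    gcongr
    linarith [ht.2]
  set h := y 0 - x 0 with hh
  have key := norm_le_gronwallBound_of_norm_deriv_right_le (E := E) (a := 0) (b := T)
    (f := fun t => y t - x t - Y t h)
    (f' := fun t => f (y t) - f (x t) - (fderiv ℝ f (x t)).comp (Y t) h)
    (δ := 0) (K := K) (ε := M * (‖h‖ * Real.exp (K * T)) ^ 2)
    (fun t ht => (((hy t ht).2.sub (hx t ht).2).sub
      ((hY t ht).clm_apply (hasDerivAt_const t h))).continuousAt.continuousWithinAt)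
    (fun t ht => by
      have := (((hy t ⟨ht.1, ht.2.le⟩).2.sub (hx t ⟨ht.1, ht.2.le⟩).2).sub
        ((hY t ⟨ht.1, ht.2.le⟩).clm_apply (hasDerivAt_const t h))).hasDerivWithinAt (s := Ici t)
      exact this.congr_deriv (by simp))
    (by simp [hY0, hh])
    (fun t ht => by
      have ht' : t ∈ Icc 0 T := ⟨ht.1, ht.2.le⟩
      have h1 := norm_taylor_one_le hs hf hM (hx t ht').1 (hy t ht').1
      have e : f (y t) - f (x t) - (fderiv ℝ f (x t)).comp (Y t) h
          = fderiv ℝ f (x t) (y t - x t - Y t h)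
            + (f (y t) - f (x t) - fderiv ℝ f (x t) (y t - x t)) := by
        simp only [ContinuousLinearMap.comp_apply, map_sub]; abel
      rw [e]
      refine (norm_add_le _ _).trans (add_le_add ?_ (h1.trans ?_))
      · exact (ContinuousLinearMap.le_opNorm _ _).trans (by gcongr; exact hK _ (hx t ht').1)
      · gcongr; exact hd t ht') T ⟨hT, le_rfl⟩
  refine key.trans (le_of_eq ?_)
  simp only [sub_zero]
  by_cases hK0 : (K : ℝ) = 0
  · rw [hK0, gronwallBound_K0, gronwallBound_K0]; simp; ring
  · rw [gronwallBound_of_K_ne_0 hK0, gronwallBound_of_K_ne_0 hK0]; field_simp; ring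

/-- A `C²` vector field has a local flow, whose maps for small positive times are `C¹`. The flow
and its derivative are obtained together, as the flow of `(x, Y)' = (f x, Df x ∘ Y)`. -/
theorem exists_local_flow [CompleteSpace E] {f : E → E} {O : Set E} (hO : IsOpen O)
    (hf : ContDiffOn ℝ 2 f O) {z₀ : E} (hz₀ : z₀ ∈ O) :
    ∃ ε > 0, ∃ N : Set E, IsOpen N ∧ z₀ ∈ N ∧ ∃ φ : E → ℝ → E, ∀ z ∈ N, φ z 0 = z ∧
      (∀ t ∈ Ioo (-ε) ε, φ z t ∈ O ∧ HasDerivAt (φ z) (f (φ z t)) t) ∧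
      ∀ t ∈ Ico 0 ε, ContDiffAt ℝ 1 (fun z => φ z t) z := by
  have hf0 : ContDiffAt ℝ 2 f z₀ := hf.contDiffAt (hO.mem_nhds hz₀)
  have hDf : ContDiffAt ℝ 1 (fderiv ℝ f) z₀ :=
    hf0.fderiv_right (m := 1) (by norm_num)
  obtain ⟨M, s₁, hs₁, hM⟩ := hDf.exists_lipschitzOnWith
  obtain ⟨K, hK⟩ : ∃ K : NNReal, ∀ᶠ z in 𝓝 z₀, ‖fderiv ℝ f z‖ ≤ K := by
    refine ⟨‖fderiv ℝ f z₀‖₊ + 1, ?_⟩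
    have := hDf.continuousAt.norm.eventually_lt_const
      (show ‖fderiv ℝ f z₀‖ < ‖fderiv ℝ f z₀‖ + 1 by linarith)
    filter_upwards [this] with z hz
    simpa using hz.le
  obtain ⟨a, ha, has⟩ := Metric.mem_nhds_iff.1
    (Filter.inter_mem (Filter.inter_mem (hO.mem_nhds hz₀) hs₁) hK)
  -- the vector field of the original equation together with its linearisation; it is only `C¹`,
  -- so that Picard–Lindelöf gives a continuous flow `α`
  let G : E × (E →L[ℝ] E) → E × (E →L[ℝ] E) := fun p => (f p.1, (fderiv ℝ f p.1).comp p.2)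
  have hG : ContDiffAt ℝ 1 G (z₀, ContinuousLinearMap.id ℝ E) := by
    refine ContDiffAt.prodMk ?_ ?_
    · exact (hf0.of_le (by norm_num)).comp (z₀, ContinuousLinearMap.id ℝ E) contDiffAt_fst
    · exact (hDf.comp (z₀, ContinuousLinearMap.id ℝ E) contDiffAt_fst).clm_comp contDiffAt_snd
  obtain ⟨ε, hε, A, r, L, K', hr, hP⟩ := IsPicardLindelof.of_contDiffAt_one hG
  obtain ⟨α, hα, hαc⟩ := (hP 0).exists_forall_mem_closedBall_eq_hasDerivWithinAt_continuousOn
  set I := ContinuousLinearMap.id ℝ E with hI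
  have hα0 : ContinuousAt α ((z₀, I), 0) := by
    refine hαc.continuousAt (prod_mem_nhds (closedBall_mem_nhds _ (by exact_mod_cast hr)) ?_)
    exact Icc_mem_nhds (by simpa using hε) (by simpa using hε)
  have hα00 : α ((z₀, I), 0) = (z₀, I) := (hα (z₀, I) (mem_closedBall_self r.2)).1
  have hev : ∀ᶠ p : E × ℝ in 𝓝 (z₀, 0), (α ((p.1, I), p.2)).1 ∈ ball z₀ a := by
    have hc : ContinuousAt (fun p : E × ℝ => (α ((p.1, I), p.2)).1) (z₀, 0) := by
      have : ContinuousAt (fun p : E × ℝ => (((p.1, I), p.2) : (E × (E →L[ℝ] E)) × ℝ)) (z₀, 0) := by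
        fun_prop
      exact continuous_fst.continuousAt.comp (ContinuousAt.comp (f := fun p : E × ℝ =>
        (((p.1, I), p.2) : (E × (E →L[ℝ] E)) × ℝ)) hα0 this)
    refine hc.eventually_mem ?_
    simp only [hα00]
    exact ball_mem_nhds _ ha
  rw [nhds_prod_eq, Filter.eventually_prod_iff] at hev
  obtain ⟨p1, hp1, p2, hp2, hpp⟩ := hev
  obtain ⟨r₁, hr₁, hr₁'⟩ := Metric.eventually_nhds_iff_ball.1 hp1
  obtain ⟨ε₁, hε₁, hε₁'⟩ := Metric.eventually_nhds_iff_ball.1 hp2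
  have hr' : (0 : ℝ) < r := by exact_mod_cast hr
  refine ⟨min ε ε₁, lt_min hε hε₁, ball z₀ (min r r₁), isOpen_ball,
    mem_ball_self (lt_min hr' hr₁), fun z t => (α ((z, I), t)).1, ?_⟩
  have hmem : ∀ z ∈ ball z₀ (min r r₁), ((z, I) : E × (E →L[ℝ] E)) ∈ closedBall (z₀, I) r := by
    intro z hz
    rw [mem_ball, lt_min_iff] at hz
    simp [mem_closedBall, Prod.dist_eq, hz.1.le]
  have hball : ∀ z ∈ ball z₀ (min r r₁), ∀ t ∈ Ioo (-(min ε ε₁)) (min ε ε₁),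
      (α ((z, I), t)).1 ∈ ball z₀ a := by
    intro z hz t ht
    rw [mem_ball, lt_min_iff] at hz
    refine hpp (hr₁' z hz.2) (hε₁' t ?_)
    rw [mem_ball, Real.dist_eq, sub_zero, abs_lt]
    have := min_le_right ε ε₁
    exact ⟨by linarith [ht.1], by linarith [ht.2]⟩
  have hder : ∀ z ∈ ball z₀ (min r r₁), ∀ t ∈ Ioo (-(min ε ε₁)) (min ε ε₁),
      HasDerivAt (fun t => α ((z, I), t)) (G (α ((z, I), t))) t := by
    intro z hz t ht
    have := min_le_left ε ε₁
    have h1 : -ε < t := by linarith [ht.1]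
    have h2 : t < ε := by linarith [ht.2]
    exact ((hα _ (hmem z hz)).2 t (by simp [h1.le, h2.le])).hasDerivAt
      (Icc_mem_nhds (by simpa using h1) (by simpa using h2))
  have hfst : ∀ z ∈ ball z₀ (min r r₁), ∀ t ∈ Ioo (-(min ε ε₁)) (min ε ε₁),
      HasDerivAt (fun t => (α ((z, I), t)).1) (f (α ((z, I), t)).1) t := fun z hz t ht =>
    ((ContinuousLinearMap.fst ℝ E (E →L[ℝ] E)).hasFDerivAt.comp_hasDerivAt t (hder z hz t ht))
  have hsnd : ∀ z ∈ ball z₀ (min r r₁), ∀ t ∈ Ioo (-(min ε ε₁)) (min ε ε₁),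
      HasDerivAt (fun t => (α ((z, I), t)).2)
        ((fderiv ℝ f (α ((z, I), t)).1).comp (α ((z, I), t)).2) t := fun z hz t ht =>
    ((ContinuousLinearMap.snd ℝ E (E →L[ℝ] E)).hasFDerivAt.comp_hasDerivAt t (hder z hz t ht))
  -- the second component of `α` is the derivative of the first one in the initial value
  have hfd : ∀ z ∈ ball z₀ (min r r₁), ∀ t ∈ Ico 0 (min ε ε₁),
      HasFDerivAt (fun z => (α ((z, I), t)).1) (α ((z, I), t)).2 z := by
    intro z hz t ht
    have hsub : ∀ u ∈ Icc 0 t, u ∈ Ioo (-(min ε ε₁)) (min ε ε₁) := fun u hu =>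
      ⟨by linarith [lt_min hε hε₁, hu.1], by linarith [ht.2, hu.2]⟩
    have hbig : (fun z' => (α ((z', I), t)).1 - (α ((z, I), t)).1 - (α ((z, I), t)).2 (z' - z))
        =O[𝓝 z] fun z' => ‖z' - z‖ ^ 2 := by
      refine Asymptotics.IsBigO.of_bound
        (gronwallBound 0 K (M * Real.exp (K * t) ^ 2) t) ?_
      filter_upwards [isOpen_ball.mem_nhds hz] with z' hz'
      have := norm_flow_sub_le (f := f) (s := ball z₀ a) (convex_ball z₀ a)
        (fun x hx => (hf.contDiffAt (hO.mem_nhds (has hx).1.1)).differentiableAt (by norm_num))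
        (hM.mono fun x hx => (has hx).1.2) (K := K) (fun x hx => (has hx).2) ht.1
        (x := fun u => (α ((z, I), u)).1) (y := fun u => (α ((z', I), u)).1)
        (Y := fun u => (α ((z, I), u)).2)
        (fun u hu => ⟨hball z hz u (hsub u hu), hfst z hz u (hsub u hu)⟩)
        (fun u hu => ⟨hball z' hz' u (hsub u hu), hfst z' hz' u (hsub u hu)⟩)
        (fun u hu => hsnd z hz u (hsub u hu))
        (show (α ((z, I), 0)).2 = I from congrArg (fun p => p.2) (hα _ (hmem z hz)).1)
      simpa [(hα _ (hmem z hz)).1, (hα _ (hmem z' hz')).1] using this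
    have h0 := hbig.hasFDerivAt (𝕜 := ℝ) (by norm_num)
    have h1 : HasFDerivAt (fun z' => (α ((z, I), t)).1 + (α ((z, I), t)).2 (z' - z))
        (α ((z, I), t)).2 z := by
      simpa [map_sub] using
        ((α ((z, I), t)).2.hasFDerivAt (x := z)).sub_const ((α ((z, I), t)).2 z) |>.const_add
          (α ((z, I), t)).1
    have h2 := h0.add h1
    rw [zero_add] at h2
    refine h2.congr_of_eventuallyEq (Filter.Eventually.of_forall fun z' => ?_)
    simp
  refine fun z hz => ⟨by simp [(hα _ (hmem z hz)).1], fun t ht =>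
    ⟨(has (hball z hz t ht)).1.1, hfst z hz t ht⟩, fun t ht => ?_⟩
  refine contDiffAt_one_iff.2 ⟨fun z => (α ((z, I), t)).2, _, isOpen_ball.mem_nhds hz, ?_,
    fun z' hz' => hfd z' hz' t ht⟩
  have hmt : MapsTo (fun z : E => (((z, I), t) : (E × (E →L[ℝ] E)) × ℝ)) (ball z₀ (min r r₁))
      (closedBall (z₀, I) r ×ˢ Icc (0 - ε) (0 + ε)) := by
    intro z hz
    have := min_le_left ε ε₁
    exact ⟨hmem z hz, by rw [mem_Icc]; constructor <;> linarith [ht.1, ht.2]⟩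
  exact continuous_snd.comp_continuousOn (hαc.comp (by fun_prop) hmt)

end Flow

/-! ### Charts of the tangent bundle -/

section TangentCharts

variable {n : ℕ} {M : Type*} [TopologicalSpace M]
  [ChartedSpace (EuclideanSpace ℝ (Fin n)) M]

local notation "𝔼" => EuclideanSpace ℝ (Fin n)

/-- The coordinates `(x, v)` of a tangent vector in the chart of `M` at `c`. -/
def tchart (c : M) (ξ : TangentBundle (𝓡 n) M) : 𝔼 × 𝔼 :=
  (extChartAt (𝓡 n) c ξ.proj, mfderiv (𝓡 n) 𝓘(ℝ, 𝔼) (extChartAt (𝓡 n) c) ξ.proj ξ.snd)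

/-- The tangent vector with coordinates `(x, v)` in the chart of `M` at `c`. -/
def tsymm (c : M) (z : 𝔼 × 𝔼) : TangentBundle (𝓡 n) M :=
  ⟨(extChartAt (𝓡 n) c).symm z.1,
    mfderiv 𝓘(ℝ, 𝔼) (𝓡 n) (extChartAt (𝓡 n) c).symm z.1 z.2⟩

theorem tchart_fiberSmul (c : M) (a : ℝ) (ξ : TangentBundle (𝓡 n) M) :
    tchart c (fiberSmul a ξ) = ((tchart c ξ).1, a • (tchart c ξ).2) :=
  Prod.ext rfl (map_smul _ a ξ.snd)

theorem fiberSmul_tsymm (c : M) (a : ℝ) (z : 𝔼 × 𝔼) :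
    fiberSmul a (tsymm c z) = tsymm c (z.1, a • z.2) := by
  have h := map_smul (mfderiv 𝓘(ℝ, 𝔼) (𝓡 n) (extChartAt (𝓡 n) c).symm z.1) a z.2
  exact congrArg (fun v => (⟨_, v⟩ : TangentBundle (𝓡 n) M)) h.symm

variable [IsManifold (𝓡 n) ∞ M]

theorem contMDiffAt_chart_symm (c : M) {y : 𝔼} (hy : y ∈ (extChartAt (𝓡 n) c).target) :
    ContMDiffAt 𝓘(ℝ, 𝔼) (𝓡 n) ∞ (extChartAt (𝓡 n) c).symm y :=
  (contMDiffOn_extChartAt_symm c).contMDiffAt ((isOpen_extChartAt_target c).mem_nhds hy)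

theorem contMDiffAt_chart (c : M) {p : M} (hp : p ∈ (extChartAt (𝓡 n) c).source) :
    ContMDiffAt (𝓡 n) 𝓘(ℝ, 𝔼) ∞ (extChartAt (𝓡 n) c) p :=
  contMDiffAt_extChartAt' (by simpa using hp)

/-- `tchart c` is the chart of the tangent bundle provided by Mathlib. -/
theorem tchart_eq (c : M) {ξ : TangentBundle (𝓡 n) M}
    (h : ξ.proj ∈ (extChartAt (𝓡 n) c).source) :
    tchart c ξ = extChartAt (𝓡 n).tangent (⟨c, 0⟩ : TangentBundle (𝓡 n) M) ξ := by
  rw [extChartAt_source] at h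
  have : IsManifold (𝓡 n) 1 M := IsManifold.of_le (n := ∞) (by simp)
  have e := TangentBundle.continuousLinearMapAt_trivializationAt (I := 𝓡 n) h
  refine Prod.ext rfl ?_
  have e2 := congrArg (fun A => A ξ.snd) e
  exact e2.symm.trans (by
    rw [Bundle.Trivialization.continuousLinearMapAt_apply,
      Bundle.Trivialization.linearMapAt_apply, if_pos (by simpa using h)]
    rfl)

theorem tchart_tsymm (c : M) {z : 𝔼 × 𝔼} (h : z.1 ∈ (extChartAt (𝓡 n) c).target) :
    tchart c (tsymm c z) = z := by
  refine Prod.ext ((extChartAt (𝓡 n) c).right_inv h) ?_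
  have : IsManifold (𝓡 n) 1 M := IsManifold.of_le (n := ∞) (by simp)
  have := mfderiv_extChartAt_comp_mfderivWithin_extChartAt_symm (I := 𝓡 n) h
  rw [ModelWithCorners.range_eq_univ, mfderivWithin_univ] at this
  exact congrArg (fun A => A z.2) this

omit [IsManifold (𝓡 n) ∞ M] in
theorem tsymm_proj_mem (c : M) {z : 𝔼 × 𝔼} (h : z.1 ∈ (extChartAt (𝓡 n) c).target) :
    (tsymm c z).proj ∈ (extChartAt (𝓡 n) c).source :=
  (extChartAt (𝓡 n) c).map_target h

omit [IsManifold (𝓡 n) ∞ M] in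
theorem tchart_mem (c : M) {ξ : TangentBundle (𝓡 n) M}
    (h : ξ.proj ∈ (extChartAt (𝓡 n) c).source) : (tchart c ξ).1 ∈ (extChartAt (𝓡 n) c).target :=
  (extChartAt (𝓡 n) c).map_source h

theorem mem_tangent_source_iff (c : M) {ξ : TangentBundle (𝓡 n) M} :
    ξ ∈ (extChartAt (𝓡 n).tangent (⟨c, 0⟩ : TangentBundle (𝓡 n) M)).source ↔
      ξ.proj ∈ (extChartAt (𝓡 n) c).source := by
  rw [extChartAt_source, extChartAt_source, TangentBundle.mem_chart_source_iff]

theorem tsymm_eq (c : M) {z : 𝔼 × 𝔼} (h : z.1 ∈ (extChartAt (𝓡 n) c).target) :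
    tsymm c z = (extChartAt (𝓡 n).tangent (⟨c, 0⟩ : TangentBundle (𝓡 n) M)).symm z := by
  have h1 := tsymm_proj_mem c h
  have key := tchart_tsymm c h
  rw [tchart_eq c h1] at key
  rw [← key, PartialEquiv.left_inv]
  · rw [key]
  · exact (mem_tangent_source_iff c).2 h1

theorem mem_tangent_target_iff (c : M) {z : 𝔼 × 𝔼} :
    z ∈ (extChartAt (𝓡 n).tangent (⟨c, 0⟩ : TangentBundle (𝓡 n) M)).target ↔
      z.1 ∈ (extChartAt (𝓡 n) c).target := by
  constructor
  · intro h
    have h1 := (mem_tangent_source_iff c).1 ((extChartAt (𝓡 n).tangent _).map_target h)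
    have h2 := tchart_mem c h1
    rwa [tchart_eq c h1, PartialEquiv.right_inv _ h] at h2
  · intro h
    have := (extChartAt (𝓡 n).tangent (⟨c, 0⟩ : TangentBundle (𝓡 n) M)).map_source
      ((mem_tangent_source_iff c).2 (tsymm_proj_mem c h))
    rwa [← tchart_eq c (tsymm_proj_mem c h), tchart_tsymm c h] at this

theorem tsymm_tchart (c : M) {ξ : TangentBundle (𝓡 n) M}
    (h : ξ.proj ∈ (extChartAt (𝓡 n) c).source) : tsymm c (tchart c ξ) = ξ := by
  rw [tsymm_eq c (tchart_mem c h), tchart_eq c h, PartialEquiv.left_inv]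
  exact (mem_tangent_source_iff c).2 h

theorem contMDiffAt_tchart (c : M) {ξ : TangentBundle (𝓡 n) M}
    (h : ξ.proj ∈ (extChartAt (𝓡 n) c).source) :
    ContMDiffAt (𝓡 n).tangent 𝓘(ℝ, 𝔼 × 𝔼) ∞ (tchart c) ξ := by
  have h0 := (mem_tangent_source_iff c).2 h
  have : ContMDiffAt (𝓡 n).tangent 𝓘(ℝ, 𝔼 × 𝔼) ∞
      (extChartAt (𝓡 n).tangent (⟨c, 0⟩ : TangentBundle (𝓡 n) M)) ξ :=
    contMDiffAt_extChartAt' (by rwa [extChartAt_source] at h0)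
  refine this.congr_of_eventuallyEq ?_
  filter_upwards [(isOpen_extChartAt_source (I := (𝓡 n).tangent)
    (⟨c, 0⟩ : TangentBundle (𝓡 n) M)).mem_nhds h0] with η hη
  exact tchart_eq c ((mem_tangent_source_iff c).1 hη)

theorem contMDiffAt_tsymm (c : M) {z : 𝔼 × 𝔼} (h : z.1 ∈ (extChartAt (𝓡 n) c).target) :
    ContMDiffAt 𝓘(ℝ, 𝔼 × 𝔼) (𝓡 n).tangent ∞ (tsymm c) z := by
  have ho : IsOpen (extChartAt (𝓡 n).tangent (⟨c, 0⟩ : TangentBundle (𝓡 n) M)).target :=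
    isOpen_extChartAt_target _
  have hz := (mem_tangent_target_iff c).2 h
  refine ((contMDiffOn_extChartAt_symm (I := (𝓡 n).tangent)
    (⟨c, 0⟩ : TangentBundle (𝓡 n) M)).contMDiffAt (ho.mem_nhds hz)).congr_of_eventuallyEq ?_
  filter_upwards [ho.mem_nhds hz] with w hw
  exact tsymm_eq c ((mem_tangent_target_iff c).1 hw)

theorem tchart_self (p : M) (v : TangentSpace (𝓡 n) p) :
    tchart p ⟨p, v⟩ = (extChartAt (𝓡 n) p p, v) := by
  have : IsManifold (𝓡 n) 1 M := IsManifold.of_le (n := ∞) (by simp)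
  exact Prod.ext rfl (congrArg (fun A => A v) (mfderiv_extChartAt_self (I := 𝓡 n) (x := p)))

theorem tsymm_self (p : M) (v : 𝔼) : tsymm p (extChartAt (𝓡 n) p p, v) = ⟨p, v⟩ := by
  exact (congrArg (tsymm p) (tchart_self p v).symm).trans
    (tsymm_tchart p (mem_extChartAt_source p))

/-- The coordinates of the velocity of a curve are the derivative of its coordinates. -/
theorem hasDerivAt_chart_comp {σ : ℝ → M} {t : ℝ} (c : M)
    (hσ : MDifferentiableAt 𝓘(ℝ, ℝ) (𝓡 n) σ t) (h : σ t ∈ (extChartAt (𝓡 n) c).source) :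
    HasDerivAt (fun u => extChartAt (𝓡 n) c (σ u)) (tchart c (velocity σ t)).2 t := by
  have h1 : MDifferentiableAt (𝓡 n) 𝓘(ℝ, 𝔼) (extChartAt (𝓡 n) c) (σ t) :=
    (contMDiffAt_chart c h).mdifferentiableAt (by simp)
  let A : ℝ →L[ℝ] 𝔼 := (mfderiv (𝓡 n) 𝓘(ℝ, 𝔼) (extChartAt (𝓡 n) c) (σ t)).comp
    (mfderiv 𝓘(ℝ, ℝ) (𝓡 n) σ t)
  have h2 : HasFDerivAt (fun u => extChartAt (𝓡 n) c (σ u)) A t :=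
    (h1.hasMFDerivAt.comp t hσ.hasMFDerivAt).hasFDerivAt
  exact h2.hasDerivAt

theorem tchart_velocity {σ : ℝ → M} {t : ℝ} (c : M)
    (hσ : MDifferentiableAt 𝓘(ℝ, ℝ) (𝓡 n) σ t) (h : σ t ∈ (extChartAt (𝓡 n) c).source) :
    tchart c (velocity σ t)
      = (extChartAt (𝓡 n) c (σ t), deriv (fun u => extChartAt (𝓡 n) c (σ u)) t) :=
  Prod.ext rfl (hasDerivAt_chart_comp c hσ h).deriv.symm

theorem tangent_ext (c : M) {ξ η : TangentBundle (𝓡 n) M}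
    (hξ : ξ.proj ∈ (extChartAt (𝓡 n) c).source) (hη : η.proj ∈ (extChartAt (𝓡 n) c).source)
    (h : tchart c ξ = tchart c η) : ξ = η := by
  rw [← tsymm_tchart c hξ, h, tsymm_tchart c hη]

omit [IsManifold (𝓡 n) ∞ M] in
theorem tangent_mk_eq {p q : M} (h : p = q) {v w : 𝔼} (h' : v = w) :
    (⟨p, v⟩ : TangentBundle (𝓡 n) M) = ⟨q, w⟩ := by
  subst h h'; rfl

omit [IsManifold (𝓡 n) ∞ M] in
theorem velocity_congr {σ τ : ℝ → M} {t : ℝ} (h : σ =ᶠ[𝓝 t] τ) :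
    velocity (n := n) σ t = velocity τ t := by
  have e := h.mfderiv_eq (I := 𝓘(ℝ, ℝ)) (I' := 𝓡 n)
  exact tangent_mk_eq h.self_of_nhds (congrArg (fun A : ℝ →L[ℝ] 𝔼 => A 1) e)

omit [IsManifold (𝓡 n) ∞ M] in
theorem velocity_comp_affine {σ : ℝ → M} {a b t : ℝ}
    (h : MDifferentiableAt 𝓘(ℝ, ℝ) (𝓡 n) σ (a * t + b)) :
    velocity (n := n) (fun u => σ (a * u + b)) t = fiberSmul a (velocity σ (a * t + b)) := by
  have h1 : HasDerivAt (fun u : ℝ => a * u + b) a t := by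
    simpa using ((hasDerivAt_id t).const_mul a).add_const b
  have h2 := (h.hasMFDerivAt.comp t h1.hasFDerivAt.hasMFDerivAt).mfderiv
  let A : ℝ →L[ℝ] 𝔼 := mfderiv 𝓘(ℝ, ℝ) (𝓡 n) σ (a * t + b)
  have h3 : A a = a • A 1 := by rw [← map_smul, smul_eq_mul, mul_one]
  refine tangent_mk_eq rfl ((congrArg (fun A : ℝ →L[ℝ] 𝔼 => A 1) h2).trans (Eq.trans ?_ h3))
  change A ((ContinuousLinearMap.toSpanSingleton ℝ a) 1) = A a
  simp

end TangentCharts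

/-! ### The geodesic equation in a fixed chart -/

section EulerLagrange

variable {E : Type*} [NormedAddCommGroup E] [NormedSpace ℝ E]

/-- The geodesic equation of the metric `g` for position `y`, velocity `v` and acceleration `a`,
contracted with an arbitrary vector. -/
def EulerLagrange (g : E → E →L[ℝ] E →L[ℝ] ℝ) (y v a : E) : Prop :=
  ∀ w, g y a w + fderiv ℝ g y v v w = 1 / 2 * fderiv ℝ g y w v v

/-- The geodesic equation is covariant: if the metric `g` is the pullback of `h` under `τ`, then a
curve satisfies the equation of `g` as soon as its image under `τ` satisfies that of `h`. The terms
containing the second derivative of `τ` cancel by its symmetry. -/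
theorem EulerLagrange.of_pullback {g h : E → E →L[ℝ] E →L[ℝ] ℝ} {τ : E → E} {y v a : E}
    (hτ : ContDiffAt ℝ 2 τ y) (hg : DifferentiableAt ℝ g y) (hh : DifferentiableAt ℝ h (τ y))
    (hs : ∀ v w, h (τ y) v w = h (τ y) w v)
    (hgh : ∀ᶠ z in 𝓝 y, ∀ v w, g z v w = h (τ z) (fderiv ℝ τ z v) (fderiv ℝ τ z w))
    (H : EulerLagrange h (τ y) (fderiv ℝ τ y v)
      (fderiv ℝ (fderiv ℝ τ) y v v + fderiv ℝ τ y a)) : EulerLagrange g y v a := by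
  have hτ1 : HasFDerivAt τ (fderiv ℝ τ y) y := (hτ.differentiableAt (by norm_num)).hasFDerivAt
  have hτ2 : HasFDerivAt (fderiv ℝ τ) (fderiv ℝ (fderiv ℝ τ) y) y :=
    ((hτ.fderiv_right (m := 1) (by norm_num)).differentiableAt (by norm_num)).hasFDerivAt
  have hsymm : IsSymmSndFDerivAt ℝ τ y := hτ.isSymmSndFDerivAt (by simp)
  have key : ∀ u v w, fderiv ℝ g y u v w
      = fderiv ℝ h (τ y) (fderiv ℝ τ y u) (fderiv ℝ τ y v) (fderiv ℝ τ y w)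
        + h (τ y) (fderiv ℝ (fderiv ℝ τ) y u v) (fderiv ℝ τ y w)
        + h (τ y) (fderiv ℝ τ y v) (fderiv ℝ (fderiv ℝ τ) y u w) := by
    intro u v w
    have h1 : HasFDerivAt (fun z => g z v w) _ y :=
      (hg.hasFDerivAt.clm_apply (hasFDerivAt_const v y)).clm_apply (hasFDerivAt_const w y)
    have h2 : HasFDerivAt (fun z => h (τ z) (fderiv ℝ τ z v) (fderiv ℝ τ z w)) _ y :=
      ((hh.hasFDerivAt.comp y hτ1).clm_apply (hτ2.clm_apply (hasFDerivAt_const v y))).clm_apply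
        (hτ2.clm_apply (hasFDerivAt_const w y))
    have h3 := h1.unique (h2.congr_of_eventuallyEq (hgh.mono fun z hz => hz v w))
    have h4 := congrArg (fun A => A u) h3
    simp at h4
    rw [h4]; ring
  intro w
  have H' := H (fderiv ℝ τ y w)
  rw [key, key, hgh.self_of_nhds]
  rw [map_add, add_apply] at H'
  have e1 := hsymm.eq w v
  have e2 := hs (fderiv ℝ τ y v) (fderiv ℝ (fderiv ℝ τ) y v w)
  rw [e1]
  linarith

/-- The acceleration of a geodesic of the metric `g` with position `z.1` and velocity `z.2`. -/
def acceleration (g : E → E →L[ℝ] E →L[ℝ] ℝ) (z : E × E) : E :=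
  (g z.1).inverse
    ((1 / 2 : ℝ) • ((fderiv ℝ g z.1).flip z.2).flip z.2 - fderiv ℝ g z.1 z.2 z.2)

/-- For a nondegenerate metric, the geodesic equation can be solved for the acceleration. -/
theorem eulerLagrange_iff {g : E → E →L[ℝ] E →L[ℝ] ℝ} {y : E} (hy : (g y).IsInvertible) (v a : E) :
    EulerLagrange g y v a ↔ a = acceleration g (y, v) := by
  obtain ⟨e, he⟩ := hy
  simp only [acceleration]
  rw [← he, ContinuousLinearMap.inverse_equiv, ContinuousLinearEquiv.coe_coe,
    ContinuousLinearEquiv.eq_symm_apply, EulerLagrange, ← he, ContinuousLinearMap.ext_iff]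
  refine forall_congr' fun w => ?_
  simp only [sub_apply, smul_apply, ContinuousLinearMap.flip_apply, smul_eq_mul,
    ContinuousLinearEquiv.coe_coe]
  exact eq_sub_iff_add_eq.symm

theorem contDiffAt_acceleration [CompleteSpace E] {g : E → E →L[ℝ] E →L[ℝ] ℝ} {z : E × E}
    (hg : ContDiffAt ℝ ∞ g z.1) (hi : (g z.1).IsInvertible) :
    ContDiffAt ℝ ∞ (acceleration g) z := by
  have h1 : ContDiffAt ℝ ∞ (fun z : E × E => g z.1) z := hg.comp z contDiffAt_fst
  have h2 : ContDiffAt ℝ ∞ (fun z : E × E => fderiv ℝ g z.1) z :=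
    (hg.fderiv_right (m := ∞) (by simp)).comp z contDiffAt_fst
  obtain ⟨e, he⟩ := hi
  have h3 : ContDiffAt ℝ ∞ (fun z : E × E => (g z.1).inverse) z := by
    have := contDiffAt_map_inverse (𝕜 := ℝ) (n := ∞) e
    rw [he] at this
    exact this.comp z h1
  have f1 : ContDiffAt ℝ ∞ (fun z : E × E => (fderiv ℝ g z.1).flip) z :=
    (ContinuousLinearMap.flipₗᵢ ℝ E E (E →L[ℝ] ℝ)).contDiff.contDiffAt.comp z h2
  have f2 : ContDiffAt ℝ ∞ (fun z : E × E => (fderiv ℝ g z.1).flip z.2) z :=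
    f1.clm_apply contDiffAt_snd
  have f3 : ContDiffAt ℝ ∞ (fun z : E × E => ((fderiv ℝ g z.1).flip z.2).flip) z :=
    (ContinuousLinearMap.flipₗᵢ ℝ E E ℝ).contDiff.contDiffAt.comp z f2
  have f4 : ContDiffAt ℝ ∞ (fun z : E × E => ((fderiv ℝ g z.1).flip z.2).flip z.2) z :=
    f3.clm_apply contDiffAt_snd
  have f5 : ContDiffAt ℝ ∞ (fun z : E × E => fderiv ℝ g z.1 z.2) z := h2.clm_apply contDiffAt_snd
  have h5 : ContDiffAt ℝ ∞ (fun z : E × E => fderiv ℝ g z.1 z.2 z.2) z :=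
    f5.clm_apply contDiffAt_snd
  exact h3.clm_apply ((f4.const_smul (1 / 2 : ℝ)).sub h5)

end EulerLagrange

section Metric

variable {n : ℕ} {M : Type*} [TopologicalSpace M]
  [ChartedSpace (EuclideanSpace ℝ (Fin n)) M]
  [RiemannianBundle (fun x : M => TangentSpace (𝓡 n) x)]

local notation "𝔼" => EuclideanSpace ℝ (Fin n)

theorem chartMetric_comm (c : M) (y v w : 𝔼) : chartMetric c y v w = chartMetric c y w v :=
  real_inner_comm _ _

theorem chartMetric_add_right (c : M) (y v w w' : 𝔼) :
    chartMetric c y v (w + w') = chartMetric c y v w + chartMetric c y v w' := by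
  let A := mfderiv 𝓘(ℝ, 𝔼) (𝓡 n) (extChartAt (𝓡 n) c).symm y
  change inner ℝ (A v) (A (w + w')) = inner ℝ (A v) (A w) + inner ℝ (A v) (A w')
  rw [← inner_add_right]
  exact congrArg _ (map_add A w w')

theorem chartMetric_smul_right (c : M) (y : 𝔼) (a : ℝ) (v w : 𝔼) :
    chartMetric c y v (a • w) = a * chartMetric c y v w := by
  let A := mfderiv 𝓘(ℝ, 𝔼) (𝓡 n) (extChartAt (𝓡 n) c).symm y
  change inner ℝ (A v) (A (a • w)) = a * inner ℝ (A v) (A w)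
  rw [← real_inner_smul_right]
  exact congrArg _ (map_smul A a w)

/-- The metric in the chart at `c`, as a function with values in bilinear forms. -/
def metricForm (c : M) (y : 𝔼) : 𝔼 →L[ℝ] 𝔼 →L[ℝ] ℝ :=
  LinearMap.toContinuousLinearMap
    { toFun := fun v => LinearMap.toContinuousLinearMap
        { toFun := fun w => chartMetric c y v w
          map_add' := fun w w' => chartMetric_add_right c y v w w'
          map_smul' := fun a w => chartMetric_smul_right c y a v w }
      map_add' := fun v v' => by
        ext w
        change chartMetric c y (v + v') w = chartMetric c y v w + chartMetric c y v' w
        rw [chartMetric_comm, chartMetric_add_right, chartMetric_comm c y w,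
          chartMetric_comm c y w]
      map_smul' := fun a v => by
        ext w
        change chartMetric c y (a • v) w = a * chartMetric c y v w
        rw [chartMetric_comm, chartMetric_smul_right, chartMetric_comm c y w] }

@[simp]
theorem metricForm_apply (c : M) (y v w : 𝔼) : metricForm c y v w = chartMetric c y v w := rfl

theorem metricForm_comm (c : M) (y v w : 𝔼) : metricForm c y v w = metricForm c y w v :=
  chartMetric_comm c y v w

variable [IsManifold (𝓡 n) ∞ M]

/-- The metric is nondegenerate in every chart. -/
theorem metricForm_isInvertible (c : M) {y : 𝔼} (hy : y ∈ (extChartAt (𝓡 n) c).target) :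
    (metricForm c y).IsInvertible := by
  have hinj : Function.Injective (metricForm c y) := by
    rw [injective_iff_map_eq_zero]
    intro v hv
    have h1 : chartMetric c y v v = 0 := by
      rw [← metricForm_apply, hv]; rfl
    have h2 := inner_self_eq_zero.1 h1
    have h3 : (tchart c (tsymm c (y, v))).2 = v :=
      congrArg Prod.snd (tchart_tsymm c (z := (y, v)) hy)
    refine h3.symm.trans ?_
    exact (congrArg _ h2).trans (map_zero (mfderiv (𝓡 n) 𝓘(ℝ, 𝔼) (extChartAt (𝓡 n) c) _))
  have hdim : Module.finrank ℝ 𝔼 = Module.finrank ℝ (𝔼 →L[ℝ] ℝ) := by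
    rw [← (LinearMap.toContinuousLinearMap (𝕜 := ℝ) (E := 𝔼) (F' := ℝ)).finrank_eq]
    exact (Subspace.dual_finrank_eq (K := ℝ) (V := 𝔼)).symm
  let e := LinearEquiv.ofInjectiveOfFinrankEq (metricForm c y : 𝔼 →ₗ[ℝ] (𝔼 →L[ℝ] ℝ)) hinj hdim
  exact ⟨e.toContinuousLinearEquiv, by ext v w; rfl⟩

variable [IsContMDiffRiemannianBundle (𝓡 n) ∞ (EuclideanSpace ℝ (Fin n))
      (fun x : M => TangentSpace (𝓡 n) x)]

theorem contDiffOn_metricForm (c : M) :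
    ContDiffOn ℝ ∞ (metricForm c) (extChartAt (𝓡 n) c).target := by
  refine contDiffOn_clm_apply.2 fun v => contDiffOn_clm_apply.2 fun w y hy => ?_
  have hv : ∀ v : 𝔼, ContMDiffAt 𝓘(ℝ, 𝔼) (𝓡 n).tangent ∞ (fun m => tsymm c (m, v)) y := by
    intro v
    have : ContMDiffAt 𝓘(ℝ, 𝔼) 𝓘(ℝ, 𝔼 × 𝔼) ∞ (fun m : 𝔼 => (m, v)) y := by
      rw [contMDiffAt_iff_contDiffAt]; fun_prop
    exact ContMDiffAt.comp (g := tsymm c) y (contMDiffAt_tsymm c (z := (y, v)) hy) this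
  have := ContMDiffAt.inner_bundle (IB := 𝓡 n) (F := 𝔼) (E := fun x : M => TangentSpace (𝓡 n) x)
    (hv v) (hv w)
  exact this.contDiffAt.contDiffWithinAt

theorem differentiableAt_metricForm (c : M) {y : 𝔼} (hy : y ∈ (extChartAt (𝓡 n) c).target) :
    DifferentiableAt ℝ (metricForm c) y :=
  ((contDiffOn_metricForm c).contDiffAt ((isOpen_extChartAt_target c).mem_nhds hy)).differentiableAt
    (by simp)

/-- The geodesic vector field on the tangent bundle, in the chart at `c`. -/
def geodesicField (c : M) (z : 𝔼 × 𝔼) : 𝔼 × 𝔼 := (z.2, acceleration (metricForm c) z)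

theorem contDiffOn_geodesicField (c : M) :
    ContDiffOn ℝ ∞ (geodesicField c) ((extChartAt (𝓡 n) c).target ×ˢ univ) := by
  intro z hz
  have hg := (contDiffOn_metricForm c).contDiffAt ((isOpen_extChartAt_target c).mem_nhds hz.1)
  exact (contDiffAt_snd.prodMk
    (contDiffAt_acceleration hg (metricForm_isInvertible c hz.1))).contDiffWithinAt

end Metric

/-! ### Geodesics as integral curves -/

section Geodesics

variable {n : ℕ} {M : Type*} [TopologicalSpace M]
  [ChartedSpace (EuclideanSpace ℝ (Fin n)) M]

local notation "𝔼" => EuclideanSpace ℝ (Fin n)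

section Curves

variable [IsManifold (𝓡 n) ∞ M]

theorem contDiffAt_deriv {E : Type*} [NormedAddCommGroup E] [NormedSpace ℝ E] {k m : WithTop ℕ∞}
    {x : ℝ → E} {t : ℝ} (hx : ContDiffAt ℝ k x t) (hm : m + 1 ≤ k) :
    ContDiffAt ℝ m (deriv x) t := by
  have := (hx.fderiv_right hm).clm_apply (contDiffAt_const (c := (1 : ℝ)))
  simpa only [fderiv_apply_one_eq_deriv] using! this

theorem contDiffAt_chart_comp {k : WithTop ℕ∞} (hk : k ≤ (∞ : WithTop ℕ∞)) {σ : ℝ → M} {t : ℝ}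
    (c : M) (hσ : ContMDiffAt 𝓘(ℝ, ℝ) (𝓡 n) k σ t) (h : σ t ∈ (extChartAt (𝓡 n) c).source) :
    ContDiffAt ℝ k (fun u => extChartAt (𝓡 n) c (σ u)) t :=
  (((contMDiffAt_chart c h).of_le hk).comp t hσ).contDiffAt

theorem eventually_tchart_velocity {σ : ℝ → M} {t : ℝ} (c : M)
    (hσ : ContMDiffAt 𝓘(ℝ, ℝ) (𝓡 n) 1 σ t) (h : σ t ∈ (extChartAt (𝓡 n) c).source) :
    ∀ᶠ u in 𝓝 t, σ u ∈ (extChartAt (𝓡 n) c).source ∧ tchart c (velocity σ u)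
      = (extChartAt (𝓡 n) c (σ u), deriv (fun u => extChartAt (𝓡 n) c (σ u)) u) := by
  filter_upwards [(contMDiffAt_iff_contMDiffAt_nhds (by simp)).1 hσ, hσ.continuousAt.eventually_mem
    ((isOpen_extChartAt_source c).mem_nhds h)] with u hu hu'
  exact ⟨hu', tchart_velocity c (hu.mdifferentiableAt (by simp)) hu'⟩

theorem continuousAt_velocity {σ : ℝ → M} {t : ℝ} (hσ : ContMDiffAt 𝓘(ℝ, ℝ) (𝓡 n) 1 σ t) :
    ContinuousAt (velocity (n := n) σ) t := by
  have hc := mem_extChartAt_source (I := 𝓡 n) (σ t)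
  have hx := contDiffAt_chart_comp (k := 1) (by norm_num) (σ t) hσ hc
  have h1 := eventually_tchart_velocity (σ t) hσ hc
  have h2 : ContinuousAt (fun u => ((extChartAt (𝓡 n) (σ t) (σ u),
      deriv (fun u => extChartAt (𝓡 n) (σ t) (σ u)) u) : 𝔼 × 𝔼)) t :=
    hx.continuousAt.prodMk (contDiffAt_deriv (m := 0) hx (by norm_num)).continuousAt
  have h3 : (extChartAt (𝓡 n) (σ t) (σ t)) ∈ (extChartAt (𝓡 n) (σ t)).target :=
    mem_extChartAt_target _
  have h4 := (contMDiffAt_tsymm (n := n) (σ t) (z := (extChartAt (𝓡 n) (σ t) (σ t),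
      deriv (fun u => extChartAt (𝓡 n) (σ t) (σ u)) t)) h3).continuousAt
  have h5 := ContinuousAt.comp (f := fun u => ((extChartAt (𝓡 n) (σ t) (σ u),
      deriv (fun u => extChartAt (𝓡 n) (σ t) (σ u)) u) : 𝔼 × 𝔼)) h4 h2
  refine h5.congr ?_
  filter_upwards [h1] with u hu
  rw [Function.comp_apply, ← hu.2, tsymm_tchart _ hu.1]

theorem continuous_proj : Continuous (fun ξ : TangentBundle (𝓡 n) M => ξ.proj) :=
  have : IsManifold (𝓡 n) 1 M := IsManifold.of_le (n := ∞) (by simp)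
  FiberBundle.continuous_proj 𝔼 (TangentSpace (𝓡 n) : M → Type _)

/-- Vectors over different points are separated by open sets of `M`, vectors over the same point in
a chart. -/
theorem t2Space_tangentBundle [T2Space M] : T2Space (TangentBundle (𝓡 n) M) := by
  refine ⟨fun ξ η hne => ?_⟩
  by_cases hp : ξ.proj = η.proj
  · have hη : η.proj ∈ (extChartAt (𝓡 n) ξ.proj).source := hp ▸ mem_extChartAt_source _
    have hξ : ξ.proj ∈ (extChartAt (𝓡 n) ξ.proj).source := mem_extChartAt_source _
    have hne' : tchart ξ.proj ξ ≠ tchart ξ.proj η := fun h => hne (tangent_ext _ hξ hη h)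
    obtain ⟨u, v, hu, hv, h1, h2, h3⟩ := t2_separation hne'
    have c1 := (contMDiffAt_tchart (n := n) ξ.proj hξ).continuousAt.preimage_mem_nhds
      (hu.mem_nhds h1)
    have c2 := (contMDiffAt_tchart (n := n) ξ.proj hη).continuousAt.preimage_mem_nhds
      (hv.mem_nhds h2)
    obtain ⟨u', hu', hu'o, hu'm⟩ := mem_nhds_iff.1 c1
    obtain ⟨v', hv', hv'o, hv'm⟩ := mem_nhds_iff.1 c2
    exact ⟨u', v', hu'o, hv'o, hu'm, hv'm, (h3.preimage _).mono hu' hv'⟩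
  · obtain ⟨u, v, hu, hv, h1, h2, h3⟩ := t2_separation hp
    exact ⟨_, _, hu.preimage continuous_proj, hv.preimage continuous_proj, h1, h2,
      h3.preimage _⟩

end Curves

variable [RiemannianBundle (fun x : M => TangentSpace (𝓡 n) x)]

theorem isGeodesicOn_iff_forall {σ : ℝ → M} {s : Set ℝ} :
    IsGeodesicOn (n := n) σ s ↔ ∀ t ∈ s, IsGeodesicOn (n := n) σ {t} := by
  simp [IsGeodesicOn]

theorem IsGeodesicOn.mono {σ : ℝ → M} {s s' : Set ℝ} (h : IsGeodesicOn (n := n) σ s)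
    (hs : s' ⊆ s) : IsGeodesicOn (n := n) σ s' := fun t ht => h t (hs ht)

theorem IsGeodesicOn.contMDiffAt {σ : ℝ → M} {s : Set ℝ} (h : IsGeodesicOn (n := n) σ s) {t : ℝ}
    (ht : t ∈ s) : ContMDiffAt 𝓘(ℝ, ℝ) (𝓡 n) 2 σ t := (h t ht).1

theorem IsGeodesicOn.mdifferentiableAt {σ : ℝ → M} {s : Set ℝ} (h : IsGeodesicOn (n := n) σ s)
    {t : ℝ} (ht : t ∈ s) : MDifferentiableAt 𝓘(ℝ, ℝ) (𝓡 n) σ t :=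
  (h.contMDiffAt ht).mdifferentiableAt (by simp)

/-- Being a geodesic at a time depends only on the germ of the curve at that time. -/
theorem isGeodesicOn_congr {σ τ : ℝ → M} {t : ℝ} (h : σ =ᶠ[𝓝 t] τ)
    (hσ : IsGeodesicOn (n := n) σ {t}) : IsGeodesicOn (n := n) τ {t} := by
  intro t' ht'
  obtain rfl : t' = t := ht'
  obtain ⟨h1, h2⟩ := hσ t' rfl
  refine ⟨h1.congr_of_eventuallyEq h.symm, fun w => ?_⟩
  have hx : (fun u => extChartAt (𝓡 n) (σ t') (σ u)) =ᶠ[𝓝 t']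
      fun u => extChartAt (𝓡 n) (τ t') (τ u) := by
    filter_upwards [h] with u hu
    rw [hu, h.self_of_nhds]
  have := h2 w
  simp only at this ⊢
  rw [hx.deriv.deriv_eq, hx.deriv_eq, h.self_of_nhds] at this
  exact this

variable [IsManifold (𝓡 n) ∞ M] [IsContMDiffRiemannianBundle (𝓡 n) ∞ (EuclideanSpace ℝ (Fin n))
      (fun x : M => TangentSpace (𝓡 n) x)]

theorem fderiv_chartMetric (c : M) {y : 𝔼} (hy : y ∈ (extChartAt (𝓡 n) c).target) (u v w : 𝔼) :
    fderiv ℝ (fun y => chartMetric c y v w) y u = fderiv ℝ (metricForm c) y u v w := by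
  have h1 : HasFDerivAt (fun z => metricForm c z v w) _ y :=
    ((differentiableAt_metricForm c hy).hasFDerivAt.clm_apply
      (hasFDerivAt_const v y)).clm_apply (hasFDerivAt_const w y)
  have h2 := h1.fderiv
  simp only [metricForm_apply] at h2
  rw [h2]
  simp

omit [IsManifold (𝓡 n) ∞ M] [IsContMDiffRiemannianBundle (𝓡 n) ∞ (EuclideanSpace ℝ (Fin n))
      (fun x : M => TangentSpace (𝓡 n) x)] in
theorem inner_congr_base {p q : M} (h : p = q) (v w : 𝔼) :
    inner ℝ (show TangentSpace (𝓡 n) p from v) (show TangentSpace (𝓡 n) p from w)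
      = inner ℝ (show TangentSpace (𝓡 n) q from v) (show TangentSpace (𝓡 n) q from w) := by
  subst h; rfl

omit [RiemannianBundle (fun x : M => TangentSpace (𝓡 n) x)]
  [IsContMDiffRiemannianBundle (𝓡 n) ∞ (EuclideanSpace ℝ (Fin n))
      (fun x : M => TangentSpace (𝓡 n) x)] in
theorem contDiffAt_coordChange (c c' : M) {y : 𝔼} (hy : y ∈ (extChartAt (𝓡 n) c).target)
    (hy' : (extChartAt (𝓡 n) c).symm y ∈ (extChartAt (𝓡 n) c').source) :
    ContDiffAt ℝ ∞ (fun z => extChartAt (𝓡 n) c' ((extChartAt (𝓡 n) c).symm z)) y :=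
  ((contMDiffAt_chart c' hy').comp y (contMDiffAt_chart_symm c hy)).contDiffAt

omit [RiemannianBundle (fun x : M => TangentSpace (𝓡 n) x)]
  [IsContMDiffRiemannianBundle (𝓡 n) ∞ (EuclideanSpace ℝ (Fin n))
      (fun x : M => TangentSpace (𝓡 n) x)] in
theorem eventually_mem_coordChange (c c' : M) {y : 𝔼} (hy : y ∈ (extChartAt (𝓡 n) c).target)
    (hy' : (extChartAt (𝓡 n) c).symm y ∈ (extChartAt (𝓡 n) c').source) :
    ∀ᶠ z in 𝓝 y, z ∈ (extChartAt (𝓡 n) c).target ∧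
      (extChartAt (𝓡 n) c).symm z ∈ (extChartAt (𝓡 n) c').source :=
  ((isOpen_extChartAt_target c).eventually_mem hy).and
    ((contMDiffAt_chart_symm c hy).continuousAt.eventually_mem
      ((isOpen_extChartAt_source c').mem_nhds hy'))

omit [IsContMDiffRiemannianBundle (𝓡 n) ∞ (EuclideanSpace ℝ (Fin n))
      (fun x : M => TangentSpace (𝓡 n) x)] in
/-- The metrics in two charts are related by pullback under the coordinate change. -/
theorem metricForm_pullback (c c' : M) {y : 𝔼} (hy : y ∈ (extChartAt (𝓡 n) c).target)
    (hy' : (extChartAt (𝓡 n) c).symm y ∈ (extChartAt (𝓡 n) c').source) (v w : 𝔼) :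
    metricForm c y v w = metricForm c' (extChartAt (𝓡 n) c' ((extChartAt (𝓡 n) c).symm y))
      (fderiv ℝ (fun z => extChartAt (𝓡 n) c' ((extChartAt (𝓡 n) c).symm z)) y v)
      (fderiv ℝ (fun z => extChartAt (𝓡 n) c' ((extChartAt (𝓡 n) c).symm z)) y w) := by
  set τ : 𝔼 → 𝔼 := fun z => extChartAt (𝓡 n) c' ((extChartAt (𝓡 n) c).symm z) with hτ
  have hτ1 : DifferentiableAt ℝ τ y :=
    (contDiffAt_coordChange c c' hy hy').differentiableAt (by simp)
  have hτy : τ y ∈ (extChartAt (𝓡 n) c').target := (extChartAt (𝓡 n) c').map_source hy'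
  have h1 : MDifferentiableAt 𝓘(ℝ, 𝔼) (𝓡 n) (extChartAt (𝓡 n) c').symm (τ y) :=
    (contMDiffAt_chart_symm c' hτy).mdifferentiableAt (by simp)
  have h2 := (h1.hasMFDerivAt.comp y hτ1.hasFDerivAt.hasMFDerivAt).mfderiv
  have heq : ((extChartAt (𝓡 n) c').symm ∘ τ) =ᶠ[𝓝 y] (extChartAt (𝓡 n) c).symm := by
    filter_upwards [eventually_mem_coordChange c c' hy hy'] with z hz
    exact (extChartAt (𝓡 n) c').left_inv hz.2
  have h3 := heq.mfderiv_eq (I := 𝓘(ℝ, 𝔼)) (I' := 𝓡 n)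
  let A : 𝔼 →L[ℝ] 𝔼 := mfderiv 𝓘(ℝ, 𝔼) (𝓡 n) (extChartAt (𝓡 n) c).symm y
  let B : 𝔼 →L[ℝ] 𝔼 := mfderiv 𝓘(ℝ, 𝔼) (𝓡 n) (extChartAt (𝓡 n) c').symm (τ y)
  have hAB : ∀ v, A v = B (fderiv ℝ τ y v) := fun v =>
    congrArg (fun A : 𝔼 →L[ℝ] 𝔼 => A v) (h3.symm.trans h2)
  have := inner_congr_base (n := n) heq.self_of_nhds.symm (A v) (A w)
  refine this.trans ?_
  rw [hAB, hAB]
  rfl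

/-- The geodesic equation does not depend on the chart. -/
theorem eulerLagrange_chart_change {σ : ℝ → M} {t : ℝ} (c c' : M)
    (hc : σ t ∈ (extChartAt (𝓡 n) c).source) (hc' : σ t ∈ (extChartAt (𝓡 n) c').source)
    (hσ : ContMDiffAt 𝓘(ℝ, ℝ) (𝓡 n) 2 σ t)
    (H : EulerLagrange (metricForm c') (extChartAt (𝓡 n) c' (σ t))
        (deriv (fun u => extChartAt (𝓡 n) c' (σ u)) t)
        (deriv (deriv (fun u => extChartAt (𝓡 n) c' (σ u))) t)) :
    EulerLagrange (metricForm c) (extChartAt (𝓡 n) c (σ t))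
        (deriv (fun u => extChartAt (𝓡 n) c (σ u)) t)
        (deriv (deriv (fun u => extChartAt (𝓡 n) c (σ u))) t) := by
  set τ : 𝔼 → 𝔼 := fun z => extChartAt (𝓡 n) c' ((extChartAt (𝓡 n) c).symm z) with hτ
  set x : ℝ → 𝔼 := fun u => extChartAt (𝓡 n) c (σ u) with hx
  set x' : ℝ → 𝔼 := fun u => extChartAt (𝓡 n) c' (σ u) with hx'
  have hxc : ContDiffAt ℝ 2 x t := contDiffAt_chart_comp (k := 2)
    (WithTop.coe_le_coe.2 le_top) c hσ hc
  have hy : x t ∈ (extChartAt (𝓡 n) c).target := (extChartAt (𝓡 n) c).map_source hc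
  have hy0 : (extChartAt (𝓡 n) c).symm (x t) = σ t := (extChartAt (𝓡 n) c).left_inv hc
  have hy' : (extChartAt (𝓡 n) c).symm (x t) ∈ (extChartAt (𝓡 n) c').source := hy0 ▸ hc'
  have hτc : ContDiffAt ℝ ∞ τ (x t) := contDiffAt_coordChange c c' hy hy'
  have hτ2 : ContDiffAt ℝ 2 τ (x t) := hτc.of_le (WithTop.coe_le_coe.2 le_top)
  have hτx : τ (x t) = x' t := by simp only [hτ, hy0, hx']
  have hxx' : x' =ᶠ[𝓝 t] fun u => τ (x u) := by
    filter_upwards [hσ.continuousAt.eventually_mem ((isOpen_extChartAt_source c).mem_nhds hc)]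
      with u hu
    simp only [hτ, hx, hx', (extChartAt (𝓡 n) c).left_inv hu]
  -- chain rule for the first and second derivatives of `x' = τ ∘ x`
  have hd : deriv x' =ᶠ[𝓝 t] fun u => fderiv ℝ τ (x u) (deriv x u) := by
    have e1 : ∀ᶠ u in 𝓝 t, DifferentiableAt ℝ x u :=
      (hxc.eventually (by simp)).mono fun u hu => hu.differentiableAt (by simp)
    have e2 : ∀ᶠ u in 𝓝 t, DifferentiableAt ℝ τ (x u) :=
      hxc.continuousAt.eventually
        ((hτ2.eventually (by simp)).mono fun u hu => hu.differentiableAt (by simp))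
    filter_upwards [hxx'.eventuallyEq_nhds, e1, e2] with u hu h1 h2
    rw [hu.deriv_eq]
    exact (h2.hasFDerivAt.comp_hasDerivAt u h1.hasDerivAt).deriv
  have hdd : deriv (deriv x') t = fderiv ℝ (fderiv ℝ τ) (x t) (deriv x t) (deriv x t)
      + fderiv ℝ τ (x t) (deriv (deriv x) t) := by
    rw [hd.deriv_eq]
    have h1 : HasFDerivAt (fderiv ℝ τ) (fderiv ℝ (fderiv ℝ τ) (x t)) (x t) :=
      ((hτ2.fderiv_right (m := 1) (by norm_num)).differentiableAt (by simp)).hasFDerivAt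
    have h2 : HasDerivAt x (deriv x t) t := (hxc.differentiableAt (by simp)).hasDerivAt
    have h3 : HasDerivAt (deriv x) (deriv (deriv x) t) t :=
      ((contDiffAt_deriv (m := 1) hxc (by norm_num)).differentiableAt (by simp)).hasDerivAt
    exact ((h1.comp_hasDerivAt t h2).clm_apply h3).deriv
  rw [hdd, hd.self_of_nhds, show extChartAt (𝓡 n) c' (σ t) = τ (x t) from hτx.symm] at H
  refine EulerLagrange.of_pullback (τ := τ) hτ2 (differentiableAt_metricForm c hy) ?_ ?_ ?_ H
  · exact differentiableAt_metricForm c' ((extChartAt (𝓡 n) c').map_source hy')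
  · exact fun v w => metricForm_comm c' _ v w
  · filter_upwards [eventually_mem_coordChange c c' hy hy'] with z hz v w
    exact metricForm_pullback c c' hz.1 hz.2 v w

/-- Geodesics, defined by the equation in the chart at the point considered, satisfy it in every
chart. -/
theorem isGeodesicOn_singleton_iff {σ : ℝ → M} {t : ℝ} (c : M)
    (hc : σ t ∈ (extChartAt (𝓡 n) c).source) :
    IsGeodesicOn (n := n) σ {t} ↔ ContMDiffAt 𝓘(ℝ, ℝ) (𝓡 n) 2 σ t ∧
      EulerLagrange (metricForm c) (extChartAt (𝓡 n) c (σ t))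
        (deriv (fun u => extChartAt (𝓡 n) c (σ u)) t)
        (deriv (deriv (fun u => extChartAt (𝓡 n) c (σ u))) t) := by
  have hself : IsGeodesicOn (n := n) σ {t} ↔ ContMDiffAt 𝓘(ℝ, ℝ) (𝓡 n) 2 σ t ∧
      EulerLagrange (metricForm (σ t)) (extChartAt (𝓡 n) (σ t) (σ t))
        (deriv (fun u => extChartAt (𝓡 n) (σ t) (σ u)) t)
        (deriv (deriv (fun u => extChartAt (𝓡 n) (σ t) (σ u))) t) := by
    simp only [IsGeodesicOn, mem_singleton_iff, forall_eq, EulerLagrange, metricForm_apply]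
    simp only [fderiv_chartMetric (σ t) (mem_extChartAt_target (I := 𝓡 n) (σ t))]
  rw [hself]
  have h0 := mem_extChartAt_source (I := 𝓡 n) (σ t)
  exact ⟨fun h => ⟨h.1, eulerLagrange_chart_change c (σ t) hc h0 h.1 h.2⟩,
    fun h => ⟨h.1, eulerLagrange_chart_change (σ t) c h0 hc h.1 h.2⟩⟩

end Geodesics

section GeodesicFlow

theorem contDiffAt_succ_of_hasDerivAt {E : Type*} [NormedAddCommGroup E] [NormedSpace ℝ E]
    {x y : ℝ → E} {t : ℝ} {k : ℕ} (hx : ∀ᶠ u in 𝓝 t, HasDerivAt x (y u) u)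
    (hy : ContDiffAt ℝ k y t) : ContDiffAt ℝ (k + 1 : ℕ) x t := by
  have h1 : ContDiffAt ℝ k (fun u => (ContinuousLinearMap.id ℝ ℝ).smulRight (y u)) t :=
    contDiffAt_const.smulRight hy
  refine contDiffAt_succ_iff_hasFDerivAt.2 ⟨_, ⟨_, hx, fun u hu => ?_⟩, h1⟩
  exact hu.hasFDerivAt.congr_fderiv (by ext; simp)

variable {n : ℕ} {M : Type*} [TopologicalSpace M]
  [ChartedSpace (EuclideanSpace ℝ (Fin n)) M]
  [RiemannianBundle (fun x : M => TangentSpace (𝓡 n) x)]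

local notation "𝔼" => EuclideanSpace ℝ (Fin n)

variable [IsManifold (𝓡 n) ∞ M] [IsContMDiffRiemannianBundle (𝓡 n) ∞ (EuclideanSpace ℝ (Fin n))
      (fun x : M => TangentSpace (𝓡 n) x)]

/-- The velocity of a geodesic is an integral curve of the geodesic vector field. -/
theorem hasDerivAt_tchart_velocity {σ : ℝ → M} {t : ℝ} (c : M)
    (hσ : IsGeodesicOn (n := n) σ {t}) (hc : σ t ∈ (extChartAt (𝓡 n) c).source) :
    HasDerivAt (fun u => tchart c (velocity (n := n) σ u))
      (geodesicField c (tchart c (velocity σ t))) t := by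
  obtain ⟨h2, hE⟩ := (isGeodesicOn_singleton_iff c hc).1 hσ
  have h1 : ContMDiffAt 𝓘(ℝ, ℝ) (𝓡 n) 1 σ t := h2.of_le (by norm_num)
  have hev := eventually_tchart_velocity c h1 hc
  set x : ℝ → 𝔼 := fun u => extChartAt (𝓡 n) c (σ u) with hx
  have hxc : ContDiffAt ℝ 2 x t := contDiffAt_chart_comp (k := 2)
    (WithTop.coe_le_coe.2 le_top) c h2 hc
  have d1 : HasDerivAt x (deriv x t) t := (hxc.differentiableAt (by simp)).hasDerivAt
  have d2 : HasDerivAt (deriv x) (deriv (deriv x) t) t :=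
    ((contDiffAt_deriv (m := 1) hxc (by norm_num)).differentiableAt (by simp)).hasDerivAt
  have hy : x t ∈ (extChartAt (𝓡 n) c).target := (extChartAt (𝓡 n) c).map_source hc
  have hacc := (eulerLagrange_iff (metricForm_isInvertible c hy) _ _).1 hE
  have d3 := d1.prodMk d2
  refine (d3.congr_of_eventuallyEq (hev.mono fun u hu => hu.2)).congr_deriv ?_
  rw [hev.self_of_nhds.2, geodesicField, hacc]

/-- Integral curves of the geodesic vector field of a chart are the coordinates of geodesics and
their velocities. -/
theorem isGeodesicOn_of_hasDerivAt (c : M) {z : ℝ → 𝔼 × 𝔼} {t : ℝ}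
    (hz : ∀ᶠ u in 𝓝 t, (z u).1 ∈ (extChartAt (𝓡 n) c).target ∧
      HasDerivAt z (geodesicField c (z u)) u) :
    IsGeodesicOn (n := n) (fun u => (extChartAt (𝓡 n) c).symm (z u).1) {t} ∧
      velocity (fun u => (extChartAt (𝓡 n) c).symm (z u).1) t = tsymm c (z t) := by
  set σ : ℝ → M := fun u => (extChartAt (𝓡 n) c).symm (z u).1 with hσ
  have d1 : ∀ᶠ u in 𝓝 t, HasDerivAt (fun u => (z u).1) (z u).2 u := hz.mono fun u hu => by
    simpa [geodesicField] using!
      (ContinuousLinearMap.fst ℝ 𝔼 𝔼).hasFDerivAt.comp_hasDerivAt u hu.2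
  have d2 : ∀ᶠ u in 𝓝 t, HasDerivAt (fun u => (z u).2) (acceleration (metricForm c) (z u)) u :=
    hz.mono fun u hu => by
      simpa [geodesicField] using!
        (ContinuousLinearMap.snd ℝ 𝔼 𝔼).hasFDerivAt.comp_hasDerivAt u hu.2
  have hzt := hz.self_of_nhds
  have hc : σ t ∈ (extChartAt (𝓡 n) c).source := (extChartAt (𝓡 n) c).map_target hzt.1
  have e0 : (fun u => extChartAt (𝓡 n) c (σ u)) =ᶠ[𝓝 t] fun u => (z u).1 :=
    hz.mono fun u hu => (extChartAt (𝓡 n) c).right_inv hu.1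
  have e1 : deriv (fun u => extChartAt (𝓡 n) c (σ u)) =ᶠ[𝓝 t] fun u => (z u).2 :=
    e0.deriv.trans (d1.mono fun u hu => hu.deriv)
  have e0t : extChartAt (𝓡 n) c (σ t) = (z t).1 := e0.self_of_nhds
  have e1t : deriv (fun u => extChartAt (𝓡 n) c (σ u)) t = (z t).2 := e1.self_of_nhds
  have e2 := e1.deriv_eq.trans d2.self_of_nhds.deriv
  have hz1 : ContDiffAt ℝ 2 (fun u => (z u).1) t := by
    have c0 : ContDiffAt ℝ (0 : ℕ) (fun u => geodesicField c (z u)) t := by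
      have hO : IsOpen ((extChartAt (𝓡 n) c).target ×ˢ (univ : Set 𝔼)) :=
        (isOpen_extChartAt_target c).prod isOpen_univ
      refine contDiffAt_zero.2 ⟨_, hz, fun u hu => ?_⟩
      exact (((contDiffOn_geodesicField c).contDiffAt (hO.mem_nhds ⟨hu.1, trivial⟩)
        ).continuousAt.comp hu.2.continuousAt).continuousWithinAt
    have c1 := contDiffAt_succ_of_hasDerivAt (hz.mono fun u hu => hu.2) c0
    have c2 := contDiffAt_succ_of_hasDerivAt (k := 1) d1 (contDiffAt_snd.comp t c1)
    exact c2
  have hσ2 : ContMDiffAt 𝓘(ℝ, ℝ) (𝓡 n) 2 σ t :=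
    ((contMDiffAt_chart_symm c hzt.1).of_le (WithTop.coe_le_coe.2 le_top)).comp t
      hz1.contMDiffAt
  refine ⟨(isGeodesicOn_singleton_iff c hc).2 ⟨hσ2, ?_⟩, ?_⟩
  · rw [e2, e1t, e0t]
    exact (eulerLagrange_iff (metricForm_isInvertible c hzt.1) _ _).2 rfl
  · have h3 := tchart_velocity c (hσ2.mdifferentiableAt (by simp)) hc
    rw [e1t, e0t] at h3
    rw [← tsymm_tchart c (ξ := velocity σ t) hc, h3]

/-- Geodesics with the same velocity at one time agree: the set of times at which the velocities
agree is open, by uniqueness for the geodesic equation in a chart, and closed in the interval. -/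
theorem IsGeodesicOn.velocity_eqOn [T2Space M] {σ τ : ℝ → M} {a b t₀ : ℝ}
    (hσ : IsGeodesicOn (n := n) σ (Ioo a b)) (hτ : IsGeodesicOn (n := n) τ (Ioo a b))
    (ht₀ : t₀ ∈ Ioo a b) (h : velocity (n := n) σ t₀ = velocity τ t₀) :
    EqOn (velocity (n := n) σ) (velocity τ) (Ioo a b) := by
  have : T2Space (TangentBundle (𝓡 n) M) := t2Space_tangentBundle
  have hcσ : ∀ t ∈ Ioo a b, ContinuousAt (velocity (n := n) σ) t := fun t ht =>
    continuousAt_velocity ((hσ.contMDiffAt ht).of_le (by norm_num))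
  have hcτ : ∀ t ∈ Ioo a b, ContinuousAt (velocity (n := n) τ) t := fun t ht =>
    continuousAt_velocity ((hτ.contMDiffAt ht).of_le (by norm_num))
  let u := {t | t ∈ Ioo a b ∧ velocity (n := n) σ t = velocity τ t}
  suffices hsub : Ioo a b ⊆ u from fun t ht => (hsub ht).2
  refine isPreconnected_Ioo.subset_of_closure_inter_subset ?_ ⟨t₀, ht₀, ht₀, h⟩ ?_
  · rw [isOpen_iff_mem_nhds]
    rintro t ⟨ht, hv⟩
    have hp : σ t = τ t := congrArg (fun ξ => ξ.proj) hv
    have hc : σ t ∈ (extChartAt (𝓡 n) (σ t)).source := mem_extChartAt_source _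
    have hc' : τ t ∈ (extChartAt (𝓡 n) (σ t)).source := hp ▸ hc
    have hO : IsOpen ((extChartAt (𝓡 n) (σ t)).target ×ˢ (univ : Set 𝔼)) :=
      (isOpen_extChartAt_target (σ t)).prod isOpen_univ
    have hmem : tchart (σ t) (velocity (n := n) σ t) ∈
        (extChartAt (𝓡 n) (σ t)).target ×ˢ (univ : Set 𝔼) := ⟨tchart_mem _ hc, trivial⟩
    obtain ⟨K, s, hs, hK⟩ := (((contDiffOn_geodesicField (σ t)).contDiffAt
      (hO.mem_nhds hmem)).of_le (m := 1) (by simp)).exists_lipschitzOnWith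
    have hev : ∀ ρ : ℝ → M, IsGeodesicOn (n := n) ρ (Ioo a b) →
        ContinuousAt (velocity (n := n) ρ) t →
        velocity (n := n) ρ t = velocity σ t → ∀ᶠ u in 𝓝 t,
        (HasDerivAt (fun u => tchart (σ t) (velocity (n := n) ρ u))
          (geodesicField (σ t) (tchart (σ t) (velocity ρ u))) u ∧
          tchart (σ t) (velocity ρ u) ∈ s) ∧ ρ u ∈ (extChartAt (𝓡 n) (σ t)).source := by
      intro ρ hρ hρc hρt
      have hρt' : ρ t = σ t := congrArg (fun ξ => ξ.proj) hρt
      have h1 : ContinuousAt (fun u => tchart (σ t) (velocity (n := n) ρ u)) t :=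
        ContinuousAt.comp (contMDiffAt_tchart (σ t)
          (show (velocity ρ t).proj ∈ _ by rw [hρt]; exact hc)).continuousAt hρc
      have h2 : ∀ᶠ u in 𝓝 t, ρ u ∈ (extChartAt (𝓡 n) (σ t)).source :=
        (hρ.contMDiffAt ht).continuousAt.eventually_mem
          ((isOpen_extChartAt_source _).mem_nhds (hρt' ▸ hc))
      filter_upwards [h1.eventually_mem (hρt ▸ hs), h2, Ioo_mem_nhds ht.1 ht.2] with u hu hu2 hu3
      exact ⟨⟨hasDerivAt_tchart_velocity _ (hρ.mono (singleton_subset_iff.2 hu3)) hu2, hu⟩, hu2⟩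
    have e1 := hev σ hσ (hcσ t ht) rfl
    have e2 := hev τ hτ (hcτ t ht) hv.symm
    have key := ODE_solution_unique_of_eventually (v := fun _ => geodesicField (σ t))
      (s := fun _ => s) (K := K) (t₀ := t) (Filter.Eventually.of_forall fun _ => hK)
      (e1.mono fun u hu => hu.1) (e2.mono fun u hu => hu.1) (by simp only [hv])
    filter_upwards [key, e1, e2, Ioo_mem_nhds ht.1 ht.2] with u hu h1 h2 h3
    exact ⟨h3, tangent_ext (σ t) h1.2 h2.2 hu⟩
  · rintro t ⟨htc, ht⟩
    refine ⟨ht, ?_⟩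
    exact tendsto_nhds_unique_of_frequently_eq (hcσ t ht) (hcτ t ht)
      ((mem_closure_iff_frequently.1 htc).mono fun s hs => hs.2)

theorem IsGeodesicOn.eqOn [T2Space M] {σ τ : ℝ → M} {a b t₀ : ℝ}
    (hσ : IsGeodesicOn (n := n) σ (Ioo a b)) (hτ : IsGeodesicOn (n := n) τ (Ioo a b))
    (ht₀ : t₀ ∈ Ioo a b) (h : velocity (n := n) σ t₀ = velocity τ t₀) : EqOn σ τ (Ioo a b) :=
  fun _ ht => congrArg (fun ξ => ξ.proj) (hσ.velocity_eqOn hτ ht₀ h ht)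

/-- Affine reparametrisations of geodesics are geodesics. -/
theorem IsGeodesicOn.comp_affine {σ : ℝ → M} {s : Set ℝ} (hσ : IsGeodesicOn (n := n) σ s)
    (a b : ℝ) : IsGeodesicOn (n := n) (fun u => σ (a * u + b)) ((fun u => a * u + b) ⁻¹' s) := by
  rw [isGeodesicOn_iff_forall]
  intro t ht
  have hc := mem_extChartAt_source (I := 𝓡 n) (σ (a * t + b))
  obtain ⟨h2, hE⟩ := (isGeodesicOn_singleton_iff _ hc).1
    (hσ.mono (singleton_subset_iff.2 (show a * t + b ∈ s from ht)))
  refine (isGeodesicOn_singleton_iff (σ := fun u => σ (a * u + b)) (σ (a * t + b)) hc).2 ⟨?_, ?_⟩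
  · have : ContMDiffAt 𝓘(ℝ, ℝ) 𝓘(ℝ, ℝ) 2 (fun u : ℝ => a * u + b) t := by
      rw [contMDiffAt_iff_contDiffAt]; fun_prop
    exact h2.comp t this
  · set x : ℝ → 𝔼 := fun u => extChartAt (𝓡 n) (σ (a * t + b)) (σ u) with hx
    have e1 : ∀ f : ℝ → 𝔼, deriv (fun u => f (a * u + b)) = fun u => a • deriv f (a * u + b) := by
      intro f
      ext1 u
      rw [deriv_comp_mul_left (f := fun v => f (v + b)), deriv_comp_add_const]
    have e2 : deriv (deriv (fun u => x (a * u + b))) t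
        = a • a • deriv (deriv x) (a * t + b) := by
      rw [e1, deriv_fun_const_smul_field, e1]
    have e3 := congrFun (e1 x) t
    intro w
    rw [show (fun u => extChartAt (𝓡 n) (σ (a * t + b)) (σ (a * u + b)))
      = fun u => x (a * u + b) from rfl, e2, e3]
    have := hE w
    simp only [map_smul, smul_apply, smul_eq_mul] at this ⊢
    -- the geodesic equation is homogeneous of degree two in the velocity
    linear_combination a ^ 2 * this

/-- Two geodesics with overlapping domains and a common velocity can be glued. -/
theorem IsGeodesicOn.glue [T2Space M] {σ τ : ℝ → M} {a b c d t₀ : ℝ}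
    (hσ : IsGeodesicOn (n := n) σ (Ioo a b)) (hτ : IsGeodesicOn (n := n) τ (Ioo c d))
    (ht₀ : t₀ ∈ Ioo a b) (ht₀' : t₀ ∈ Ioo c d) (h : velocity (n := n) σ t₀ = velocity τ t₀) :
    IsGeodesicOn (n := n) (fun t => if t < t₀ then σ t else τ t) (Ioo a d) ∧
    (∀ t ∈ Ioo a d, t ≤ t₀ → velocity (n := n) (fun t => if t < t₀ then σ t else τ t) t
      = velocity σ t) ∧
    (∀ t ∈ Ioo a d, t₀ ≤ t → velocity (n := n) (fun t => if t < t₀ then σ t else τ t) t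
      = velocity τ t) := by
  have hnear : σ =ᶠ[𝓝 t₀] τ := by
    have h1 : t₀ ∈ Ioo (max a c) (min b d) :=
      ⟨max_lt ht₀.1 ht₀'.1, lt_min ht₀.2 ht₀'.2⟩
    filter_upwards [Ioo_mem_nhds h1.1 h1.2] with t ht
    exact (hσ.mono (Ioo_subset_Ioo (le_max_left a c) (min_le_left b d))).eqOn
      (hτ.mono (Ioo_subset_Ioo (le_max_right a c) (min_le_right b d))) h1 h ht
  have hl : ∀ t ≤ t₀, σ =ᶠ[𝓝 t] (fun t => if t < t₀ then σ t else τ t) := by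
    intro t ht
    rcases ht.lt_or_eq with ht | rfl
    · filter_upwards [Iio_mem_nhds ht] with u hu
      exact (if_pos hu).symm
    · filter_upwards [hnear] with u hu
      split_ifs <;> simp [hu]
  have hr : ∀ t, t₀ ≤ t → τ =ᶠ[𝓝 t] (fun t => if t < t₀ then σ t else τ t) := by
    intro t ht
    rcases ht.lt_or_eq with ht | rfl
    · filter_upwards [Ioi_mem_nhds ht] with u hu
      exact (if_neg (not_lt.2 (le_of_lt hu))).symm
    · filter_upwards [hnear] with u hu
      split_ifs <;> simp [hu]
  refine ⟨?_, fun t _ ht => (velocity_congr (hl t ht)).symm,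
    fun t _ ht => (velocity_congr (hr t ht)).symm⟩
  rw [isGeodesicOn_iff_forall]
  intro t ht
  rcases le_total t t₀ with h' | h'
  · exact isGeodesicOn_congr (hl t h') (hσ.mono (singleton_subset_iff.2
      ⟨ht.1, h'.trans_lt ht₀.2⟩))
  · exact isGeodesicOn_congr (hr t h') (hτ.mono (singleton_subset_iff.2
      ⟨ht₀'.1.trans_le h', ht.2⟩))

/-- Short geodesics exist, and depend `C¹` on their initial velocity. -/
theorem exists_local_geodesic_flow (ξ₀ : TangentBundle (𝓡 n) M) :
    ∃ ε > 0, ∃ N : Set (TangentBundle (𝓡 n) M), IsOpen N ∧ ξ₀ ∈ N ∧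
      ∃ Φ : TangentBundle (𝓡 n) M → ℝ → M, ∀ ξ ∈ N,
        IsGeodesicOn (n := n) (Φ ξ) (Ioo (-ε) ε) ∧ velocity (Φ ξ) 0 = ξ ∧
        ∀ t ∈ Ico 0 ε,
          ContMDiffAt (𝓡 n).tangent (𝓡 n).tangent 1 (fun η => velocity (n := n) (Φ η) t) ξ := by
  set c := ξ₀.proj with hcdef
  have hc : ξ₀.proj ∈ (extChartAt (𝓡 n) c).source := mem_extChartAt_source _
  have hO : IsOpen ((extChartAt (𝓡 n) c).target ×ˢ (univ : Set 𝔼)) :=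
      (isOpen_extChartAt_target c).prod isOpen_univ
  obtain ⟨ε, hε, N, hN, hzN, φ, hφ⟩ := exists_local_flow hO
    ((contDiffOn_geodesicField c).of_le (m := 2) (WithTop.coe_le_coe.2 le_top))
    (z₀ := tchart c ξ₀) ⟨tchart_mem c hc, trivial⟩
  let S : Set (TangentBundle (𝓡 n) M) := (fun ξ => ξ.proj) ⁻¹' (extChartAt (𝓡 n) c).source
  have hS : IsOpen S := (isOpen_extChartAt_source c).preimage continuous_proj
  have hcont : ContinuousOn (tchart c) S := fun ξ hξ =>
    (contMDiffAt_tchart c hξ).continuousAt.continuousWithinAt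
  have hNo : IsOpen (S ∩ tchart c ⁻¹' N) := hcont.isOpen_inter_preimage hS hN
  have hgeo : ∀ ξ ∈ S ∩ tchart c ⁻¹' N, ∀ t ∈ Ioo (-ε) ε,
      IsGeodesicOn (n := n) (fun u => (extChartAt (𝓡 n) c).symm (φ (tchart c ξ) u).1) {t} ∧
      velocity (fun u => (extChartAt (𝓡 n) c).symm (φ (tchart c ξ) u).1) t
        = tsymm c (φ (tchart c ξ) t) := by
    intro ξ hξ t ht
    refine isGeodesicOn_of_hasDerivAt c ?_
    filter_upwards [Ioo_mem_nhds ht.1 ht.2] with u hu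
    exact ⟨((hφ _ hξ.2).2.1 u hu).1.1, ((hφ _ hξ.2).2.1 u hu).2⟩
  have h0 : (0 : ℝ) ∈ Ioo (-ε) ε := ⟨by linarith, hε⟩
  refine ⟨ε, hε, S ∩ tchart c ⁻¹' N, hNo, ⟨hc, hzN⟩,
    fun ξ u => (extChartAt (𝓡 n) c).symm (φ (tchart c ξ) u).1, fun ξ hξ => ⟨?_, ?_, ?_⟩⟩
  · rw [isGeodesicOn_iff_forall]
    exact fun t ht => (hgeo ξ hξ t ht).1
  · rw [(hgeo ξ hξ 0 h0).2, (hφ _ hξ.2).1, tsymm_tchart c hξ.1]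
  · intro t ht
    have ht' : t ∈ Ioo (-ε) ε := ⟨by linarith [ht.1], ht.2⟩
    have h1 : ContMDiffAt (𝓡 n).tangent 𝓘(ℝ, 𝔼 × 𝔼) 1 (fun η => φ (tchart c η) t) ξ :=
      ContMDiffAt.comp (g := fun z => φ z t) ξ ((hφ _ hξ.2).2.2 t ht).contMDiffAt
        ((contMDiffAt_tchart c hξ.1).of_le (by simp))
    have h2 := ContMDiffAt.comp (g := tsymm c) ξ
      ((contMDiffAt_tsymm c ((hφ _ hξ.2).2.1 t ht').1.1).of_le (by simp)) h1
    refine h2.congr_of_eventuallyEq ?_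
    filter_upwards [hNo.mem_nhds hξ] with η hη
    exact (hgeo η hη t ht').2

end GeodesicFlow

/-! ### The exponential map -/

section Exponential

variable {n : ℕ} {M : Type*} [TopologicalSpace M]
  [ChartedSpace (EuclideanSpace ℝ (Fin n)) M]

local notation "𝔼" => EuclideanSpace ℝ (Fin n)

@[simp] theorem fiberSmul_proj (a : ℝ) (ξ : TangentBundle (𝓡 n) M) :
    (fiberSmul a ξ).proj = ξ.proj := rfl

theorem fiberSmul_fiberSmul (a b : ℝ) (ξ : TangentBundle (𝓡 n) M) :
    fiberSmul a (fiberSmul b ξ) = fiberSmul (a * b) ξ :=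
  tangent_mk_eq rfl (smul_smul a b (show 𝔼 from ξ.snd))

@[simp] theorem fiberSmul_one (ξ : TangentBundle (𝓡 n) M) : fiberSmul 1 ξ = ξ :=
  tangent_mk_eq rfl (one_smul ℝ (show 𝔼 from ξ.snd))

theorem exists_Ioo_subset {s : Set ℝ} (hs : IsOpen s) (hc : s.OrdConnected) (h0 : (0 : ℝ) ∈ s)
    (h1 : (1 : ℝ) ∈ s) : ∃ ε > 0, Ioo (-ε) (1 + ε) ⊆ s := by
  obtain ⟨ε₀, hε₀, h0'⟩ := Metric.isOpen_iff.1 hs 0 h0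
  obtain ⟨ε₁, hε₁, h1'⟩ := Metric.isOpen_iff.1 hs 1 h1
  refine ⟨min ε₀ ε₁, lt_min hε₀ hε₁, fun t ht => ?_⟩
  have a0 := min_le_left ε₀ ε₁
  have a1 := min_le_right ε₀ ε₁
  by_cases ht0 : t < 0
  · exact h0' (by rw [Metric.mem_ball, Real.dist_eq, abs_lt]; constructor <;> linarith [ht.1])
  by_cases ht1 : 1 < t
  · exact h1' (by rw [Metric.mem_ball, Real.dist_eq, abs_lt]; constructor <;> linarith [ht.2])
  exact hc.out h0 h1 ⟨not_lt.1 ht0, not_lt.1 ht1⟩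

variable [IsManifold (𝓡 n) ∞ M]

theorem contMDiff_proj : ContMDiff (𝓡 n).tangent (𝓡 n) ∞
    (fun ξ : TangentBundle (𝓡 n) M => ξ.proj) :=
  have : IsManifold (𝓡 n) 1 M := IsManifold.of_le (n := ∞) (by simp)
  Bundle.contMDiff_proj (TangentSpace (𝓡 n) : M → Type _)

theorem contMDiff_fiberSmul : ContMDiff (𝓘(ℝ, ℝ).prod (𝓡 n).tangent) (𝓡 n).tangent ∞
    (fun p : ℝ × TangentBundle (𝓡 n) M => fiberSmul p.1 p.2) := by
  rintro ⟨a, ξ⟩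
  set c := ξ.proj with hcdef
  have hc : ξ.proj ∈ (extChartAt (𝓡 n) c).source := mem_extChartAt_source _
  have h1 : ContMDiffAt (𝓘(ℝ, ℝ).prod (𝓡 n).tangent) 𝓘(ℝ, ℝ × (𝔼 × 𝔼)) ∞
      (fun p : ℝ × TangentBundle (𝓡 n) M => (p.1, tchart c p.2)) (a, ξ) :=
    contMDiffAt_fst.prodMk_space
      (ContMDiffAt.comp (g := tchart c) (a, ξ) (contMDiffAt_tchart c hc) contMDiffAt_snd)
  have h2 : ContDiffAt ℝ ∞ (fun q : ℝ × (𝔼 × 𝔼) => (q.2.1, q.1 • q.2.2)) (a, tchart c ξ) := by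
    fun_prop
  have h3 : ContMDiffAt 𝓘(ℝ, 𝔼 × 𝔼) (𝓡 n).tangent ∞ (tsymm c)
      ((tchart c ξ).1, a • (tchart c ξ).2) := contMDiffAt_tsymm c (tchart_mem c hc)
  have h4 := ContMDiffAt.comp (g := tsymm c) (a, ξ) h3
    (ContMDiffAt.comp (g := fun q : ℝ × (𝔼 × 𝔼) => (q.2.1, q.1 • q.2.2)) (a, ξ) h2.contMDiffAt h1)
  refine h4.congr_of_eventuallyEq ?_
  have hS : IsOpen ((fun p : ℝ × TangentBundle (𝓡 n) M => p.2.proj) ⁻¹'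
      (extChartAt (𝓡 n) c).source) :=
    (isOpen_extChartAt_source c).preimage (continuous_proj.comp continuous_snd)
  filter_upwards [hS.mem_nhds (show (a, ξ) ∈ _ from hc)] with p hp
  simp only [Function.comp_apply]
  rw [← fiberSmul_tsymm, tsymm_tchart c hp]

theorem continuous_fiberSmul :
    Continuous (fun p : ℝ × TangentBundle (𝓡 n) M => fiberSmul p.1 p.2) :=
  contMDiff_fiberSmul.continuous

variable [RiemannianBundle (fun x : M => TangentSpace (𝓡 n) x)]
  [IsContMDiffRiemannianBundle (𝓡 n) ∞ (EuclideanSpace ℝ (Fin n))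
      (fun x : M => TangentSpace (𝓡 n) x)]

/-- The velocity at time `1` of the geodesic with initial velocity `ξ`, with value `ξ` if
`ExpDefined ξ` fails. -/
def expVel (ξ : TangentBundle (𝓡 n) M) : TangentBundle (𝓡 n) M :=
  open Classical in if h : ExpDefined ξ then velocity h.choose 1 else ξ

omit [IsManifold (𝓡 n) ∞ M] [IsContMDiffRiemannianBundle (𝓡 n) ∞ (EuclideanSpace ℝ (Fin n))
      (fun x : M => TangentSpace (𝓡 n) x)] in
theorem expVel_proj (ξ : TangentBundle (𝓡 n) M) : (expVel ξ).proj = riemExp ξ := by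
  unfold expVel riemExp
  split_ifs <;> rfl

theorem expVel_eq [T2Space M] {ξ : TangentBundle (𝓡 n) M} {σ : ℝ → M}
    (h : IsGeodesicWithVelocity ξ σ) : expVel ξ = velocity σ 1 := by
  have hd : ExpDefined ξ := ⟨σ, h⟩
  rw [expVel, dif_pos hd]
  obtain ⟨⟨ε, hε, hσ⟩, h0⟩ := h
  obtain ⟨⟨ε', hε', hσ'⟩, h0'⟩ := hd.choose_spec
  have hm : 0 < min ε ε' := lt_min hε hε'
  refine (hσ'.mono (s' := Ioo (-(min ε ε')) (1 + min ε ε')) ?_).velocity_eqOn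
    (hσ.mono ?_) (t₀ := 0) ⟨by linarith, by linarith⟩ (h0'.trans h0.symm) ⟨by linarith, by linarith⟩
  · exact Ioo_subset_Ioo (by linarith [min_le_right ε ε']) (by linarith [min_le_right ε ε'])
  · exact Ioo_subset_Ioo (by linarith [min_le_left ε ε']) (by linarith [min_le_left ε ε'])

theorem riemExp_eq [T2Space M] {ξ : TangentBundle (𝓡 n) M} {σ : ℝ → M}
    (h : IsGeodesicWithVelocity ξ σ) : riemExp ξ = σ 1 := by
  rw [← expVel_proj, expVel_eq h]; rfl

theorem IsGeodesicOn.isGeodesicWithVelocity {σ : ℝ → M} {a b s t : ℝ}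
    (hσ : IsGeodesicOn (n := n) σ (Ioo a b)) (hs : s ∈ Ioo a b) (ht : t + s ∈ Ioo a b) :
    IsGeodesicWithVelocity (fiberSmul t (velocity (n := n) σ s)) (fun u => σ (t * u + s)) := by
  have hc : ((fun u => t * u + s) ⁻¹' Ioo a b).OrdConnected := by
    refine ⟨fun u hu v hv w hw => ?_⟩
    rcases le_total 0 t with h | h
    · have h1 := mul_le_mul_of_nonneg_left hw.1 h
      have h2 := mul_le_mul_of_nonneg_left hw.2 h
      exact ⟨by linarith [hu.1], by linarith [hv.2]⟩
    · have h1 := mul_le_mul_of_nonpos_left hw.1 h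
      have h2 := mul_le_mul_of_nonpos_left hw.2 h
      exact ⟨by linarith [hv.1], by linarith [hu.2]⟩
  obtain ⟨ε, hε, hsub⟩ := exists_Ioo_subset (s := (fun u => t * u + s) ⁻¹' Ioo a b)
    (isOpen_Ioo.preimage (by fun_prop)) hc (by simpa using hs) (by simpa using ht)
  refine ⟨⟨ε, hε, (hσ.comp_affine t s).mono hsub⟩, ?_⟩
  have := velocity_comp_affine (n := n) (σ := σ) (a := t) (b := s) (t := 0)
    (by simpa using hσ.mdifferentiableAt hs)
  simpa using this

/-- All properties of the exponential map along a geodesic. -/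
theorem IsGeodesicOn.exp [T2Space M] {σ : ℝ → M} {a b s t : ℝ}
    (hσ : IsGeodesicOn (n := n) σ (Ioo a b)) (hs : s ∈ Ioo a b) (ht : t + s ∈ Ioo a b) :
    ExpDefined (fiberSmul t (velocity (n := n) σ s)) ∧
    riemExp (fiberSmul t (velocity (n := n) σ s)) = σ (t + s) ∧
    expVel (fiberSmul t (velocity (n := n) σ s)) = fiberSmul t (velocity σ (t + s)) := by
  have h := hσ.isGeodesicWithVelocity hs ht
  refine ⟨⟨_, h⟩, by rw [riemExp_eq h, mul_one], ?_⟩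
  rw [expVel_eq h, velocity_comp_affine (by simpa using hσ.mdifferentiableAt ht), mul_one]

/-- The geodesics with initial velocity near `ξ` exist up to time `t`, and their velocity at that
time is a `C¹` function of their initial velocity. -/
def HasFlowAt (ξ : TangentBundle (𝓡 n) M) (t : ℝ) : Prop :=
  ∃ Φ : TangentBundle (𝓡 n) M → ℝ → M, ∃ δ > 0,
    (∀ᶠ η in 𝓝 ξ, IsGeodesicOn (n := n) (Φ η) (Ioo (-δ) (t + δ)) ∧ velocity (Φ η) 0 = η) ∧
    ContMDiffAt (𝓡 n).tangent (𝓡 n).tangent 1 (fun η => velocity (n := n) (Φ η) t) ξ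

/-- The flow exists for a time `ε` that does not depend on the initial velocity near `ξ₀`. -/
theorem exists_hasFlowAt (ξ₀ : TangentBundle (𝓡 n) M) :
    ∃ ε > 0, ∀ᶠ ξ in 𝓝 ξ₀, ∀ t ∈ Ico 0 ε, HasFlowAt ξ t := by
  obtain ⟨ε, hε, N, hN, h0, Φ, hΦ⟩ := exists_local_geodesic_flow ξ₀
  refine ⟨ε, hε, ?_⟩
  filter_upwards [hN.mem_nhds h0] with ξ hξ t ht
  refine ⟨Φ, ε - t, by linarith [ht.2], ?_, (hΦ ξ hξ).2.2 t ht⟩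
  filter_upwards [hN.mem_nhds hξ] with η hη
  exact ⟨(hΦ η hη).1.mono (Ioo_subset_Ioo (by linarith [ht.1]) (by linarith)), (hΦ η hη).2.1⟩

/-- The flow up to time `s + t` is the composition of the flows up to the times `s` and `t`. -/
theorem HasFlowAt.trans [T2Space M] {ξ : TangentBundle (𝓡 n) M} {s t a b : ℝ}
    (h : HasFlowAt ξ s) {σ : ℝ → M} (hσ : IsGeodesicOn (n := n) σ (Ioo a b)) (ha : a < 0)
    (hσ0 : velocity σ 0 = ξ) (hs : 0 ≤ s) (hsb : s < b) (ht : 0 ≤ t)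
    (h' : HasFlowAt (velocity (n := n) σ s) t) : HasFlowAt ξ (s + t) := by
  obtain ⟨Φ, δ, hδ, hΦ, hΦs⟩ := h
  obtain ⟨Ψ, δ', hδ', hΨ, hΨt⟩ := h'
  have hv : velocity (Φ ξ) s = velocity (n := n) σ s := by
    have h0 := hΦ.self_of_nhds
    refine (h0.1.mono (s' := Ioo (max (-δ) a) (min (s + δ) b)) (Ioo_subset_Ioo (le_max_left _ _)
      (min_le_left _ _))).velocity_eqOn (hσ.mono (Ioo_subset_Ioo (le_max_right _ _)
      (min_le_right _ _))) (t₀ := 0) ⟨max_lt (by linarith) ha, lt_min (by linarith) (by linarith)⟩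
      (h0.2.trans hσ0.symm) ⟨max_lt (by linarith) (by linarith), lt_min (by linarith) hsb⟩
  rw [← hv] at hΨ hΨt
  have hev := hΦ.and (hΦs.continuousAt.eventually hΨ)
  have key : ∀ᶠ η in 𝓝 ξ,
      IsGeodesicOn (n := n) (fun u => if u < s then Φ η u else Ψ (velocity (Φ η) s) (1 * u + -s))
        (Ioo (-(min δ δ')) (s + t + min δ δ')) ∧
      velocity (n := n)
        (fun u => if u < s then Φ η u else Ψ (velocity (Φ η) s) (1 * u + -s)) 0 = η ∧
      velocity (n := n) (fun u => if u < s then Φ η u else Ψ (velocity (Φ η) s) (1 * u + -s))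
        (s + t) = velocity (Ψ (velocity (Φ η) s)) t := by
    filter_upwards [hev] with η hη
    obtain ⟨⟨g1, g2⟩, g3, g4⟩ := hη
    have g5 := g3.comp_affine 1 (-s)
    have hpre : (fun u : ℝ => 1 * u + -s) ⁻¹' Ioo (-δ') (t + δ') = Ioo (s - δ') (s + t + δ') := by
      ext u
      simp only [mem_preimage, mem_Ioo]
      constructor <;> rintro ⟨h1, h2⟩ <;> constructor <;> linarith
    rw [hpre] at g5
    have g6 : ∀ u ∈ Ioo (s - δ') (s + t + δ'),
        velocity (n := n) (fun u => Ψ (velocity (Φ η) s) (1 * u + -s)) u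
          = velocity (Ψ (velocity (Φ η) s)) (u - s) := by
      intro u hu
      have e : 1 * u + -s = u - s := by ring
      rw [velocity_comp_affine (by
        rw [e]; exact g3.mdifferentiableAt ⟨by linarith [hu.1], by linarith [hu.2]⟩),
        fiberSmul_one, e]
    have hglue := g1.glue g5 (t₀ := s) ⟨by linarith, by linarith⟩ ⟨by linarith, by linarith⟩
      (by rw [g6 s ⟨by linarith, by linarith⟩, sub_self, g4])
    refine ⟨hglue.1.mono (Ioo_subset_Ioo (by linarith [min_le_left δ δ'])
      (by linarith [min_le_right δ δ'])), ?_, ?_⟩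
    · rw [hglue.2.1 0 ⟨by linarith, by linarith⟩ hs, g2]
    · rw [hglue.2.2 (s + t) ⟨by linarith, by linarith⟩ (by linarith),
        g6 (s + t) ⟨by linarith, by linarith⟩, add_sub_cancel_left]
  refine ⟨fun η u => if u < s then Φ η u else Ψ (velocity (Φ η) s) (1 * u + -s), min δ δ',
    lt_min hδ hδ', key.mono fun η hη => ⟨hη.1, hη.2.1⟩, ?_⟩
  have hcomp := ContMDiffAt.comp (g := fun ζ => velocity (n := n) (Ψ ζ) t) ξ hΨt hΦs
  exact hcomp.congr_of_eventuallyEq (key.mono fun η hη => hη.2.2)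

/-- The flow extends along a geodesic, by compactness of the time interval: there is a step that can
be taken from every time. -/
theorem ExpDefined.hasFlowAt [T2Space M] {ξ : TangentBundle (𝓡 n) M} (h : ExpDefined ξ) :
    HasFlowAt ξ 1 := by
  obtain ⟨σ, ⟨ε, hε, hσ⟩, h0⟩ := h
  have hstep : ∀ t₀ : ℝ, ∃ ρ > 0, t₀ ∈ Icc (0 : ℝ) 1 → ∀ s ∈ Metric.ball t₀ ρ,
      ∀ t ∈ Metric.ball t₀ ρ, 0 ≤ s → s ≤ t → t ≤ 1 → HasFlowAt ξ s → HasFlowAt ξ t := by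
    intro t₀
    by_cases ht₀ : t₀ ∈ Icc (0 : ℝ) 1
    swap
    · exact ⟨1, one_pos, fun h => absurd h ht₀⟩
    obtain ⟨ε', hε', hN⟩ := exists_hasFlowAt (velocity (n := n) σ t₀)
    have hc : ContinuousAt (velocity (n := n) σ) t₀ := continuousAt_velocity
      ((hσ.contMDiffAt ⟨by linarith [ht₀.1], by linarith [ht₀.2]⟩).of_le (by norm_num))
    obtain ⟨ρ, hρ, hball⟩ := Metric.eventually_nhds_iff_ball.1 (hc.eventually hN)
    refine ⟨min ρ (ε' / 2), lt_min hρ (by linarith), fun _ s hs t ht h1 h2 h3 hfl => ?_⟩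
    rw [Metric.mem_ball, Real.dist_eq, lt_min_iff, abs_lt, abs_lt] at hs ht
    have := hball s (by rw [Metric.mem_ball, Real.dist_eq, abs_lt]; exact hs.1) (t - s)
      ⟨by linarith, by linarith [hs.2.1, ht.2.2]⟩
    have := hfl.trans hσ (by linarith) h0 h1 (by linarith) (by linarith) this
    rwa [add_sub_cancel] at this
  choose ρ hρ hflow using hstep
  obtain ⟨δ, hδ, hleb⟩ := lebesgue_number_lemma_of_metric (ι := Icc (0 : ℝ) 1)
    (c := fun t => Metric.ball (t : ℝ) (ρ t)) (isCompact_Icc (a := (0 : ℝ)) (b := 1))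
    (fun _ => Metric.isOpen_ball)
    (fun t ht => mem_iUnion.2 ⟨⟨t, ht⟩, Metric.mem_ball_self (hρ t)⟩)
  have hind : ∀ k : ℕ, HasFlowAt ξ (min (k * (δ / 2)) 1) := by
    intro k
    induction k with
    | zero =>
      obtain ⟨ε', hε', hN⟩ := exists_hasFlowAt ξ
      simpa using hN.self_of_nhds 0 ⟨le_rfl, hε'⟩
    | succ k ih =>
      have hk : (0 : ℝ) ≤ k * (δ / 2) := by positivity
      have hmem : min (k * (δ / 2)) 1 ∈ Icc (0 : ℝ) 1 := ⟨le_min hk zero_le_one, min_le_right _ _⟩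
      obtain ⟨t₀, ht₀⟩ := hleb _ hmem
      have hle : min (k * (δ / 2)) 1 ≤ min (((k + 1 : ℕ) : ℝ) * (δ / 2)) 1 := by
        push_cast
        exact min_le_min_right _ (by linarith)
      have hlt : min (((k + 1 : ℕ) : ℝ) * (δ / 2)) 1 < min (k * (δ / 2)) 1 + δ := by
        push_cast
        rcases min_cases ((k : ℝ) * (δ / 2)) 1 with h | h
        · exact (min_le_left _ _).trans_lt (by linarith)
        · exact (min_le_right _ _).trans_lt (by linarith)
      exact hflow t₀ t₀.2 _ (ht₀ (Metric.mem_ball_self hδ)) _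
        (ht₀ (by rw [Metric.mem_ball, Real.dist_eq, abs_lt]; constructor <;> linarith))
        hmem.1 hle (min_le_right _ _) ih
  obtain ⟨k, hk⟩ := exists_nat_gt (1 / (δ / 2))
  have := hind k
  rwa [min_eq_right] at this
  rw [div_lt_iff₀ (by linarith)] at hk
  exact hk.le

theorem ExpDefined.eventually [T2Space M] {ξ : TangentBundle (𝓡 n) M} (h : ExpDefined ξ) :
    ∀ᶠ η in 𝓝 ξ, ExpDefined η := by
  obtain ⟨Φ, δ, hδ, hΦ, -⟩ := h.hasFlowAt
  exact hΦ.mono fun η hη => ⟨Φ η, ⟨δ, hδ, hη.1⟩, hη.2⟩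

theorem contMDiffAt_expVel [T2Space M] {ξ : TangentBundle (𝓡 n) M} (h : ExpDefined ξ) :
    ContMDiffAt (𝓡 n).tangent (𝓡 n).tangent 1 expVel ξ := by
  obtain ⟨Φ, δ, hδ, hΦ, hc⟩ := h.hasFlowAt
  exact hc.congr_of_eventuallyEq (hΦ.mono fun η hη => expVel_eq ⟨⟨δ, hδ, hη.1⟩, hη.2⟩)

theorem contMDiffAt_riemExp [T2Space M] {ξ : TangentBundle (𝓡 n) M} (h : ExpDefined ξ) :
    ContMDiffAt (𝓡 n).tangent (𝓡 n) 1 riemExp ξ := by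
  have h1 := ContMDiffAt.comp (g := fun ξ : TangentBundle (𝓡 n) M => ξ.proj) ξ
    ((contMDiff_proj (n := n) (M := M)).contMDiffAt.of_le (by simp)) (contMDiffAt_expVel h)
  exact h1.congr_of_eventuallyEq (Filter.Eventually.of_forall fun η => (expVel_proj η).symm)

/-- By compactness of `[0, 1]`, the condition at each time being open. -/
theorem isOpen_segmentIn [T2Space M] {U : Set M} (hU : IsOpen U) :
    IsOpen {ξ : TangentBundle (𝓡 n) M | SegmentIn U ξ} := by
  rw [isOpen_iff_mem_nhds]
  intro ξ hξ
  refine isCompact_Icc.eventually_forall_of_forall_eventually fun t ht => ?_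
  obtain ⟨h1, h2⟩ := hξ t ht
  have hev : ∀ᶠ η in 𝓝 (fiberSmul t ξ), ExpDefined η ∧ riemExp η ∈ U :=
    h1.eventually.and ((contMDiffAt_riemExp h1).continuousAt.eventually_mem (hU.mem_nhds h2))
  have hc : Continuous (fun p : TangentBundle (𝓡 n) M × ℝ => fiberSmul p.2 p.1) :=
    continuous_fiberSmul.comp continuous_swap
  exact (hc.tendsto (ξ, t)).eventually hev

end Exponential

/-! ### The logarithm on a normal convex neighbourhood -/

section Logarithm

variable {n : ℕ} {M : Type*} [TopologicalSpace M] [T2Space M]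
  [ChartedSpace (EuclideanSpace ℝ (Fin n)) M] [IsManifold (𝓡 n) ∞ M]
  [RiemannianBundle (fun x : M => TangentSpace (𝓡 n) x)]
  [IsContMDiffRiemannianBundle (𝓡 n) ∞ (EuclideanSpace ℝ (Fin n))
      (fun x : M => TangentSpace (𝓡 n) x)] {U : Set M}

local notation "𝔼" => EuclideanSpace ℝ (Fin n)

omit [T2Space M] [IsManifold (𝓡 n) ∞ M] [IsContMDiffRiemannianBundle (𝓡 n) ∞
  (EuclideanSpace ℝ (Fin n)) (fun x : M => TangentSpace (𝓡 n) x)] in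
theorem SegmentIn.expDefined {ξ : TangentBundle (𝓡 n) M} (h : SegmentIn U ξ) : ExpDefined ξ := by
  simpa using (h 1 ⟨zero_le_one, le_rfl⟩).1

omit [T2Space M] [IsManifold (𝓡 n) ∞ M] [IsContMDiffRiemannianBundle (𝓡 n) ∞
  (EuclideanSpace ℝ (Fin n)) (fun x : M => TangentSpace (𝓡 n) x)] in
theorem SegmentIn.riemExp_mem {ξ : TangentBundle (𝓡 n) M} (h : SegmentIn U ξ) : riemExp ξ ∈ U := by
  simpa using (h 1 ⟨zero_le_one, le_rfl⟩).2

theorem riemExp_fiberSmul_zero {ξ : TangentBundle (𝓡 n) M} (h : ExpDefined ξ) :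
    riemExp (fiberSmul 0 ξ) = ξ.proj := by
  obtain ⟨σ, ⟨ε, hε, hσ⟩, h0⟩ := h
  have := (hσ.exp (s := 0) (t := 0) ⟨by linarith, by linarith⟩ ⟨by linarith, by linarith⟩).2.1
  rw [h0] at this
  rw [this, ← h0]
  simp [velocity]

/-- A geodesic segment in `U` starts with a vector of the ball in the definition of normal
convexity. Otherwise, let `t₀ v` be the first multiple of its initial vector `v` outside the ball.
The inverse of `exp_p` on the ball is continuous at `exp_p (t₀ v)`, so its value there would be
`t₀ v`. -/
theorem SegmentIn.enorm_lt {p : M} {r : ℝ≥0∞}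
    (hinj : InjOn (fun v : TangentSpace (𝓡 n) p => riemExp (n := n) ⟨p, v⟩) {v | ‖v‖ₑ < r})
    (hloc : IsLocalDiffeomorphOn 𝓘(ℝ, TangentSpace (𝓡 n) p) (𝓡 n) ∞
      (fun v : TangentSpace (𝓡 n) p => riemExp (n := n) ⟨p, v⟩) {v | ‖v‖ₑ < r})
    (hr : 0 < r)
    (hsurj : ∀ q ∈ U, ∃ v : TangentSpace (𝓡 n) p, ‖v‖ₑ < r ∧ riemExp (n := n) ⟨p, v⟩ = q)
    {v : TangentSpace (𝓡 n) p} (hv : SegmentIn (n := n) U ⟨p, v⟩) : ‖v‖ₑ < r := by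
  by_contra hlt
  rw [not_lt] at hlt
  have hrtop : r ≠ ⊤ := (hlt.trans_lt enorm_lt_top).ne
  lift r to NNReal using hrtop
  have hr' : (0 : ℝ) < r := by exact_mod_cast hr
  have hb : ∀ w : TangentSpace (𝓡 n) p, ‖w‖ₑ < r ↔ ‖w‖ < r := by
    intro w
    rw [enorm_eq_nnnorm, ENNReal.coe_lt_coe, ← NNReal.coe_lt_coe, coe_nnnorm]
  have hle : (r : ℝ) ≤ ‖v‖ := by
    by_contra h
    exact absurd ((hb v).2 (not_le.1 h)) (not_lt.2 hlt)
  have hv0 : 0 < ‖v‖ := hr'.trans_le hle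
  set t₀ : ℝ := r / ‖v‖ with ht₀
  have ht₀0 : 0 < t₀ := div_pos hr' hv0
  have ht₀1 : t₀ ≤ 1 := (div_le_one hv0).2 hle
  obtain ⟨hexp, hmem⟩ := hv t₀ ⟨ht₀0.le, ht₀1⟩
  obtain ⟨w, hw, hwe⟩ := hsurj _ hmem
  have hmap := hloc.isLocalHomeomorphOn.map_nhds_eq hw
  have hcurve : ContinuousAt (fun t : ℝ => riemExp (fiberSmul t (⟨p, v⟩ : TangentBundle (𝓡 n) M)))
      t₀ := by
    have h1 := (contMDiffAt_riemExp hexp).continuousAt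
    have h2 : Continuous (fun t : ℝ => fiberSmul t (⟨p, v⟩ : TangentBundle (𝓡 n) M)) :=
      continuous_fiberSmul.comp (continuous_id.prodMk continuous_const)
    exact ContinuousAt.comp (f := fun t : ℝ => fiberSmul t (⟨p, v⟩ : TangentBundle (𝓡 n) M)) h1
      h2.continuousAt
  have hball : {v : TangentSpace (𝓡 n) p | ‖v‖ₑ < r} ∈ 𝓝 w := by
    have : {v : TangentSpace (𝓡 n) p | ‖v‖ₑ < r} = {v | ‖v‖ < r} := by ext w; exact hb w
    rw [this]
    exact (isOpen_lt continuous_norm continuous_const).mem_nhds ((hb w).1 hw)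
  have hlim : Filter.Tendsto (fun t : ℝ => t • v) (𝓝[<] t₀) (𝓝 w) := by
    intro N hN
    have h1 : (fun v : TangentSpace (𝓡 n) p => riemExp (n := n) ⟨p, v⟩) ''
        (N ∩ {v | ‖v‖ₑ < r}) ∈ 𝓝 (riemExp (n := n) ⟨p, w⟩) := by
      rw [← hmap]
      exact Filter.image_mem_map (Filter.inter_mem hN hball)
    rw [hwe] at h1
    have h2 := hcurve.continuousWithinAt (s := Iio t₀) |>.eventually h1
    rw [Filter.mem_map]
    filter_upwards [h2, self_mem_nhdsWithin,
      mem_nhdsWithin_of_mem_nhds (Ioi_mem_nhds ht₀0)] with t ht htlt htpos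
    obtain ⟨w', ⟨hw'N, hw'r⟩, hw'e⟩ := ht
    have htv : t • v ∈ {v : TangentSpace (𝓡 n) p | ‖v‖ₑ < r} := by
      refine (hb _).2 ?_
      rw [norm_smul, Real.norm_eq_abs, abs_of_pos htpos, ← lt_div_iff₀ hv0]
      exact htlt
    have := hinj hw'r htv hw'e
    rw [this] at hw'N
    exact hw'N
  have hlim' : Filter.Tendsto (fun t : ℝ => t • v) (𝓝[<] t₀) (𝓝 (t₀ • v)) :=
    ((continuous_id.smul continuous_const).tendsto t₀).mono_left nhdsWithin_le_nhds
  have heq : w = t₀ • v := tendsto_nhds_unique hlim hlim'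
  have hn := (hb w).1 hw
  rw [heq, norm_smul, Real.norm_eq_abs, abs_of_pos ht₀0, ht₀, div_mul_cancel₀ _ hv0.ne'] at hn
  exact lt_irrefl _ hn

/-- In a normal convex set, geodesic segments are determined by their endpoints. -/
theorem IsNormalConvex.segment_unique (hU : IsNormalConvex (n := n) U) {p : M} (hp : p ∈ U)
    {v w : TangentSpace (𝓡 n) p} (hv : SegmentIn (n := n) U ⟨p, v⟩)
    (hw : SegmentIn (n := n) U ⟨p, w⟩) (h : riemExp (n := n) ⟨p, v⟩ = riemExp (n := n) ⟨p, w⟩) :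
    v = w := by
  obtain ⟨r, hr, -, hinj, hloc, hsurj⟩ := hU.2 p hp
  have hs : ∀ q ∈ U, ∃ v : TangentSpace (𝓡 n) p, ‖v‖ₑ < r ∧ riemExp (n := n) ⟨p, v⟩ = q :=
    fun q hq => (hsurj q hq).imp fun v hv => ⟨hv.1, hv.2.1⟩
  exact hinj (hv.enorm_lt hinj hloc hr hs) (hw.enorm_lt hinj hloc hr hs) h

/-- If the backward extension of a geodesic segment stays in `U` and the segment ends in `U`, then
it stays in `U`: its initial vector lies in the ball of the definition of normal convexity. -/
theorem IsNormalConvex.segmentIn_of_neg (hU : IsNormalConvex (n := n) U)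
    {ξ : TangentBundle (𝓡 n) M} (hp : ξ.proj ∈ U) (hneg : SegmentIn U (fiberSmul (-1) ξ))
    (hξ : riemExp ξ ∈ U) : SegmentIn U ξ := by
  obtain ⟨p, v⟩ := ξ
  obtain ⟨r, hr, -, hinj, hloc, hsurj⟩ := hU.2 p hp
  have hs : ∀ q ∈ U, ∃ v : TangentSpace (𝓡 n) p, ‖v‖ₑ < r ∧ riemExp (n := n) ⟨p, v⟩ = q :=
    fun q hq => (hsurj q hq).imp fun v hv => ⟨hv.1, hv.2.1⟩
  have h1 : ‖(-1 : ℝ) • v‖ₑ < r := SegmentIn.enorm_lt hinj hloc hr hs hneg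
  have h2 : ‖v‖ₑ < r := by rwa [neg_one_smul, enorm_neg] at h1
  obtain ⟨w, hw, hwe, hws⟩ := hsurj _ hξ
  rwa [hinj h2 hw hwe.symm]

omit [T2Space M] [IsManifold (𝓡 n) ∞ M] [IsContMDiffRiemannianBundle (𝓡 n) ∞
  (EuclideanSpace ℝ (Fin n)) (fun x : M => TangentSpace (𝓡 n) x)] in
theorem IsNormalConvex.exists_segment (hU : IsNormalConvex (n := n) U) {p q : M} (hp : p ∈ U)
    (hq : q ∈ U) : ∃ v : TangentSpace (𝓡 n) p,
      SegmentIn (n := n) U ⟨p, v⟩ ∧ riemExp (n := n) ⟨p, v⟩ = q := by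
  obtain ⟨r, hr, -, hinj, hloc, hsurj⟩ := hU.2 p hp
  obtain ⟨v, -, h1, h2⟩ := hsurj q hq
  exact ⟨v, h2, h1⟩

omit [T2Space M] [IsManifold (𝓡 n) ∞ M] [IsContMDiffRiemannianBundle (𝓡 n) ∞
  (EuclideanSpace ℝ (Fin n)) (fun x : M => TangentSpace (𝓡 n) x)] in
theorem IsNormalConvex.riemLog_spec (hU : IsNormalConvex (n := n) U) {p q : M} (hp : p ∈ U)
    (hq : q ∈ U) : (riemLog (n := n) U p q).proj = p ∧ SegmentIn U (riemLog (n := n) U p q) ∧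
      riemExp (riemLog (n := n) U p q) = q := by
  have h := hU.exists_segment hp hq
  rw [riemLog, dif_pos h]
  exact ⟨rfl, h.choose_spec⟩

theorem IsNormalConvex.riemLog_riemExp (hU : IsNormalConvex (n := n) U)
    {ξ : TangentBundle (𝓡 n) M} (hp : ξ.proj ∈ U) (hξ : SegmentIn U ξ) :
    riemLog U ξ.proj (riemExp ξ) = ξ := by
  obtain ⟨p, v⟩ := ξ
  have h : ∃ w : TangentSpace (𝓡 n) p,
      SegmentIn (n := n) U ⟨p, w⟩ ∧ riemExp (n := n) ⟨p, w⟩ = riemExp (n := n) ⟨p, v⟩ :=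
    ⟨v, hξ, rfl⟩
  change riemLog U p (riemExp (n := n) ⟨p, v⟩) = _
  rw [riemLog, dif_pos h, hU.segment_unique hp h.choose_spec.1 hξ h.choose_spec.2]

/-- Reversal of a geodesic segment: the reversed segment starts with the opposite of the final
velocity, ends at the starting point, and its final velocity is the opposite of the initial one. -/
theorem SegmentIn.reverse {ξ : TangentBundle (𝓡 n) M} (h : SegmentIn U ξ) :
    SegmentIn U (fiberSmul (-1) (expVel ξ)) ∧ riemExp (fiberSmul (-1) (expVel ξ)) = ξ.proj ∧
      expVel (fiberSmul (-1) (expVel ξ)) = fiberSmul (-1) ξ := by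
  obtain ⟨σ, ⟨ε, hε, hσ⟩, h0⟩ := h.expDefined
  have e1 : expVel ξ = velocity σ 1 := expVel_eq ⟨⟨ε, hε, hσ⟩, h0⟩
  have key : ∀ t ∈ Icc (0 : ℝ) 1, _ := fun t ht =>
    hσ.exp (s := 1) (t := -t) ⟨by linarith, by linarith⟩ ⟨by linarith [ht.2], by linarith [ht.1]⟩
  have key1 := key 1 ⟨zero_le_one, le_rfl⟩
  rw [e1]
  refine ⟨fun t ht => ?_, ?_, ?_⟩
  · rw [fiberSmul_fiberSmul, mul_neg_one]
    refine ⟨(key t ht).1, ?_⟩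
    rw [(key t ht).2.1]
    have h2 := hσ.exp (s := 0) (t := -t + 1) ⟨by linarith, by linarith⟩
      ⟨by linarith [ht.2], by linarith [ht.1]⟩
    rw [h0, add_zero] at h2
    rw [← h2.2.1]
    exact (h (-t + 1) ⟨by linarith [ht.2], by linarith [ht.1]⟩).2
  · rw [key1.2.1, ← h0]
    simp [velocity]
  · rw [key1.2.2, neg_add_cancel, h0]

end Logarithm

/-! ### Regularity of the logarithm -/

section LogarithmRegularity

variable {n : ℕ} {M : Type*} [TopologicalSpace M] [T2Space M]
  [ChartedSpace (EuclideanSpace ℝ (Fin n)) M] [IsManifold (𝓡 n) ∞ M]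
  [RiemannianBundle (fun x : M => TangentSpace (𝓡 n) x)]
  [IsContMDiffRiemannianBundle (𝓡 n) ∞ (EuclideanSpace ℝ (Fin n))
      (fun x : M => TangentSpace (𝓡 n) x)] {U : Set M}

local notation "𝔼" => EuclideanSpace ℝ (Fin n)

omit [T2Space M] [RiemannianBundle (fun x : M => TangentSpace (𝓡 n) x)]
  [IsContMDiffRiemannianBundle (𝓡 n) ∞ (EuclideanSpace ℝ (Fin n))
      (fun x : M => TangentSpace (𝓡 n) x)] in
/-- The coordinate expression of a local diffeomorphism `f` from a vector space `V` to `M` has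
injective derivative. Here `e` compares `𝔼` with `V`; for `V = T_p M`, the two are the same vector
space with different norms. -/
theorem injective_fderiv_of_isLocalDiffeomorphAt {V : Type*} [NormedAddCommGroup V]
    [NormedSpace ℝ V] {f : V → M} {e : 𝔼 →L[ℝ] V} (he : Function.Injective e) {b : 𝔼}
    (h : IsLocalDiffeomorphAt 𝓘(ℝ, V) (𝓡 n) ∞ f (e b)) {q : M} (hq : f (e b) = q)
    {B : 𝔼 →L[ℝ] 𝔼} (hB : HasFDerivAt (fun b : 𝔼 => extChartAt (𝓡 n) q (f (e b))) B b) :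
    Function.Injective B := by
  subst hq
  let D := h.mfderivToContinuousLinearEquiv (by simp)
  have h1 : HasMFDerivAt 𝓘(ℝ, 𝔼) 𝓘(ℝ, V) e b e := e.hasFDerivAt.hasMFDerivAt
  have h2 : HasMFDerivAt 𝓘(ℝ, V) (𝓡 n) f (e b)
      (D : TangentSpace 𝓘(ℝ, V) (e b) →L[ℝ] TangentSpace (𝓡 n) (f (e b))) :=
    (h.mdifferentiableAt (by simp)).hasMFDerivAt
  have h3 : HasMFDerivAt (𝓡 n) 𝓘(ℝ, 𝔼) (extChartAt (𝓡 n) (f (e b))) (f (e b))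
      (ContinuousLinearMap.id ℝ 𝔼) := by
    have : IsManifold (𝓡 n) 1 M := IsManifold.of_le (n := ∞) (by simp)
    have h4 : MDifferentiableAt (𝓡 n) 𝓘(ℝ, 𝔼) (extChartAt (𝓡 n) (f (e b))) (f (e b)) :=
      (contMDiffAt_chart _ (mem_extChartAt_source _)).mdifferentiableAt (by simp)
    have h5 := h4.hasMFDerivAt
    rwa [mfderiv_extChartAt_self] at h5
  let A : 𝔼 →L[ℝ] 𝔼 := (ContinuousLinearMap.id ℝ 𝔼).comp
    ((D : TangentSpace 𝓘(ℝ, V) (e b) →L[ℝ] TangentSpace (𝓡 n) (f (e b))).comp e)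
  have h6 : HasFDerivAt (fun x : 𝔼 => extChartAt (𝓡 n) (f (e b)) (f (e x))) A b :=
    (h3.comp b (h2.comp b h1)).hasFDerivAt
  rw [← h6.unique hB]
  exact D.injective.comp he

/-- The logarithm is `C¹`, by the inverse function theorem for `(p, v) ↦ (p, exp_p v)`. -/
theorem IsNormalConvex.contMDiffAt_riemLog (hU : IsNormalConvex (n := n) U) {p₀ q₀ : M}
    (hp : p₀ ∈ U) (hq : q₀ ∈ U) :
    ContMDiffAt ((𝓡 n).prod (𝓡 n)) (𝓡 n).tangent 1
      (fun x : M × M => riemLog (n := n) U x.1 x.2) (p₀, q₀) := by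
  obtain ⟨v₀, hseg, hexp⟩ := hU.exists_segment hp hq
  have hdiff : IsLocalDiffeomorphAt 𝓘(ℝ, TangentSpace (𝓡 n) p₀) (𝓡 n) ∞
      (fun v : TangentSpace (𝓡 n) p₀ => riemExp (n := n) ⟨p₀, v⟩) v₀ := by
    obtain ⟨r, hr, -, hinj, hloc, hsurj⟩ := hU.2 p₀ hp
    exact hloc ⟨v₀, hseg.enorm_lt hinj hloc hr
      fun q hq => (hsurj q hq).imp fun v hv => ⟨hv.1, hv.2.1⟩⟩
  set φ := extChartAt (𝓡 n) p₀ with hφ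
  set ψ := extChartAt (𝓡 n) q₀ with hψ
  let z₀ : 𝔼 × 𝔼 := (φ p₀, v₀)
  have hz₀ : tsymm p₀ z₀ = ⟨p₀, v₀⟩ := tsymm_self p₀ v₀
  have hz₀t : z₀.1 ∈ φ.target := mem_extChartAt_target p₀
  have hs1 : ContMDiffAt 𝓘(ℝ, 𝔼 × 𝔼) (𝓡 n).tangent 1 (tsymm p₀) z₀ :=
    (contMDiffAt_tsymm p₀ hz₀t).of_le (by simp)
  have hs2 : ContMDiffAt 𝓘(ℝ, 𝔼 × 𝔼) (𝓡 n) 1 (fun z => riemExp (tsymm p₀ z)) z₀ := by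
    refine ContMDiffAt.comp (g := riemExp) z₀ ?_ hs1
    rw [hz₀]
    exact contMDiffAt_riemExp hseg.expDefined
  have hval : riemExp (tsymm p₀ z₀) = q₀ := by rw [hz₀, hexp]
  have hg : ContDiffAt ℝ 1 (fun z => ψ (riemExp (tsymm p₀ z))) z₀ := by
    rw [← contMDiffAt_iff_contDiffAt]
    refine ContMDiffAt.comp (g := ψ) z₀ ?_ hs2
    rw [hval]
    exact (contMDiffAt_chart q₀ (mem_extChartAt_source q₀)).of_le (by simp)
  obtain ⟨g', hg'⟩ : ∃ g', HasFDerivAt (fun z => ψ (riemExp (tsymm p₀ z))) g' z₀ :=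
    ⟨_, (hg.differentiableAt (by simp)).hasFDerivAt⟩
  have hB : Function.Injective (g'.comp (ContinuousLinearMap.inr ℝ 𝔼 𝔼)) := by
    -- the identity, from the Euclidean norm to the norm of the Riemannian metric
    let e : 𝔼 →L[ℝ] TangentSpace (𝓡 n) p₀ := LinearMap.toContinuousLinearMap
      (E := 𝔼) (F' := TangentSpace (𝓡 n) p₀) (LinearMap.id (M := 𝔼))
    refine injective_fderiv_of_isLocalDiffeomorphAt (e := e) (b := z₀.2) (fun _ _ h => h) hdiff
      hexp ?_
    have h1 := HasFDerivAt.comp (g := fun z => ψ (riemExp (tsymm p₀ z))) z₀.2 hg'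
      (hasFDerivAt_prodMk_right (𝕜 := ℝ) (φ p₀) z₀.2)
    refine h1.congr_of_eventuallyEq (Filter.Eventually.of_forall fun b => ?_)
    exact congrArg (fun ξ => ψ (riemExp ξ)) (tsymm_self p₀ b).symm
  -- the map `(p, v) ↦ (p, exp_p v)` in coordinates
  let H : 𝔼 × 𝔼 → 𝔼 × 𝔼 := fun z => (z.1, ψ (riemExp (tsymm p₀ z)))
  have hH : ContDiffAt ℝ 1 H z₀ := contDiffAt_fst.prodMk hg
  have hH' : HasFDerivAt H ((ContinuousLinearMap.fst ℝ 𝔼 𝔼).prod g') z₀ :=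
    hasFDerivAt_fst.prodMk hg'
  have hinj : Function.Injective ((ContinuousLinearMap.fst ℝ 𝔼 𝔼).prod g') := by
    rw [injective_iff_map_eq_zero]
    rintro ⟨a, b⟩ hab
    rw [ContinuousLinearMap.prod_apply, Prod.mk_eq_zero] at hab
    obtain ⟨rfl, h2⟩ : a = 0 ∧ _ := hab
    rw [injective_iff_map_eq_zero] at hB
    rw [hB b h2]
    rfl
  let A : (𝔼 × 𝔼) ≃L[ℝ] 𝔼 × 𝔼 := (LinearEquiv.ofInjectiveEndo
    (((ContinuousLinearMap.fst ℝ 𝔼 𝔼).prod g' : 𝔼 × 𝔼 →L[ℝ] 𝔼 × 𝔼) : 𝔼 × 𝔼 →ₗ[ℝ] 𝔼 × 𝔼)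
    hinj).toContinuousLinearEquiv
  have hA : HasFDerivAt H (A : 𝔼 × 𝔼 →L[ℝ] 𝔼 × 𝔼) z₀ := by
    convert hH' using 1
    ext z <;> rfl
  have hinv := hH.to_localInverse hA one_ne_zero
  have hinv0 := hH.localInverse_apply_image hA one_ne_zero
  have hright : ∀ᶠ y in 𝓝 (H z₀), H (hH.localInverse hA one_ne_zero y) = y :=
    (hH.hasStrictFDerivAt' hA one_ne_zero).eventually_right_inverse
  set J := hH.localInverse hA one_ne_zero with hJ
  have hHz₀ : H z₀ = (φ p₀, ψ q₀) := Prod.ext rfl (congrArg ψ hval)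
  rw [hHz₀] at hinv hinv0 hright
  have hc : ContMDiffAt ((𝓡 n).prod (𝓡 n)) 𝓘(ℝ, 𝔼 × 𝔼) 1
      (fun x : M × M => (φ x.1, ψ x.2)) (p₀, q₀) := by
    refine ContMDiffAt.prodMk_space ?_ ?_
    · exact ContMDiffAt.comp (g := φ) (p₀, q₀)
        ((contMDiffAt_chart p₀ (mem_extChartAt_source p₀)).of_le (by simp)) contMDiffAt_fst
    · exact ContMDiffAt.comp (g := ψ) (p₀, q₀)
        ((contMDiffAt_chart q₀ (mem_extChartAt_source q₀)).of_le (by simp)) contMDiffAt_snd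
  have hJc : ContMDiffAt ((𝓡 n).prod (𝓡 n)) 𝓘(ℝ, 𝔼 × 𝔼) 1
      (fun x : M × M => J (φ x.1, ψ x.2)) (p₀, q₀) :=
    ContMDiffAt.comp (g := J) (p₀, q₀) hinv.contMDiffAt hc
  have hK : ContMDiffAt ((𝓡 n).prod (𝓡 n)) (𝓡 n).tangent 1
      (fun x : M × M => tsymm p₀ (J (φ x.1, ψ x.2))) (p₀, q₀) := by
    refine ContMDiffAt.comp (g := tsymm p₀) (p₀, q₀) ?_ hJc
    rw [hinv0]
    exact hs1
  -- near `(p₀, q₀)`, the inverse of `H` produces a segment in `U` from `p` to `q`, and segments are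
  -- unique
  refine hK.congr_of_eventuallyEq ?_
  have e1 := hc.continuousAt.eventually hright
  have hlim : Filter.Tendsto (fun x : M × M => tsymm p₀ (J (φ x.1, ψ x.2))) (𝓝 (p₀, q₀))
      (𝓝 ⟨p₀, v₀⟩) := by
    have := hK.continuousAt.tendsto
    rwa [hinv0, hz₀] at this
  have e2 := hlim.eventually ((isOpen_segmentIn hU.1).mem_nhds hseg)
  have e3 := hlim.eventually (((contMDiffAt_riemExp hseg.expDefined).continuousAt.eventually_mem
    (s := ψ.source) ((isOpen_extChartAt_source q₀).mem_nhds
      (by rw [hexp]; exact mem_extChartAt_source q₀))))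
  have e4 := hlim.eventually (continuous_proj.continuousAt.eventually_mem (s := φ.source ∩ U)
    (((isOpen_extChartAt_source p₀).inter hU.1).mem_nhds ⟨mem_extChartAt_source p₀, hp⟩))
  have e5 : ∀ᶠ x : M × M in 𝓝 (p₀, q₀), x.1 ∈ φ.source :=
    continuousAt_fst.eventually_mem (extChartAt_source_mem_nhds p₀)
  have e6 : ∀ᶠ x : M × M in 𝓝 (p₀, q₀), x.2 ∈ ψ.source :=
    continuousAt_snd.eventually_mem (extChartAt_source_mem_nhds q₀)
  have e7 : ∀ᶠ x : M × M in 𝓝 (p₀, q₀), (J (φ x.1, ψ x.2)).1 ∈ φ.target := by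
    refine (continuous_fst.continuousAt.comp hJc.continuousAt).eventually_mem ?_
    simp only [Function.comp_apply]
    rw [hinv0]
    exact (isOpen_extChartAt_target p₀).mem_nhds hz₀t
  filter_upwards [e1, e2, e3, e4, e5, e6, e7] with ⟨p, q⟩ h1 h2 h3 h4 h5 h6 h7
  set z := J (φ p, ψ q) with hz
  have hz1 : z.1 = φ p := congrArg Prod.fst h1
  have hz2 : ψ (riemExp (tsymm p₀ z)) = ψ q := congrArg Prod.snd h1
  have hpe : (tsymm p₀ z).proj = p := by
    change φ.symm z.1 = p
    rw [hz1, φ.left_inv h5]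
  have hqe : riemExp (tsymm p₀ z) = q := ψ.injOn h3 h6 hz2
  have := hU.riemLog_riemExp h4.2 h2
  rwa [hpe, hqe] at this

end LogarithmRegularity

/-! ### Bézier curves -/

section BezierCurves

variable {n : ℕ} {M : Type*} [TopologicalSpace M]
  [ChartedSpace (EuclideanSpace ℝ (Fin n)) M] [IsManifold (𝓡 n) ∞ M]

local notation "𝔼" => EuclideanSpace ℝ (Fin n)

/-- The derivative of `u ↦ G (u, u)` is the sum of the partial derivatives of `G`. -/
theorem velocity_diagonal {G : ℝ × ℝ → M} {s : ℝ}
    (hG : MDifferentiableAt 𝓘(ℝ, ℝ × ℝ) (𝓡 n) G (s, s)) {ξ : TangentBundle (𝓡 n) M} {a b : ℝ}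
    (h1 : velocity (fun u => G (u, s)) s = fiberSmul a ξ)
    (h2 : velocity (fun u => G (s, u)) s = fiberSmul b ξ) :
    velocity (fun u => G (u, u)) s = fiberSmul (a + b) ξ := by
  set c := G (s, s) with hcdef
  have hc : G (s, s) ∈ (extChartAt (𝓡 n) c).source := mem_extChartAt_source _
  have hproj : ξ.proj = c := (congrArg (fun ξ => ξ.proj) h1).symm
  have hf : DifferentiableAt ℝ (fun z => extChartAt (𝓡 n) c (G z)) (s, s) :=
    (((contMDiffAt_chart c hc).mdifferentiableAt (by simp)).comp (s, s) hG).differentiableAt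
  have key : ∀ l : ℝ → ℝ × ℝ, ∀ l' : ℝ × ℝ, HasDerivAt l l' s → l s = (s, s) →
      tchart c (velocity (fun u => G (l u)) s)
        = (extChartAt (𝓡 n) c c, fderiv ℝ (fun z => extChartAt (𝓡 n) c (G z)) (s, s) l') := by
    intro l l' hl hls
    have hd : MDifferentiableAt 𝓘(ℝ, ℝ) (𝓡 n) (fun u => G (l u)) s := by
      refine MDifferentiableAt.comp (g := G) s ?_ hl.differentiableAt.mdifferentiableAt
      rwa [hls]
    rw [tchart_velocity c hd (by rw [hls]; exact hc)]
    refine Prod.ext (by simp only [hls]; rfl) ?_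
    rw [← hls] at hf
    have := (hf.hasFDerivAt.comp_hasDerivAt s hl).deriv
    rw [hls] at this
    exact this
  have k1 := key (fun u => (u, s)) (1, 0) ((hasDerivAt_id s).prodMk (hasDerivAt_const s s)) rfl
  have k2 := key (fun u => (s, u)) (0, 1) ((hasDerivAt_const s s).prodMk (hasDerivAt_id s)) rfl
  have k3 := key (fun u => (u, u)) (1, 1) ((hasDerivAt_id s).prodMk (hasDerivAt_id s)) rfl
  rw [h1, tchart_fiberSmul] at k1
  rw [h2, tchart_fiberSmul] at k2
  refine tangent_ext c hc (by rw [fiberSmul_proj, hproj]; exact hc) ?_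
  have e1 : a • (tchart c ξ).2 = _ := congrArg Prod.snd k1
  have e2 : b • (tchart c ξ).2 = _ := congrArg Prod.snd k2
  rw [k3, tchart_fiberSmul, add_smul, e1, e2, ← map_add]
  exact Prod.ext (congrArg Prod.fst k1).symm (by simp)

variable [T2Space M] [RiemannianBundle (fun x : M => TangentSpace (𝓡 n) x)]
  [IsContMDiffRiemannianBundle (𝓡 n) ∞ (EuclideanSpace ℝ (Fin n))
      (fun x : M => TangentSpace (𝓡 n) x)] {U : Set M}

omit [IsManifold (𝓡 n) ∞ M] [T2Space M] [IsContMDiffRiemannianBundle (𝓡 n) ∞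
  (EuclideanSpace ℝ (Fin n)) (fun x : M => TangentSpace (𝓡 n) x)] in
theorem IsNormalConvex.geod_mem (hU : IsNormalConvex (n := n) U) {p q : M} (hp : p ∈ U)
    (hq : q ∈ U) {t : ℝ} (ht : t ∈ Icc (0 : ℝ) 1) : geod (n := n) U t p q ∈ U :=
  ((hU.riemLog_spec hp hq).2.1 t ht).2

theorem IsNormalConvex.geod_zero (hU : IsNormalConvex (n := n) U) {p q : M} (hp : p ∈ U)
    (hq : q ∈ U) : geod (n := n) U 0 p q = p := by
  obtain ⟨h1, h2, -⟩ := hU.riemLog_spec hp hq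
  rw [geod, riemExp_fiberSmul_zero h2.expDefined, h1]

omit [IsManifold (𝓡 n) ∞ M] [T2Space M] [IsContMDiffRiemannianBundle (𝓡 n) ∞
  (EuclideanSpace ℝ (Fin n)) (fun x : M => TangentSpace (𝓡 n) x)] in
theorem IsNormalConvex.geod_one (hU : IsNormalConvex (n := n) U) {p q : M} (hp : p ∈ U)
    (hq : q ∈ U) : geod (n := n) U 1 p q = q := by
  rw [geod, fiberSmul_one, (hU.riemLog_spec hp hq).2.2]

theorem IsNormalConvex.contMDiffAt_geod (hU : IsNormalConvex (n := n) U) {p q : M} (hp : p ∈ U)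
    (hq : q ∈ U) {t : ℝ} (ht : t ∈ Icc (0 : ℝ) 1) :
    ContMDiffAt (𝓘(ℝ, ℝ).prod ((𝓡 n).prod (𝓡 n))) (𝓡 n) 1
      (fun x : ℝ × M × M => geod (n := n) U x.1 x.2.1 x.2.2) (t, p, q) := by
  have h1 : ContMDiffAt (𝓘(ℝ, ℝ).prod ((𝓡 n).prod (𝓡 n))) (𝓡 n).tangent 1
      (fun x : ℝ × M × M => riemLog (n := n) U x.2.1 x.2.2) (t, p, q) :=
    ContMDiffAt.comp (g := fun x : M × M => riemLog (n := n) U x.1 x.2) (t, p, q)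
      (hU.contMDiffAt_riemLog hp hq) contMDiffAt_snd
  have h2 : ContMDiffAt (𝓘(ℝ, ℝ).prod ((𝓡 n).prod (𝓡 n))) (𝓡 n).tangent 1
      (fun x : ℝ × M × M => fiberSmul x.1 (riemLog (n := n) U x.2.1 x.2.2)) (t, p, q) :=
    ContMDiffAt.comp (g := fun p : ℝ × TangentBundle (𝓡 n) M => fiberSmul p.1 p.2) (t, p, q)
      ((contMDiff_fiberSmul (n := n) (M := M)).contMDiffAt.of_le (by simp))
      (contMDiffAt_fst.prodMk h1)
  exact ContMDiffAt.comp (g := riemExp) (t, p, q)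
    (contMDiffAt_riemExp ((hU.riemLog_spec hp hq).2.1 t ht).1) h2

theorem IsNormalConvex.velocity_geod (hU : IsNormalConvex (n := n) U) {p q : M} (hp : p ∈ U)
    (hq : q ∈ U) : velocity (n := n) (fun t => geod (n := n) U t p q) 0 = riemLog U p q ∧
      velocity (n := n) (fun t => geod (n := n) U t p q) 1 = expVel (riemLog U p q) := by
  have hs := (hU.riemLog_spec hp hq).2.1.expDefined
  obtain ⟨σ, ⟨ε, hε, hσ⟩, h0⟩ := hs
  have heq : EqOn (fun t => geod (n := n) U t p q) σ (Ioo (-ε) (1 + ε)) := by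
    intro t ht
    have := (hσ.exp (s := 0) (t := t) ⟨by linarith, by linarith⟩ (by rwa [add_zero])).2.1
    rwa [h0, add_zero] at this
  refine ⟨?_, ?_⟩
  · rw [velocity_congr (heq.eventuallyEq_of_mem (Ioo_mem_nhds (by linarith) (by linarith))), h0]
  · rw [velocity_congr (heq.eventuallyEq_of_mem (Ioo_mem_nhds (by linarith) (by linarith))),
      expVel_eq ⟨⟨ε, hε, hσ⟩, h0⟩]

omit [IsManifold (𝓡 n) ∞ M] [T2Space M] [IsContMDiffRiemannianBundle (𝓡 n) ∞
  (EuclideanSpace ℝ (Fin n)) (fun x : M => TangentSpace (𝓡 n) x)] in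
theorem IsNormalConvex.bezier_mem (hU : IsNormalConvex (n := n) U) {k : ℕ} {P : Fin (k + 1) → M}
    (hP : ∀ i, P i ∈ U) {t : ℝ} (ht : t ∈ Icc (0 : ℝ) 1) : bezier (n := n) U k P t ∈ U := by
  induction k with
  | zero => exact hP 0
  | succ k ih => exact hU.geod_mem (ih fun i => hP _) (ih fun i => hP _) ht

theorem IsNormalConvex.contMDiffAt_bezier (hU : IsNormalConvex (n := n) U) {k : ℕ}
    {P : Fin (k + 1) → M} (hP : ∀ i, P i ∈ U) {t : ℝ} (ht : t ∈ Icc (0 : ℝ) 1) :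
    ContMDiffAt 𝓘(ℝ, ℝ) (𝓡 n) 1 (bezier (n := n) U k P) t := by
  induction k with
  | zero => exact contMDiffAt_const
  | succ k ih =>
    exact ContMDiffAt.comp (g := fun x : ℝ × M × M => geod (n := n) U x.1 x.2.1 x.2.2) t
      (hU.contMDiffAt_geod (hU.bezier_mem (fun i => hP _) ht) (hU.bezier_mem (fun i => hP _) ht) ht)
      (contMDiffAt_id.prodMk ((ih fun i => hP _).prodMk (ih fun i => hP _)))

theorem IsNormalConvex.bezier_zero (hU : IsNormalConvex (n := n) U) {k : ℕ} {P : Fin (k + 1) → M}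
    (hP : ∀ i, P i ∈ U) : bezier (n := n) U k P 0 = P 0 := by
  induction k with
  | zero => rfl
  | succ k ih =>
    rw [bezier, ih fun i => hP _, ih fun i => hP _, hU.geod_zero (hP _) (hP _)]
    rfl

omit [IsManifold (𝓡 n) ∞ M] [T2Space M] [IsContMDiffRiemannianBundle (𝓡 n) ∞
  (EuclideanSpace ℝ (Fin n)) (fun x : M => TangentSpace (𝓡 n) x)] in
theorem IsNormalConvex.bezier_one (hU : IsNormalConvex (n := n) U) {k : ℕ} {P : Fin (k + 1) → M}
    (hP : ∀ i, P i ∈ U) : bezier (n := n) U k P 1 = P (Fin.last k) := by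
  induction k with
  | zero => rfl
  | succ k ih =>
    rw [bezier, ih fun i => hP _, ih fun i => hP _, hU.geod_one (hP _) (hP _), Fin.succ_last]

/-- The time derivative in one step of de Casteljau's algorithm, at `s = 0` or `s = 1`: the
derivative of the geodesic from `f s` to `g s` is added to that of the curve which the geodesics
from `f u` to `g u` trace out at time `s`. -/
theorem IsNormalConvex.velocity_geod_comp (hU : IsNormalConvex (n := n) U) {f g : ℝ → M} {s : ℝ}
    (hs : s ∈ Icc (0 : ℝ) 1) (hf : ContMDiffAt 𝓘(ℝ, ℝ) (𝓡 n) 1 f s)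
    (hg : ContMDiffAt 𝓘(ℝ, ℝ) (𝓡 n) 1 g s) (hfU : f s ∈ U) (hgU : g s ∈ U)
    {ξ : TangentBundle (𝓡 n) M} {b : ℝ}
    (h1 : velocity (n := n) (fun t => geod (n := n) U t (f s) (g s)) s = ξ)
    (h2 : velocity (n := n) (fun t => geod (n := n) U s (f t) (g t)) s = fiberSmul b ξ) :
    velocity (n := n) (fun t => geod (n := n) U t (f t) (g t)) s = fiberSmul (b + 1) ξ := by
  have hG : ContMDiffAt 𝓘(ℝ, ℝ × ℝ) (𝓡 n) 1
      (fun z : ℝ × ℝ => geod (n := n) U z.1 (f z.2) (g z.2)) (s, s) := by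
    have hfst : ContMDiffAt 𝓘(ℝ, ℝ × ℝ) 𝓘(ℝ, ℝ) 1 (fun z : ℝ × ℝ => z.1) (s, s) :=
      contDiffAt_fst.contMDiffAt
    have hsnd : ContMDiffAt 𝓘(ℝ, ℝ × ℝ) 𝓘(ℝ, ℝ) 1 (fun z : ℝ × ℝ => z.2) (s, s) :=
      contDiffAt_snd.contMDiffAt
    exact ContMDiffAt.comp (g := fun x : ℝ × M × M => geod (n := n) U x.1 x.2.1 x.2.2) (s, s)
      (hU.contMDiffAt_geod hfU hgU hs)
      (hfst.prodMk ((ContMDiffAt.comp (g := f) (s, s) hf hsnd).prodMk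
        (ContMDiffAt.comp (g := g) (s, s) hg hsnd)))
  rw [add_comm]
  exact velocity_diagonal (hG.mdifferentiableAt (by simp)) (by rw [h1, fiberSmul_one]) h2

/-- Each step of de Casteljau's algorithm adds `log_{p₀} p₁` to the derivative at `0`. -/
theorem IsNormalConvex.velocity_bezier_zero (hU : IsNormalConvex (n := n) U) {k : ℕ}
    {P : Fin (k + 2) → M} (hP : ∀ i, P i ∈ U) :
    velocity (n := n) (bezier (n := n) U (k + 1) P) 0
      = fiberSmul (k + 1) (riemLog U (P 0) (P 1)) := by
  induction k with
  | zero =>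
    refine Eq.trans (hU.velocity_geod (hP 0) (hP 1)).1 ?_
    simp
  | succ k ih =>
    have h0 : (0 : ℝ) ∈ Icc (0 : ℝ) 1 := ⟨le_rfl, zero_le_one⟩
    set f := bezier (n := n) U (k + 1) (fun i => P i.castSucc) with hf
    set g := bezier (n := n) U (k + 1) (fun i => P i.succ) with hg
    have hfc : ContMDiffAt 𝓘(ℝ, ℝ) (𝓡 n) 1 f 0 := hU.contMDiffAt_bezier (fun i => hP _) h0
    have hgc : ContMDiffAt 𝓘(ℝ, ℝ) (𝓡 n) 1 g 0 := hU.contMDiffAt_bezier (fun i => hP _) h0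
    have hf0 : f 0 = P 0 := hU.bezier_zero fun i => hP _
    have hg0 : g 0 = P 1 := hU.bezier_zero fun i => hP _
    refine (hU.velocity_geod_comp (f := f) (g := g) h0 hfc hgc (hf0 ▸ hP 0) (hg0 ▸ hP 1)
      (b := k + 1) (ξ := riemLog U (P 0) (P 1)) ?_ ?_).trans (by push_cast; rfl)
    · rw [hf0, hg0]
      exact (hU.velocity_geod (hP 0) (hP 1)).1
    · have hev : (fun t => geod (n := n) U 0 (f t) (g t)) =ᶠ[𝓝 0] f := by
        filter_upwards [hfc.continuousAt.eventually_mem (hU.1.mem_nhds (hf0 ▸ hP 0)),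
          hgc.continuousAt.eventually_mem (hU.1.mem_nhds (hg0 ▸ hP 1))] with t h1 h2
        exact hU.geod_zero h1 h2
      rw [velocity_congr hev]
      exact ih fun i => hP _

/-- Each step of de Casteljau's algorithm adds the final velocity of the last geodesic of the
control polygon to the derivative at `1`. -/
theorem IsNormalConvex.velocity_bezier_one (hU : IsNormalConvex (n := n) U) {k : ℕ}
    {P : Fin (k + 2) → M} (hP : ∀ i, P i ∈ U) :
    velocity (n := n) (bezier (n := n) U (k + 1) P) 1
      = fiberSmul (k + 1)
        (expVel (riemLog U (P (Fin.last k).castSucc) (P (Fin.last (k + 1))))) := by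
  induction k with
  | zero =>
    refine Eq.trans (hU.velocity_geod (hP 0) (hP 1)).2 ?_
    simp
  | succ k ih =>
    have h0 : (1 : ℝ) ∈ Icc (0 : ℝ) 1 := ⟨zero_le_one, le_rfl⟩
    set f := bezier (n := n) U (k + 1) (fun i => P i.castSucc) with hf
    set g := bezier (n := n) U (k + 1) (fun i => P i.succ) with hg
    have hfc : ContMDiffAt 𝓘(ℝ, ℝ) (𝓡 n) 1 f 1 := hU.contMDiffAt_bezier (fun i => hP _) h0
    have hgc : ContMDiffAt 𝓘(ℝ, ℝ) (𝓡 n) 1 g 1 := hU.contMDiffAt_bezier (fun i => hP _) h0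
    have hf0 : f 1 = P (Fin.last (k + 1)).castSucc := hU.bezier_one fun i => hP _
    have hg0 : g 1 = P (Fin.last (k + 2)) := hU.bezier_one fun i => hP _
    refine (hU.velocity_geod_comp (f := f) (g := g) h0 hfc hgc (hf0 ▸ hP _) (hg0 ▸ hP _)
      (b := k + 1) (ξ := expVel (riemLog U (P (Fin.last (k + 1)).castSucc) (P (Fin.last (k + 2)))))
      ?_ ?_).trans (by push_cast; rfl)
    · rw [hf0, hg0]
      exact (hU.velocity_geod (hP _) (hP _)).2
    · have hev : (fun t => geod (n := n) U 1 (f t) (g t)) =ᶠ[𝓝 1] g := by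
        filter_upwards [hfc.continuousAt.eventually_mem (hU.1.mem_nhds (hf0 ▸ hP _)),
          hgc.continuousAt.eventually_mem (hU.1.mem_nhds (hg0 ▸ hP _))] with t h1 h2
        exact hU.geod_one h1 h2
      rw [velocity_congr hev]
      exact ih fun i => hP _

end BezierCurves

/-! ### Gluing curves and geodesics -/

section Gluing

variable {n : ℕ} {M : Type*} [TopologicalSpace M]
  [ChartedSpace (EuclideanSpace ℝ (Fin n)) M] [IsManifold (𝓡 n) ∞ M]

local notation "𝔼" => EuclideanSpace ℝ (Fin n)

theorem hasDerivAt_ite_le {E : Type*} [NormedAddCommGroup E] [NormedSpace ℝ E] {x y x' y' : ℝ → E}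
    {b u : ℝ} (hx : HasDerivAt x (x' u) u) (hy : HasDerivAt y (y' u) u) (h : x b = y b)
    (h' : x' b = y' b) :
    HasDerivAt (fun u => if u ≤ b then x u else y u) (if u ≤ b then x' u else y' u) u := by
  rcases lt_trichotomy u b with hub | rfl | hub
  · rw [if_pos hub.le]
    refine hx.congr_of_eventuallyEq ?_
    filter_upwards [Iio_mem_nhds hub] with v hv
    exact if_pos (le_of_lt hv)
  · rw [if_pos le_rfl]
    have h1 : HasDerivWithinAt (fun v => if v ≤ u then x v else y v) (x' u) (Iic u) u :=
      hx.hasDerivWithinAt.congr (fun v hv => if_pos hv) (if_pos le_rfl)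
    have h2 : HasDerivWithinAt (fun v => if v ≤ u then x v else y v) (x' u) (Ici u) u := by
      rw [h']
      refine hy.hasDerivWithinAt.congr (fun v hv => ?_) (by rw [if_pos le_rfl, h])
      rcases eq_or_lt_of_le (show u ≤ v from hv) with rfl | hv
      · rw [if_pos le_rfl, h]
      · exact if_neg (not_le.2 hv)
    have := h1.union h2
    rwa [Iic_union_Ici, hasDerivWithinAt_univ] at this
  · rw [if_neg (not_le.2 hub)]
    refine hy.congr_of_eventuallyEq ?_
    filter_upwards [Ioi_mem_nhds hub] with v hv
    exact if_neg (not_le.2 hv)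

theorem continuousAt_ite_le {E : Type*} [TopologicalSpace E] {x y : ℝ → E} {b u : ℝ}
    (hx : ContinuousAt x u) (hy : ContinuousAt y u) (h : x b = y b) :
    ContinuousAt (fun u => if u ≤ b then x u else y u) u := by
  rcases lt_trichotomy u b with hub | rfl | hub
  · refine hx.congr ?_
    filter_upwards [Iio_mem_nhds hub] with v hv
    exact (if_pos (le_of_lt hv)).symm
  · rw [continuousAt_iff_continuous_left'_right']
    refine ⟨?_, ?_⟩
    · exact hx.continuousWithinAt.congr (fun v hv => if_pos (le_of_lt hv)) (if_pos le_rfl)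
    · exact hy.continuousWithinAt.congr (fun v hv => if_neg (not_le.2 hv))
        (by rw [if_pos le_rfl, h])
  · refine hy.congr ?_
    filter_upwards [Ioi_mem_nhds hub] with v hv
    exact (if_neg (not_le.2 hv)).symm

theorem contDiffAt_ite_le {E : Type*} [NormedAddCommGroup E] [NormedSpace ℝ E] {x y : ℝ → E}
    {b : ℝ} (hx : ContDiffAt ℝ 1 x b) (hy : ContDiffAt ℝ 1 y b) (h : x b = y b)
    (h' : deriv x b = deriv y b) :
    ContDiffAt ℝ 1 (fun u => if u ≤ b then x u else y u) b := by
  have hx1 := (hx.eventually (by simp)).and (hy.eventually (by simp))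
  refine contDiffAt_succ_of_hasDerivAt (k := 0)
    (y := fun u => if u ≤ b then deriv x u else deriv y u) ?_ ?_
  · filter_upwards [hx1] with u hu
    exact hasDerivAt_ite_le (hu.1.differentiableAt (by simp)).hasDerivAt
      (hu.2.differentiableAt (by simp)).hasDerivAt h h'
  · refine contDiffAt_zero.2 ⟨_, hx1, fun u hu => ContinuousAt.continuousWithinAt ?_⟩
    exact continuousAt_ite_le (contDiffAt_deriv (m := 0) hu.1 (by simp)).continuousAt
      (contDiffAt_deriv (m := 0) hu.2 (by simp)).continuousAt h'

/-- Two `C¹` curves with the same velocity at time `b` are glued to a `C¹` curve. -/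
theorem contMDiffAt_ite_le {σ τ : ℝ → M} {b : ℝ} (hσ : ContMDiffAt 𝓘(ℝ, ℝ) (𝓡 n) 1 σ b)
    (hτ : ContMDiffAt 𝓘(ℝ, ℝ) (𝓡 n) 1 τ b) (h : velocity (n := n) σ b = velocity τ b) :
    ContMDiffAt 𝓘(ℝ, ℝ) (𝓡 n) 1 (fun u => if u ≤ b then σ u else τ u) b ∧
      velocity (n := n) (fun u => if u ≤ b then σ u else τ u) b = velocity σ b := by
  set c := σ b with hcdef
  have hc : σ b ∈ (extChartAt (𝓡 n) c).source := mem_extChartAt_source _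
  have hb : σ b = τ b := congrArg (fun ξ => ξ.proj) h
  have hc' : τ b ∈ (extChartAt (𝓡 n) c).source := hb ▸ hc
  have hxy := congrArg (tchart c) h
  rw [tchart_velocity c (hσ.mdifferentiableAt (by simp)) hc,
    tchart_velocity c (hτ.mdifferentiableAt (by simp)) hc'] at hxy
  have hx := contDiffAt_chart_comp (k := 1) (by simp) c hσ hc
  have hy := contDiffAt_chart_comp (k := 1) (by simp) c hτ hc'
  have hz := contDiffAt_ite_le hx hy (congrArg Prod.fst hxy) (congrArg Prod.snd hxy)
  have hzd := hasDerivAt_ite_le (x' := fun u => deriv (fun u => extChartAt (𝓡 n) c (σ u)) u)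
    (y' := fun u => deriv (fun u => extChartAt (𝓡 n) c (τ u)) u) (b := b) (u := b)
    (hx.differentiableAt (by simp)).hasDerivAt
    (hy.differentiableAt (by simp)).hasDerivAt (congrArg Prod.fst hxy) (congrArg Prod.snd hxy)
  rw [if_pos le_rfl] at hzd
  set ρ : ℝ → M := fun u => if u ≤ b then σ u else τ u with hρ
  have hρb : ρ b = σ b := if_pos le_rfl
  have hρz : (fun u => extChartAt (𝓡 n) c (ρ u)) = fun u =>
      if u ≤ b then extChartAt (𝓡 n) c (σ u) else extChartAt (𝓡 n) c (τ u) :=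
    funext fun u => apply_ite _ _ _ _
  rw [← hρz] at hz hzd
  have hρc : ContMDiffAt 𝓘(ℝ, ℝ) (𝓡 n) 1 ρ b := by
    have h1 : ContMDiffAt 𝓘(ℝ, ℝ) (𝓡 n) 1
        (fun u => (extChartAt (𝓡 n) c).symm (extChartAt (𝓡 n) c (ρ u))) b := by
      refine ContMDiffAt.comp (g := (extChartAt (𝓡 n) c).symm) b ?_ hz.contMDiffAt
      exact (contMDiffAt_chart_symm c ((extChartAt (𝓡 n) c).map_source (hρb ▸ hc))).of_le (by simp)
    refine h1.congr_of_eventuallyEq ?_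
    filter_upwards [hσ.continuousAt.eventually_mem ((isOpen_extChartAt_source c).mem_nhds hc),
      hτ.continuousAt.eventually_mem ((isOpen_extChartAt_source c).mem_nhds hc')] with u h1 h2
    refine ((extChartAt (𝓡 n) c).left_inv ?_).symm
    by_cases hu : u ≤ b
    · simpa only [hρ, if_pos hu] using h1
    · simpa only [hρ, if_neg hu] using h2
  have hρs : ρ b ∈ (extChartAt (𝓡 n) c).source := hρb ▸ hc
  refine ⟨hρc, tangent_ext c hρs hc ?_⟩
  rw [tchart_velocity c (hρc.mdifferentiableAt (by simp)) hρs, hzd.deriv,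
    tchart_velocity c (hσ.mdifferentiableAt (by simp)) hc, hρb]

variable [T2Space M] [RiemannianBundle (fun x : M => TangentSpace (𝓡 n) x)]
  [IsContMDiffRiemannianBundle (𝓡 n) ∞ (EuclideanSpace ℝ (Fin n))
      (fun x : M => TangentSpace (𝓡 n) x)] {U : Set M}

/-- `exp (2 ξ)` is reached by continuing with the final velocity of the segment of `ξ`. -/
theorem ExpDefined.riemExp_expVel {ξ : TangentBundle (𝓡 n) M} (h : ExpDefined (fiberSmul 2 ξ)) :
    riemExp (expVel ξ) = riemExp (fiberSmul 2 ξ) := by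
  obtain ⟨σ, ⟨ε, hε, hσ⟩, h0⟩ := h
  have h1 := hσ.exp (s := 0) (t := 1 / 2) ⟨by linarith, by linarith⟩
    ⟨by linarith, by linarith⟩
  have h2 := hσ.exp (s := 1 / 2) (t := 1 / 2) ⟨by linarith, by linarith⟩
    ⟨by linarith, by linarith⟩
  have h3 := hσ.exp (s := 0) (t := 1) ⟨by linarith, by linarith⟩
    ⟨by linarith, by linarith⟩
  rw [h0, fiberSmul_fiberSmul] at h1 h3
  norm_num at h1 h2 h3
  rw [h1.2.2, h2.2.1, h3.2.1]

theorem ExpDefined.two_smul {ξ : TangentBundle (𝓡 n) M} (h : ExpDefined ξ)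
    (h' : ExpDefined (expVel ξ)) : ExpDefined (fiberSmul 2 ξ) := by
  obtain ⟨σ, ⟨ε, hε, hσ⟩, h0⟩ := h
  obtain ⟨τ, ⟨ε', hε', hτ⟩, h0'⟩ := h'
  rw [expVel_eq ⟨⟨ε, hε, hσ⟩, h0⟩] at h0'
  have hτ' := hτ.comp_affine 1 (-1)
  have hpre : (fun u : ℝ => 1 * u + -1) ⁻¹' Ioo (-ε') (1 + ε') = Ioo (1 - ε') (2 + ε') := by
    ext u
    simp only [mem_preimage, mem_Ioo]
    constructor <;> rintro ⟨h1, h2⟩ <;> constructor <;> linarith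
  rw [hpre] at hτ'
  have hv : velocity (n := n) σ 1 = velocity (fun u => τ (1 * u + -1)) 1 := by
    rw [velocity_comp_affine (hτ.mdifferentiableAt ⟨by linarith, by linarith⟩), fiberSmul_one,
      ← h0']
    norm_num
  obtain ⟨g1, g2, -⟩ := hσ.glue hτ' (t₀ := 1) ⟨by linarith, by linarith⟩
    ⟨by linarith, by linarith⟩ hv
  have := (g1.exp (s := 0) (t := 2) ⟨by linarith, by linarith⟩ ⟨by linarith, by linarith⟩).1
  rwa [g2 0 ⟨by linarith, by linarith⟩ zero_le_one, h0] at this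

end Gluing

/-! ### Splines -/

section Splines

variable {n : ℕ} {M : Type*} [TopologicalSpace M] [T2Space M]
  [ChartedSpace (EuclideanSpace ℝ (Fin n)) M] [IsManifold (𝓡 n) ∞ M]
  [RiemannianBundle (fun x : M => TangentSpace (𝓡 n) x)]
  [IsContMDiffRiemannianBundle (𝓡 n) ∞ (EuclideanSpace ℝ (Fin n))
      (fun x : M => TangentSpace (𝓡 n) x)] {U : Set M} {L : ℕ} {P : Fin L → Fin 4 → M}

/-- The join condition as an equality of velocities: the geodesic from `p_2` to `p_3` of a segment
arrives with the initial velocity of the geodesic from `p_0` to `p_1` of the next one. Its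
continuation ends at `p_1`, but normal convexity is needed to see that it stays in `U`. -/
theorem IsSplineControl.expVel_riemLog (hU : IsNormalConvex (n := n) U)
    (hP : IsSplineControl (n := n) U L P) (i : ℕ) (hi : i + 1 < L) :
    expVel (riemLog (n := n) U (P ⟨i, by omega⟩ 2) (P ⟨i, by omega⟩ 3))
      = riemLog U (P ⟨i + 1, hi⟩ 0) (P ⟨i + 1, hi⟩ 1) := by
  obtain ⟨h1, h2, h3⟩ := hU.riemLog_spec (hP.mem ⟨i, by omega⟩ 2) (hP.mem ⟨i, by omega⟩ 3)
  obtain ⟨h4, h5⟩ := hP.join_deriv i hi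
  have h6 := h4.riemExp_expVel
  rw [geod] at h5
  rw [h5] at h6
  set η := expVel (riemLog (n := n) U (P ⟨i, by omega⟩ 2) (P ⟨i, by omega⟩ 3)) with hη
  have h7 : η.proj = P ⟨i + 1, hi⟩ 0 := by rw [hη, expVel_proj, h3, hP.join i hi]
  have h8 : η.proj ∈ U := h7 ▸ hP.mem _ _
  have h9 := hU.riemLog_riemExp h8
    (hU.segmentIn_of_neg h8 h2.reverse.1 (h6 ▸ hP.mem _ _))
  rw [h7, h6] at h9
  exact h9.symm

/-- The curve `t ↦ β^{(i)} (t - i)`, written as an affine reparametrisation. -/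
def splinePiece (n : ℕ) {M : Type*} [TopologicalSpace M]
    [ChartedSpace (EuclideanSpace ℝ (Fin n)) M] [IsManifold (𝓡 n) ∞ M]
    [RiemannianBundle (fun x : M => TangentSpace (𝓡 n) x)] (U : Set M) {L : ℕ}
    (P : Fin L → Fin 4 → M) (i : Fin L) (t : ℝ) : M :=
  bezier (n := n) U 3 (P i) (1 * t + -((i : ℕ) : ℝ))

theorem contMDiffAt_splinePiece (hU : IsNormalConvex (n := n) U)
    (hP : IsSplineControl (n := n) U L P) (i : Fin L) {t : ℝ}
    (ht : t ∈ Icc ((i : ℕ) : ℝ) ((i : ℕ) + 1)) :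
    ContMDiffAt 𝓘(ℝ, ℝ) (𝓡 n) 1 (splinePiece n U P i) t := by
  refine ContMDiffAt.comp (g := bezier (n := n) U 3 (P i)) t
    (hU.contMDiffAt_bezier (hP.mem i) ⟨by linarith [ht.1], by linarith [ht.2]⟩) ?_
  rw [contMDiffAt_iff_contDiffAt]
  fun_prop

theorem velocity_splinePiece_left (hU : IsNormalConvex (n := n) U)
    (hP : IsSplineControl (n := n) U L P) (i : Fin L) :
    velocity (n := n) (splinePiece n U P i) (i : ℕ) = fiberSmul 3 (riemLog U (P i 0) (P i 1)) := by
  have e : 1 * ((i : ℕ) : ℝ) + -((i : ℕ) : ℝ) = 0 := by ring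
  have h := hU.contMDiffAt_bezier (hP.mem i) (t := 0) ⟨le_rfl, zero_le_one⟩
  refine (velocity_comp_affine (by rw [e]; exact h.mdifferentiableAt (by simp))).trans ?_
  rw [e, fiberSmul_one, hU.velocity_bezier_zero (hP.mem i)]
  norm_num

theorem velocity_splinePiece_right (hU : IsNormalConvex (n := n) U)
    (hP : IsSplineControl (n := n) U L P) (i : Fin L) :
    velocity (n := n) (splinePiece n U P i) ((i : ℕ) + 1)
      = fiberSmul 3 (expVel (riemLog U (P i 2) (P i 3))) := by
  have e : 1 * (((i : ℕ) : ℝ) + 1) + -((i : ℕ) : ℝ) = 1 := by ring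
  have h := hU.contMDiffAt_bezier (hP.mem i) (t := 1) ⟨zero_le_one, le_rfl⟩
  refine (velocity_comp_affine (by rw [e]; exact h.mdifferentiableAt (by simp))).trans ?_
  rw [e, fiberSmul_one, hU.velocity_bezier_one (hP.mem i)]
  norm_num
  rfl

variable {B : Spline n U L}

theorem IsSplineWithControl.curve_eqOn (hU : IsNormalConvex (n := n) U)
    (hP : IsSplineControl (n := n) U L P) (hB : IsSplineWithControl (n := n) U L P B.1)
    (i : Fin L) : EqOn B.curve (splinePiece n U P i) (Icc ((i : ℕ) : ℝ) ((i : ℕ) + 1)) := by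
  have hcurve : ∀ (j : Fin L) (t : ℝ), ((j : ℕ) : ℝ) ≤ t →
      (((j : ℕ) : ℝ) < t ∨ ((j : ℕ) = 0 ∧ t = 0)) → t ≤ ((j : ℕ) : ℝ) + 1 →
      B.curve t = splinePiece n U P j t := by
    intro j t h0 h1 h2
    have hj : ((j : ℕ) : ℝ) + 1 ≤ L := by exact_mod_cast j.2
    have ht : t ∈ Icc (0 : ℝ) L := ⟨(Nat.cast_nonneg _).trans h0, h2.trans hj⟩
    rw [Spline.curve, IccExtend_of_mem _ _ ht, hB j ⟨t, ht⟩ h1 h2, splinePiece, one_mul,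
      sub_eq_add_neg]
  intro t ht
  rcases eq_or_lt_of_le ht.1 with h | h
  · subst h
    obtain ⟨i, hi⟩ := i
    cases i with
    | zero => exact hcurve ⟨0, hi⟩ _ le_rfl (Or.inr ⟨rfl, by simp⟩) ht.2
    | succ k =>
      rw [hcurve ⟨k, by omega⟩ _ (by push_cast; linarith) (Or.inl (by push_cast; linarith))
        (by push_cast; linarith), splinePiece, splinePiece]
      have e1 : 1 * ((k + 1 : ℕ) : ℝ) + -(k : ℝ) = 1 := by push_cast; ring
      have e2 : 1 * ((k + 1 : ℕ) : ℝ) + -((k + 1 : ℕ) : ℝ) = 0 := by ring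
      simp only [e1, e2]
      rw [hU.bezier_one (hP.mem _), hU.bezier_zero (hP.mem _)]
      exact hP.join k hi
  · exact hcurve i t ht.1 (Or.inl h) ht.2

/-- Near the knot `k + 1`, a spline is a `C¹` curve, glued from two segments with the same
velocity. -/
theorem IsSplineWithControl.exists_knot (hU : IsNormalConvex (n := n) U)
    (hP : IsSplineControl (n := n) U L P) (hB : IsSplineWithControl (n := n) U L P B.1)
    (k : ℕ) (hk : k + 1 < L) : ∃ ρ : ℝ → M, ContMDiffAt 𝓘(ℝ, ℝ) (𝓡 n) 1 ρ (k + 1) ∧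
      velocity (n := n) ρ (k + 1) = velocity (splinePiece n U P ⟨k, by omega⟩) (k + 1) ∧
      velocity (n := n) ρ (k + 1) = velocity (splinePiece n U P ⟨k + 1, hk⟩) (k + 1) ∧
      B.curve =ᶠ[𝓝 ((k : ℝ) + 1)] ρ := by
  have h1 := velocity_splinePiece_right hU hP ⟨k, by omega⟩
  have h2 := velocity_splinePiece_left hU hP ⟨k + 1, hk⟩
  rw [← hP.expVel_riemLog hU k hk, ← h1] at h2
  simp only [Nat.cast_add, Nat.cast_one] at h2
  have c1 := contMDiffAt_splinePiece hU hP ⟨k, by omega⟩ (t := k + 1) ⟨by simp, by simp⟩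
  have c2 := contMDiffAt_splinePiece hU hP ⟨k + 1, hk⟩ (t := k + 1) ⟨by simp, by simp⟩
  obtain ⟨g1, g2⟩ := contMDiffAt_ite_le c1 c2 h2.symm
  refine ⟨_, g1, g2, g2.trans h2.symm, ?_⟩
  filter_upwards [Ioo_mem_nhds (show (k : ℝ) < k + 1 by linarith)
    (show (k : ℝ) + 1 < k + 2 by linarith)] with u hu
  by_cases h : u ≤ k + 1
  · rw [if_pos h]
    exact hB.curve_eqOn hU hP ⟨k, by omega⟩ ⟨hu.1.le, h⟩
  · rw [if_neg h]
    refine hB.curve_eqOn hU hP ⟨k + 1, hk⟩ ⟨?_, ?_⟩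
    · push_cast; linarith
    · push_cast; linarith [hu.2]

/-- Near each point of its `i`-th segment, a spline agrees on `[0, L]` with a `C¹` curve that has
the velocity of the segment there. -/
theorem IsSplineWithControl.exists_extension (hU : IsNormalConvex (n := n) U)
    (hP : IsSplineControl (n := n) U L P) (hB : IsSplineWithControl (n := n) U L P B.1)
    (i : Fin L) {t : ℝ} (ht : t ∈ Icc ((i : ℕ) : ℝ) ((i : ℕ) + 1)) :
    ∃ ρ : ℝ → M, ContMDiffAt 𝓘(ℝ, ℝ) (𝓡 n) 1 ρ t ∧
      velocity (n := n) ρ t = velocity (splinePiece n U P i) t ∧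
      B.curve =ᶠ[𝓝[Icc (0 : ℝ) L] t] ρ := by
  have hc := contMDiffAt_splinePiece hU hP i ht
  have heq := hB.curve_eqOn hU hP i
  obtain ⟨i, hi⟩ := i
  simp only at ht heq
  rcases eq_or_lt_of_le ht.1 with h | h
  · subst h
    cases i with
    | zero =>
      refine ⟨_, hc, rfl, ?_⟩
      filter_upwards [self_mem_nhdsWithin, mem_nhdsWithin_of_mem_nhds
        (Iio_mem_nhds (show ((0 : ℕ) : ℝ) < 1 by simp))] with u hu hu1
      exact heq ⟨by simpa using hu.1, by simpa using (le_of_lt hu1)⟩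
    | succ k =>
      obtain ⟨ρ, h1, h2, h3, h4⟩ := hB.exists_knot hU hP k hi
      have e : ((k + 1 : ℕ) : ℝ) = k + 1 := by push_cast; rfl
      simp only [e]
      exact ⟨ρ, h1, h3, h4.filter_mono nhdsWithin_le_nhds⟩
  · rcases eq_or_lt_of_le ht.2 with h' | h'
    · subst h'
      by_cases hL : i + 1 < L
      · obtain ⟨ρ, h1, h2, h3, h4⟩ := hB.exists_knot hU hP i hL
        exact ⟨ρ, h1, h2, h4.filter_mono nhdsWithin_le_nhds⟩
      · refine ⟨_, hc, rfl, ?_⟩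
        have hiL : (L : ℝ) = i + 1 := by
          have : L = i + 1 := by omega
          rw [this]; push_cast; rfl
        filter_upwards [self_mem_nhdsWithin, mem_nhdsWithin_of_mem_nhds (Ioi_mem_nhds h)]
          with u hu hu1
        exact heq ⟨le_of_lt hu1, hiL ▸ hu.2⟩
    · refine ⟨_, hc, rfl, Filter.EventuallyEq.filter_mono ?_ nhdsWithin_le_nhds⟩
      filter_upwards [Ioo_mem_nhds h h'] with u hu
      exact heq ⟨hu.1.le, hu.2.le⟩

/-- Every `t ∈ [0, L]` lies in the interval `(i, i + 1]` of one of the segments, or in `[0, 1]` for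
`i = 0`. -/
theorem exists_segment_index (hL : 1 ≤ L) {t : ℝ} (ht : t ∈ Icc (0 : ℝ) L) :
    ∃ i : Fin L, (((i : ℕ) : ℝ) < t ∨ ((i : ℕ) = 0 ∧ t = 0)) ∧ t ≤ ((i : ℕ) : ℝ) + 1 ∧
      ((i : ℕ) : ℝ) ≤ t := by
  rcases eq_or_lt_of_le ht.1 with h | h
  · exact ⟨⟨0, hL⟩, Or.inr ⟨rfl, h.symm⟩, by simp [← h], by simp [← h]⟩
  · have h1 : ⌈t⌉₊ ≤ L := Nat.ceil_le.2 ht.2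
    have h2 : 0 < ⌈t⌉₊ := Nat.ceil_pos.2 h
    obtain ⟨k, hk⟩ := Nat.exists_eq_succ_of_ne_zero h2.ne'
    have h3 : (k : ℝ) < t := Nat.lt_ceil.1 (by omega)
    have h4 : t ≤ (k : ℝ) + 1 := by
      have := Nat.le_ceil t
      rw [hk] at this
      push_cast at this
      exact this
    exact ⟨⟨k, by omega⟩, Or.inl h3, h4, h3.le⟩

theorem Spline.contMDiffOn_curve (hU : IsNormalConvex (n := n) U) (hL : 1 ≤ L)
    (B : Spline n U L) : ContMDiffOn 𝓘(ℝ, ℝ) (𝓡 n) 1 B.curve (Icc (0 : ℝ) L) := by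
  obtain ⟨P, hP, hB⟩ := B.2
  intro t ht
  obtain ⟨i, -, h2, h1⟩ := exists_segment_index hL ht
  obtain ⟨ρ, h3, -, h4⟩ := IsSplineWithControl.exists_extension hU hP hB i ⟨h1, h2⟩
  exact h3.contMDiffWithinAt.congr_of_eventuallyEq h4 (h4.eq_of_nhdsWithin ht)

theorem IsSplineWithControl.velocity_eq (hU : IsNormalConvex (n := n) U)
    (hP : IsSplineControl (n := n) U L P) (hB : IsSplineWithControl (n := n) U L P B.1)
    (i : Fin L) {t : ℝ} (ht : t ∈ Icc ((i : ℕ) : ℝ) ((i : ℕ) + 1)) :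
    B.velocity t = Bezierfold.velocity (splinePiece n U P i) t := by
  obtain ⟨ρ, h1, h2, h3⟩ := hB.exists_extension hU hP i ht
  have hi : ((i : ℕ) : ℝ) + 1 ≤ L := by exact_mod_cast i.2
  have ht' : t ∈ Icc (0 : ℝ) L := ⟨(Nat.cast_nonneg _).trans ht.1, ht.2.trans hi⟩
  have hL : (0 : ℝ) < L := lt_of_lt_of_le (by positivity) hi
  have hu : UniqueMDiffWithinAt 𝓘(ℝ, ℝ) (Icc (0 : ℝ) L) t :=
    ((uniqueDiffOn_Icc hL) t ht').uniqueMDiffWithinAt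
  have e : mfderivWithin 𝓘(ℝ, ℝ) (𝓡 n) B.curve (Icc (0 : ℝ) L) t = mfderiv 𝓘(ℝ, ℝ) (𝓡 n) ρ t := by
    rw [h3.mfderivWithin_eq (h3.eq_of_nhdsWithin ht'),
      mfderivWithin_eq_mfderiv hu (h1.mdifferentiableAt (by simp))]
  rw [← h2]
  exact tangent_mk_eq (h3.eq_of_nhdsWithin ht')
    (congrArg (fun A : ℝ →L[ℝ] EuclideanSpace ℝ (Fin n) => A 1) e)

theorem IsSplineWithControl.toTangent_castSucc (hU : IsNormalConvex (n := n) U)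
    (hP : IsSplineControl (n := n) U L P) (hB : IsSplineWithControl (n := n) U L P B.1)
    (i : Fin L) : toTangent B i.castSucc = riemLog U (P i 0) (P i 1) := by
  have := hB.velocity_eq hU hP i (t := (i : ℕ)) ⟨le_rfl, by simp⟩
  rw [toTangent, Fin.val_castSucc, this, velocity_splinePiece_left hU hP, fiberSmul_fiberSmul]
  norm_num

theorem IsSplineWithControl.toTangent_succ (hU : IsNormalConvex (n := n) U)
    (hP : IsSplineControl (n := n) U L P) (hB : IsSplineWithControl (n := n) U L P B.1)
    (i : Fin L) : toTangent B i.succ = expVel (riemLog U (P i 2) (P i 3)) := by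
  have := hB.velocity_eq hU hP i (t := (i : ℕ) + 1) ⟨by simp, le_rfl⟩
  rw [toTangent, Fin.val_succ, Nat.cast_add, Nat.cast_one, this, velocity_splinePiece_right hU hP,
    fiberSmul_fiberSmul]
  norm_num

/-- The control points of the spline with prescribed `ξ i = (B(i), Ḃ(i) / 3)`: the outer ones are
the positions at the knots, the inner ones are the endpoints of the geodesic segments of `ξ i` and
`- ξ (i + 1)`. -/
def controlPoints (ξ : Fin (L + 1) → TangentBundle (𝓡 n) M) (i : Fin L) : Fin 4 → M :=
  ![(ξ i.castSucc).proj, riemExp (ξ i.castSucc), riemExp (fiberSmul (-1) (ξ i.succ)),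
    (ξ i.succ).proj]

/-- The control points are determined by the positions and derivatives at the knots. -/
theorem IsSplineWithControl.eq_controlPoints (hU : IsNormalConvex (n := n) U)
    (hP : IsSplineControl (n := n) U L P) (hB : IsSplineWithControl (n := n) U L P B.1) :
    P = controlPoints (toTangent B) := by
  funext i
  obtain ⟨h1, h2, h3⟩ := hU.riemLog_spec (hP.mem i 0) (hP.mem i 1)
  obtain ⟨h4, h5, h6⟩ := hU.riemLog_spec (hP.mem i 2) (hP.mem i 3)
  rw [controlPoints, hB.toTangent_castSucc hU hP, hB.toTangent_succ hU hP, h1, h3, expVel_proj, h6,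
    h5.reverse.2.1, h4]
  funext j
  fin_cases j <;> rfl

theorem toTangent_injective (hU : IsNormalConvex (n := n) U) (hL : 1 ≤ L) :
    Function.Injective (toTangent : Spline n U L → _) := by
  intro B B' h
  obtain ⟨P, hP, hB⟩ := B.2
  obtain ⟨P', hP', hB'⟩ := B'.2
  have e : P = P' := by
    rw [IsSplineWithControl.eq_controlPoints hU hP hB, h,
      ← IsSplineWithControl.eq_controlPoints hU hP' hB']
  subst e
  refine Subtype.ext (funext fun t => Subtype.ext ?_)
  obtain ⟨i, h1, h2, -⟩ := exists_segment_index hL t.2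
  rw [hB i t h1 h2, hB' i t h1 h2]

theorem toTangent_mem_admissible (hU : IsNormalConvex (n := n) U) (hL : 1 ≤ L)
    (B : Spline n U L) : toTangent B ∈ admissible n U L := by
  obtain ⟨P, hP, hB⟩ := B.2
  have key1 : ∀ i : Fin L, (toTangent B i.castSucc).proj ∈ U ∧
      SegmentIn U (toTangent B i.castSucc) := by
    intro i
    obtain ⟨h1, h2, h3⟩ := hU.riemLog_spec (hP.mem i 0) (hP.mem i 1)
    rw [IsSplineWithControl.toTangent_castSucc hU hP hB]
    exact ⟨by rw [h1]; exact hP.mem i 0, h2⟩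
  have key2 : ∀ i : Fin L, (toTangent B i.succ).proj ∈ U ∧
      SegmentIn U (fiberSmul (-1) (toTangent B i.succ)) := by
    intro i
    obtain ⟨h1, h2, h3⟩ := hU.riemLog_spec (hP.mem i 2) (hP.mem i 3)
    rw [IsSplineWithControl.toTangent_succ hU hP hB]
    exact ⟨by rw [expVel_proj]; exact h2.riemExp_mem, h2.reverse.1⟩
  intro j
  refine ⟨?_, fun hj => (key1 ⟨j, hj⟩).2, fun hj => ?_⟩
  · rcases Nat.lt_or_ge j L with h | h
    · exact (key1 ⟨j, h⟩).1
    · have e : j = (⟨L - 1, by omega⟩ : Fin L).succ := Fin.ext (by simp; omega)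
      rw [e]
      exact (key2 _).1
  · have e : j = (⟨j - 1, by omega⟩ : Fin L).succ := Fin.ext (by simp; omega)
    rw [e]
    exact (key2 _).2

/-- The geodesic from `exp (-ξ)` to the base point of `ξ` arrives there with velocity `ξ`. -/
theorem IsNormalConvex.riemLog_neg (hU : IsNormalConvex (n := n) U) {ξ : TangentBundle (𝓡 n) M}
    (h : SegmentIn U (fiberSmul (-1) ξ)) :
    ExpDefined (riemLog (n := n) U (riemExp (fiberSmul (-1) ξ)) ξ.proj) ∧
      expVel (riemLog (n := n) U (riemExp (fiberSmul (-1) ξ)) ξ.proj) = ξ := by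
  obtain ⟨h1, h2, h3⟩ := h.reverse
  have h4 : (fiberSmul (-1) (expVel (fiberSmul (-1) ξ))).proj = riemExp (fiberSmul (-1) ξ) :=
    expVel_proj _
  have h5 := hU.riemLog_riemExp (by rw [h4]; exact h.riemExp_mem) h1
  rw [h4, h2] at h5
  rw [fiberSmul_proj] at h5
  rw [h5, h3, fiberSmul_fiberSmul]
  exact ⟨h1.expDefined, by norm_num⟩

/-- At an inner knot, both the forward and the backward segment of `ξ i` lie in `U`, and together
they form the geodesic required by the join condition. -/
theorem isSplineControl_controlPoints (hU : IsNormalConvex (n := n) U)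
    {ξ : Fin (L + 1) → TangentBundle (𝓡 n) M} (hξ : ξ ∈ admissible n U L) :
    IsSplineControl (n := n) U L (controlPoints ξ) where
  mem i j := by
    have h1 := hξ i.castSucc
    have h2 := hξ i.succ
    have h3 := (h1.2.1 (by simp)).riemExp_mem
    have h4 := (h2.2.2 (by simp)).riemExp_mem
    fin_cases j
    exacts [h1.1, h3, h4, h2.1]
  join i h := rfl
  join_deriv i h := by
    have h2 := hξ (⟨i + 1, by omega⟩ : Fin (L + 1))
    obtain ⟨h3, h4⟩ := hU.riemLog_neg (h2.2.2 (by simp))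
    have h5 := h3.two_smul (by rw [h4]; exact (h2.2.1 h).expDefined)
    refine ⟨h5, h5.riemExp_expVel.symm.trans ?_⟩
    exact congrArg riemExp h4

omit [T2Space M] [IsContMDiffRiemannianBundle (𝓡 n) ∞ (EuclideanSpace ℝ (Fin n))
  (fun x : M => TangentSpace (𝓡 n) x)] in
theorem exists_spline (hU : IsNormalConvex (n := n) U) (hL : 1 ≤ L)
    (hP : IsSplineControl (n := n) U L P) :
    ∃ B : Spline n U L, IsSplineWithControl (n := n) U L P B.1 := by
  have key : ∀ t : Icc (0 : ℝ) L, ∃ i : Fin L, (((i : ℕ) : ℝ) < t ∨ ((i : ℕ) = 0 ∧ (t : ℝ) = 0)) ∧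
      (t : ℝ) ≤ ((i : ℕ) : ℝ) + 1 ∧ ((i : ℕ) : ℝ) ≤ t := fun t => exists_segment_index hL t.2
  choose i h1 h2 h3 using key
  let f : Icc (0 : ℝ) L → U := fun t => ⟨bezier (n := n) U 3 (P (i t)) ((t : ℝ) - ((i t : ℕ) : ℝ)),
    hU.bezier_mem (hP.mem _) ⟨by linarith [h3 t], by linarith [h2 t]⟩⟩
  have hf : IsSplineWithControl (n := n) U L P f := by
    intro j t h4 h5
    -- the half-open intervals of different segments are disjoint
    have e : i t = j := by
      refine Fin.ext ?_
      rcases h1 t with h6 | ⟨h6, h6'⟩ <;> rcases h4 with h7 | ⟨h7, h7'⟩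
      · have a1 : ((i t : ℕ) : ℝ) < (j : ℕ) + 1 := h6.trans_le h5
        have a2 : ((j : ℕ) : ℝ) < (i t : ℕ) + 1 := h7.trans_le (h2 t)
        norm_cast at a1 a2
        omega
      · rw [h7'] at h6
        exact absurd h6 (not_lt.2 (Nat.cast_nonneg _))
      · rw [h6'] at h7
        exact absurd h7 (not_lt.2 (Nat.cast_nonneg _))
      · rw [h6, h7]
    rw [← e]
  exact ⟨⟨f, P, hP, hf⟩, hf⟩

theorem range_toTangent (hU : IsNormalConvex (n := n) U) (hL : 1 ≤ L) :
    range (toTangent : Spline n U L → _) = admissible n U L := by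
  refine Subset.antisymm (range_subset_iff.2 (toTangent_mem_admissible hU hL)) fun ξ hξ => ?_
  have hP := isSplineControl_controlPoints hU hξ
  obtain ⟨B, hB⟩ := exists_spline hU hL hP
  refine ⟨B, funext fun j => ?_⟩
  rcases Nat.lt_or_ge j L with h | h
  · refine (hB.toTangent_castSucc hU hP ⟨j, h⟩).trans ?_
    exact hU.riemLog_riemExp (hξ j).1 ((hξ j).2.1 h)
  · have e : j = (⟨L - 1, by omega⟩ : Fin L).succ := Fin.ext (by simp; omega)
    have hj : 0 < (j : ℕ) := by omega
    have h1 := (hU.riemLog_neg ((hξ j).2.2 hj)).2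
    rw [e] at h1 ⊢
    exact (hB.toTangent_succ hU hP _).trans h1

omit [T2Space M] [IsManifold (𝓡 n) ∞ M] [IsContMDiffRiemannianBundle (𝓡 n) ∞
  (EuclideanSpace ℝ (Fin n)) (fun x : M => TangentSpace (𝓡 n) x)] in
theorem admissible_eq_univ (hc : ∀ ξ : TangentBundle (𝓡 n) M, ExpDefined ξ) :
    admissible n (univ : Set M) L = univ :=
  eq_univ_of_forall fun _ _ => ⟨mem_univ _, fun _ _ _ => ⟨hc _, mem_univ _⟩,
    fun _ _ _ => ⟨hc _, mem_univ _⟩⟩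

theorem isOpen_admissible (hU : IsOpen U) : IsOpen (admissible n U L) := by
  have e : admissible n U L = ⋂ i : Fin (L + 1), {ξ | (ξ i).proj ∈ U ∧
    ((i : ℕ) < L → SegmentIn U (ξ i)) ∧ (0 < (i : ℕ) → SegmentIn U (fiberSmul (-1) (ξ i)))} := by
    ext ξ; simp [admissible]
  rw [e]
  refine isOpen_iInter_of_finite fun i => ?_
  have h1 : IsOpen {ξ : Fin (L + 1) → TangentBundle (𝓡 n) M | (ξ i).proj ∈ U} :=
    hU.preimage (continuous_proj.comp (continuous_apply i))
  have h2 : IsOpen {ξ : Fin (L + 1) → TangentBundle (𝓡 n) M | SegmentIn U (ξ i)} :=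
    IsOpen.preimage (f := fun ξ : Fin (L + 1) → TangentBundle (𝓡 n) M => ξ i) (continuous_apply i)
      (isOpen_segmentIn hU)
  have h3 : IsOpen {ξ : Fin (L + 1) → TangentBundle (𝓡 n) M | SegmentIn U (fiberSmul (-1) (ξ i))} :=
    (isOpen_segmentIn hU).preimage
      (continuous_fiberSmul.comp (continuous_const.prodMk (continuous_apply i)))
  by_cases hi : (i : ℕ) < L <;> by_cases hi' : 0 < (i : ℕ)
  · simpa [hi, hi', ofPred_and] using h1.inter (h2.inter h3)
  · simpa [hi, hi', ofPred_and] using h1.inter h2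
  · simpa [hi, hi', ofPred_and] using h1.inter h3
  · simpa [hi, hi', ofPred_and] using h1

end Splines

/-! ### Products and transport of manifold structures -/

section Transport

theorem contDiffOn_of_mem_atlas {E H : Type*} [NormedAddCommGroup E] [NormedSpace ℝ E]
    [TopologicalSpace H] (I : ModelWithCorners ℝ E H) {k : WithTop ℕ∞} {W : Type*}
    [TopologicalSpace W] [ChartedSpace H W] [IsManifold I k W] {c c' : OpenPartialHomeomorph W H}
    (hc : c ∈ atlas H W) (hc' : c' ∈ atlas H W) :
    ContDiffOn ℝ k (I ∘ (c.symm ≫ₕ c') ∘ I.symm)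
      (I.symm ⁻¹' (c.symm ≫ₕ c').source ∩ range I) := by
  have h := HasGroupoid.compatible (G := contDiffGroupoid k I) hc hc'
  rw [contDiffGroupoid, mem_groupoid_of_pregroupoid] at h
  exact h.1

section Pi

variable {ι : Type*} [Fintype ι] {E : ι → Type*} [∀ i, NormedAddCommGroup (E i)]
  [∀ i, NormedSpace ℝ (E i)] {H : ι → Type*} [∀ i, TopologicalSpace (H i)]
  (I : ∀ i, ModelWithCorners ℝ (E i) (H i))

theorem boundaryless_pi [∀ i, (I i).Boundaryless] : (ModelWithCorners.pi I).Boundaryless := by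
  refine ⟨eq_univ_of_forall fun y => ?_⟩
  refine ⟨fun i => (I i).symm (y i), funext fun i => ?_⟩
  exact (I i).right_inv ((I i).range_eq_univ ▸ mem_univ _)

theorem isManifold_pi {k : WithTop ℕ∞} {M : ι → Type*} [∀ i, TopologicalSpace (M i)]
    [∀ i, ChartedSpace (H i) (M i)] [∀ i, IsManifold (I i) k (M i)] :
    IsManifold (ModelWithCorners.pi I) k (∀ i, M i) := by
  refine isManifold_of_contDiffOn _ _ _ ?_
  rintro _ _ ⟨c, hc, rfl⟩ ⟨c', hc', rfl⟩
  refine contDiffOn_pi.2 fun i => ?_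
  refine (contDiffOn_of_mem_atlas (I i) (hc i (mem_univ i)) (hc' i (mem_univ i))).comp
    (ContinuousLinearMap.proj (R := ℝ) (φ := E) i).contDiff.contDiffOn ?_
  rintro x ⟨⟨h1, h2⟩, y, rfl⟩
  exact ⟨⟨h1 i (mem_univ i), h2 i (mem_univ i)⟩, y i, rfl⟩

end Pi

variable {E H : Type*} [NormedAddCommGroup E] [NormedSpace ℝ E] [TopologicalSpace H]
  {I : ModelWithCorners ℝ E H} [I.Boundaryless] {W : Type*} [TopologicalSpace W]
  [ChartedSpace H W] [IsManifold I ∞ W] {E' : Type*} [NormedAddCommGroup E'] [NormedSpace ℝ E']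

/-- A set in bijection with a smooth boundaryless manifold carries a smooth structure, modelled on
any linearly isomorphic vector space, for which the bijection is a diffeomorphism. -/
theorem exists_transport (e : E ≃L[ℝ] E') {S : Type*} (Φ : S ≃ W) :
    ∃ (_ : TopologicalSpace S) (_ : ChartedSpace E' S),
      (T2Space W → T2Space S) ∧ (SecondCountableTopology W → SecondCountableTopology S) ∧
      IsManifold 𝓘(ℝ, E') ∞ S ∧
      ∃ Ψ : Diffeomorph 𝓘(ℝ, E') I S W ∞, ∀ s, Ψ s = Φ s := by
  let tS : TopologicalSpace S := TopologicalSpace.induced Φ inferInstance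
  let h : S ≃ₜ W := Φ.toHomeomorphOfIsInducing ⟨rfl⟩
  let A : H ≃ₜ E' := I.toHomeomorph.trans e.toHomeomorph
  -- the charts of `S` are those of `W`, composed with `Φ` and with `e`
  let chart : OpenPartialHomeomorph W H → OpenPartialHomeomorph S E' := fun c =>
    (h.toOpenPartialHomeomorph ≫ₕ c) ≫ₕ A.toOpenPartialHomeomorph
  let cS : ChartedSpace E' S :=
    { atlas := chart '' atlas H W
      chartAt := fun s => chart (chartAt H (Φ s))
      mem_chart_source := fun s => ⟨⟨trivial, mem_chart_source H (Φ s)⟩, trivial⟩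
      chart_mem_atlas := fun s => mem_image_of_mem _ (chart_mem_atlas H _) }
  have hman : IsManifold 𝓘(ℝ, E') ∞ S := by
    refine isManifold_of_contDiffOn _ _ _ ?_
    rintro _ _ ⟨c, hc, rfl⟩ ⟨c', hc', rfl⟩
    have h1 := contDiffOn_of_mem_atlas I (k := ∞) hc hc'
    have h2 := e.contDiff.comp_contDiffOn (h1.comp (e.symm.contDiff (n := ∞)).contDiffOn
      (mapsTo_preimage e.symm _))
    refine (h2.mono ?_).congr ?_
    · rintro x ⟨⟨⟨-, hx⟩, hx', -⟩, -⟩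
      refine ⟨⟨hx.1, ?_⟩, by rw [I.range_eq_univ]; trivial⟩
      have := hx'.2
      simpa [chart, h, A] using this
    · rintro x -
      simp [chart, h, A]
  have hext : ∀ s s' : S, extChartAt 𝓘(ℝ, E') s s' = e (extChartAt I (Φ s) (Φ s')) :=
    fun _ _ => rfl
  have hext_symm : ∀ (s : S) (y : E'), (extChartAt 𝓘(ℝ, E') s).symm y
      = Φ.symm ((extChartAt I (Φ s)).symm (e.symm y)) := fun _ _ => rfl
  have hsm : ContMDiff 𝓘(ℝ, E') I ∞ Φ := by
    intro s
    have h1 : ContMDiffAt 𝓘(ℝ, E') 𝓘(ℝ, E') ∞ (extChartAt 𝓘(ℝ, E') s) s := contMDiffAt_extChartAt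
    have h2 : ContMDiffAt 𝓘(ℝ, E') 𝓘(ℝ, E) ∞ (fun s' => e.symm (extChartAt 𝓘(ℝ, E') s s')) s :=
      ContMDiffAt.comp (g := e.symm) s e.symm.contDiff.contMDiff.contMDiffAt h1
    have h3 : ContMDiffAt 𝓘(ℝ, E) I ∞ (extChartAt I (Φ s)).symm (extChartAt I (Φ s) (Φ s)) :=
      (contMDiffOn_extChartAt_symm (Φ s)).contMDiffAt
        ((isOpen_extChartAt_target (Φ s)).mem_nhds (mem_extChartAt_target (Φ s)))
    have h4 : ContMDiffAt 𝓘(ℝ, E') I ∞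
        (fun s' => (extChartAt I (Φ s)).symm (e.symm (extChartAt 𝓘(ℝ, E') s s'))) s := by
      refine ContMDiffAt.comp (g := (extChartAt I (Φ s)).symm) s ?_ h2
      rwa [hext, e.symm_apply_apply]
    refine h4.congr_of_eventuallyEq ?_
    filter_upwards [h.continuous.continuousAt.eventually_mem (extChartAt_source_mem_nhds (I := I)
      (Φ s))] with s' hs'
    rw [hext, e.symm_apply_apply]
    exact ((extChartAt I (Φ s)).left_inv hs').symm
  have hsm' : ContMDiff I 𝓘(ℝ, E') ∞ Φ.symm := by
    intro w
    obtain ⟨s, rfl⟩ := Φ.surjective w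
    have h1 : ContMDiffAt I 𝓘(ℝ, E) ∞ (extChartAt I (Φ s)) (Φ s) := contMDiffAt_extChartAt
    have h2 : ContMDiffAt I 𝓘(ℝ, E') ∞ (fun w => e (extChartAt I (Φ s) w)) (Φ s) :=
      ContMDiffAt.comp (g := e) (Φ s) e.contDiff.contMDiff.contMDiffAt h1
    have h3 : ContMDiffAt 𝓘(ℝ, E') 𝓘(ℝ, E') ∞ (extChartAt 𝓘(ℝ, E') s).symm
        (extChartAt 𝓘(ℝ, E') s s) :=
      (contMDiffOn_extChartAt_symm s).contMDiffAt
        ((isOpen_extChartAt_target s).mem_nhds (mem_extChartAt_target s))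
    have h4 : ContMDiffAt I 𝓘(ℝ, E') ∞
        (fun w => (extChartAt 𝓘(ℝ, E') s).symm (e (extChartAt I (Φ s) w))) (Φ s) :=
      ContMDiffAt.comp (g := (extChartAt 𝓘(ℝ, E') s).symm) (Φ s) h3 h2
    refine h4.congr_of_eventuallyEq ?_
    filter_upwards [extChartAt_source_mem_nhds (I := I) (Φ s)] with w hw
    rw [hext_symm, e.symm_apply_apply, (extChartAt I (Φ s)).left_inv hw]
  refine ⟨tS, cS, fun _ => h.symm.t2Space, fun _ => h.secondCountableTopology, hman,
    ⟨Φ, hsm, hsm'⟩, fun s => rfl⟩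

end Transport

section TangentTopology

variable {n : ℕ} {M : Type*} [TopologicalSpace M]
  [ChartedSpace (EuclideanSpace ℝ (Fin n)) M] [IsManifold (𝓡 n) ∞ M]

/-- Countably many charts of `M` cover it, and the charts of the tangent bundle over them cover the
tangent bundle. -/
theorem secondCountableTopology_tangentBundle [SecondCountableTopology M] :
    SecondCountableTopology (TangentBundle (𝓡 n) M) := by
  obtain ⟨s, hsc, hs⟩ := TopologicalSpace.countable_cover_nhds fun x : M => chart_source_mem_nhds
    (EuclideanSpace ℝ (Fin n)) x
  have : SecondCountableTopology
      (ModelProd (EuclideanSpace ℝ (Fin n)) (EuclideanSpace ℝ (Fin n))) :=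
    inferInstanceAs (SecondCountableTopology
      (EuclideanSpace ℝ (Fin n) × EuclideanSpace ℝ (Fin n)))
  refine ChartedSpace.secondCountable_of_countable_cover
    (ModelProd (EuclideanSpace ℝ (Fin n)) (EuclideanSpace ℝ (Fin n)))
    (s := (fun c : M => (⟨c, 0⟩ : TangentBundle (𝓡 n) M)) '' s) ?_ (hsc.image _)
  refine eq_univ_of_forall fun ξ => ?_
  have h1 : ξ.proj ∈ ⋃ x ∈ s, (chartAt (EuclideanSpace ℝ (Fin n)) x).source := hs ▸ mem_univ _
  obtain ⟨c, hc, hξ⟩ := mem_iUnion₂.1 h1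
  refine mem_iUnion₂.2 ⟨_, mem_image_of_mem _ hc, ?_⟩
  rw [TangentBundle.mem_chart_source_iff]
  exact hξ

end TangentTopology

/-! ### The Bézierfold -/

section Bezierfold

variable {n : ℕ} {M : Type*} [TopologicalSpace M] [T2Space M] [SecondCountableTopology M]
  [ChartedSpace (EuclideanSpace ℝ (Fin n)) M] [IsManifold (𝓡 n) ∞ M]
  [RiemannianBundle (fun x : M => TangentSpace (𝓡 n) x)]
  [IsContMDiffRiemannianBundle (𝓡 n) ∞ (EuclideanSpace ℝ (Fin n))
      (fun x : M => TangentSpace (𝓡 n) x)] {U : Set M} {L : ℕ}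

/-- The smooth structure of the Bézierfold, transported from the open set of admissible families. -/
theorem exists_manifold_structure (hU : IsNormalConvex (n := n) U) (hL : 1 ≤ L) :
    ∃ V : Opens (Fin (L + 1) → TangentBundle (𝓡 n) M),
      (V : Set (Fin (L + 1) → TangentBundle (𝓡 n) M)) = admissible n U L ∧
      ∃ (_ : TopologicalSpace (Spline n U L))
        (_ : ChartedSpace (EuclideanSpace ℝ (Fin ((2 * L + 2) * n))) (Spline n U L)),
        T2Space (Spline n U L) ∧
        SecondCountableTopology (Spline n U L) ∧
        IsManifold (𝓡 ((2 * L + 2) * n)) ∞ (Spline n U L) ∧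
        ∃ Φ : Diffeomorph (𝓡 ((2 * L + 2) * n))
            (ModelWithCorners.pi fun _ : Fin (L + 1) => (𝓡 n).tangent)
            (Spline n U L) V ∞,
          ∀ B : Spline n U L, (Φ B : Fin (L + 1) → TangentBundle (𝓡 n) M) = toTangent B := by
  let V : Opens (Fin (L + 1) → TangentBundle (𝓡 n) M) :=
    ⟨admissible n U L, isOpen_admissible hU.1⟩
  have : T2Space (TangentBundle (𝓡 n) M) := t2Space_tangentBundle
  have : SecondCountableTopology (TangentBundle (𝓡 n) M) := secondCountableTopology_tangentBundle
  have : IsManifold (ModelWithCorners.pi fun _ : Fin (L + 1) => (𝓡 n).tangent) ∞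
      (Fin (L + 1) → TangentBundle (𝓡 n) M) := isManifold_pi _
  have : (ModelWithCorners.pi fun _ : Fin (L + 1) => (𝓡 n).tangent).Boundaryless :=
    boundaryless_pi _
  let F : Spline n U L ≃ V := Equiv.ofBijective
    (fun B => ⟨toTangent B, toTangent_mem_admissible hU hL B⟩)
    ⟨fun B B' h => toTangent_injective hU hL (congrArg Subtype.val h), fun ξ => by
      obtain ⟨B, hB⟩ := (range_toTangent hU hL).ge ξ.2
      exact ⟨B, Subtype.ext hB⟩⟩
  let e : (Fin (L + 1) → EuclideanSpace ℝ (Fin n) × EuclideanSpace ℝ (Fin n)) ≃L[ℝ]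
      EuclideanSpace ℝ (Fin ((2 * L + 2) * n)) := ContinuousLinearEquiv.ofFinrankEq (by
    rw [Module.finrank_pi_fintype]
    simp
    ring)
  obtain ⟨tS, cS, h1, h2, h3, Ψ, h4⟩ := exists_transport
    (I := ModelWithCorners.pi fun _ : Fin (L + 1) => (𝓡 n).tangent) (W := V) e F
  exact ⟨V, rfl, tS, cS, h1 inferInstance, h2 inferInstance, h3, Ψ,
    fun B => congrArg Subtype.val (h4 B)⟩

end Bezierfold

end Bezierfold

end

theorem mainTheorem1 {n : ℕ} {M : Type*} [TopologicalSpace M] [T2Space M]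
    [SecondCountableTopology M] [ChartedSpace (EuclideanSpace ℝ (Fin n)) M]
    [IsManifold (𝓡 n) ∞ M] [RiemannianBundle (fun x : M => TangentSpace (𝓡 n) x)]
    [IsContMDiffRiemannianBundle (𝓡 n) ∞ (EuclideanSpace ℝ (Fin n))
      (fun x : M => TangentSpace (𝓡 n) x)]
    (U : Set M) (hU : Bezierfold.IsNormalConvex (n := n) U) (L : ℕ) (hL : 1 ≤ L) :
    (∀ B : Bezierfold.Spline n U L,
      ContMDiffOn 𝓘(ℝ, ℝ) (𝓡 n) 1 B.curve (Icc (0 : ℝ) L)) ∧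
    Function.Injective (Bezierfold.toTangent : Bezierfold.Spline n U L → _) ∧
    range (Bezierfold.toTangent : Bezierfold.Spline n U L → _)
      = Bezierfold.admissible n U L ∧
    (U = univ → (∀ ξ : TangentBundle (𝓡 n) M, Bezierfold.ExpDefined ξ) →
      Function.Bijective (Bezierfold.toTangent : Bezierfold.Spline n U L → _)) ∧
    ∃ V : Opens (Fin (L + 1) → TangentBundle (𝓡 n) M),
      (V : Set (Fin (L + 1) → TangentBundle (𝓡 n) M)) = Bezierfold.admissible n U L ∧
      ∃ (_ : TopologicalSpace (Bezierfold.Spline n U L))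
        (_ : ChartedSpace (EuclideanSpace ℝ (Fin ((2 * L + 2) * n))) (Bezierfold.Spline n U L)),
        T2Space (Bezierfold.Spline n U L) ∧
        SecondCountableTopology (Bezierfold.Spline n U L) ∧
        IsManifold (𝓡 ((2 * L + 2) * n)) ∞ (Bezierfold.Spline n U L) ∧
        ∃ Φ : Diffeomorph (𝓡 ((2 * L + 2) * n))
            (ModelWithCorners.pi fun _ : Fin (L + 1) => (𝓡 n).tangent)
            (Bezierfold.Spline n U L) V ∞,
          ∀ B : Bezierfold.Spline n U L,
            (Φ B : Fin (L + 1) → TangentBundle (𝓡 n) M) = Bezierfold.toTangent B := by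
  refine ⟨Bezierfold.Spline.contMDiffOn_curve hU hL, Bezierfold.toTangent_injective hU hL,
    Bezierfold.range_toTangent hU hL, ?_, Bezierfold.exists_manifold_structure hU hL⟩
  rintro rfl hc
  refine ⟨Bezierfold.toTangent_injective hU hL, range_eq_univ.1 ?_⟩
  rw [Bezierfold.range_toTangent hU hL, Bezierfold.admissible_eq_univ hc]
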